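/- **Corollary 5.3.** Let $\mathrm{Vir}$ be the Virasoro algebra: the complex Lie algebra with basis $\{d_i\ (i\in\mathbb Z),\ c\}$, where $c$ is central and $$[d_i,d_j]=(j-i)\,d_{i+j}+\delta_{i,-j}\,\frac{i^3-i}{12}\,c .$$ Let $n\ge 1$ be an integer, $\theta,\alpha\in\mathbb C$, $\lambda\in\mathbb C\setminus\{0\}$, $h\in\mathbb C[t]$, and $\mathbf a=(a_n,\dots,a_{2n})\in\mathbb C^{n+1}$; put $a_k=0$ for $k>2n$. Let $$\mathfrak b_{\lambda,n+1}=\mathrm{span}\{d_k-\lambda^{k-n}d_n \mid k\ge n+1\},$$ a Lie subalgebra of $\mathrm{Vir}$, and for $f\in\mathbb C[t]$ put $$F(f)=\frac{h(t)-h(\alpha)}{t-\alpha}\,f-f',\qquad G(f)=h(\alpha)f+tF(f).$$ Let $\mathbb C[t]_{\alpha,h,\mathbf a}$ be the space $\mathbb C[t]$ with the $\mathfrak b_{\lambda,n+1}$-module structure $$(d_k-\lambda^{k-n}d_n)\circ f=(k-n)\lambda^k\big(G(f)-(k+n)\alpha F(f)\big)+(a_k-\lambda^{k-n}a_n)f\qquad(k\ge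 n+1).$$ Let $N=U(\mathrm{Vir})\otimes_{U(\mathfrak b_{\lambda,n+1})}\mathbb C[t]_{\alpha,h,\mathbf a}$, where $U(\cdot)$ denotes the universal enveloping algebra, and $\mathrm{Ind}_{\theta,\lambda}(\mathbb C[t]_{\alpha,h,\mathbf a})=N/(c-\theta)N$. Then the $\mathrm{Vir}$-module $\mathrm{Ind}_{\theta,\lambda}(\mathbb C[t]_{\alpha,h,\mathbf a})$ is irreducible if and only if $\deg(h)=1$, $\alpha\neq 0$ and $(a_{2n-1},a_{2n})\neq(0,0)$, that is, $a_{2n-1}\neq 0$ or $a_{2n}\neq 0$. -/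

import Mathlib

open scoped TensorProduct Polynomial

attribute [local instance 100] LieRing.ofAssociativeRing

noncomputable section

namespace VirInd

/-! ### The Virasoro algebra -/

/-- The underlying space of the Virasoro algebra: finitely supported families of coefficients of
the `d i` (`i ∈ ℤ`), together with the coefficient of the central element `c`. -/
def Vir : Type := (ℤ →₀ ℂ) × ℂ

namespace Vir

instance : AddCommGroup Vir := inferInstanceAs (AddCommGroup ((ℤ →₀ ℂ) × ℂ))

instance : Module ℂ Vir := inferInstanceAs (Module ℂ ((ℤ →₀ ℂ) × ℂ))

/-- The basis vectors `d i`. -/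
def d (i : ℤ) : Vir := (Finsupp.single i 1, 0)

/-- The central element `c`. -/
def c : Vir := (0, 1)

/-- The linear map reading off the coefficients of the `d i`. -/
def coeff : Vir →ₗ[ℂ] (ℤ →₀ ℂ) := LinearMap.fst ℂ (ℤ →₀ ℂ) ℂ

/-- `[d i, d j] = (j - i) d (i + j) + δ_{i,-j} (i ^ 3 - i) / 12 c`. -/
def basisBracket (i j : ℤ) : Vir :=
  ((j : ℂ) - i) • d (i + j) + (if i = -j then (((i : ℂ) ^ 3 - i) / 12) • c else 0)

/-- The bilinear extension of `basisBracket` for which `c` is central. -/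
def bracketMap : Vir →ₗ[ℂ] Vir →ₗ[ℂ] Vir :=
  (Finsupp.linearCombination ℂ fun i : ℤ =>
    (Finsupp.linearCombination ℂ (basisBracket i)).comp coeff).comp coeff

instance : Bracket Vir Vir := ⟨fun x y => bracketMap x y⟩

theorem bracket_def (x y : Vir) : ⁅x, y⁆ = bracketMap x y := rfl

@[simp] theorem coeff_d (i : ℤ) : coeff (d i) = Finsupp.single i 1 := rfl

@[simp] theorem coeff_c : coeff c = 0 := rfl

theorem bracketMap_d_d (i j : ℤ) : bracketMap (d i) (d j) = basisBracket i j := by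
  simp [bracketMap]

theorem bracketMap_c_left (x : Vir) : bracketMap c x = 0 := by
  simp [bracketMap]

theorem bracketMap_c_right (x : Vir) : bracketMap x c = 0 := by
  simp only [bracketMap, LinearMap.comp_apply, Finsupp.linearCombination_apply, Finsupp.sum,
    LinearMap.sum_apply, LinearMap.smul_apply, coeff_c]
  simp

/-- Induction on the basis `d i` (`i ∈ ℤ`), `c`. -/
theorem induction_basis {p : Vir → Prop} (hadd : ∀ x y, p x → p y → p (x + y))
    (hsmul : ∀ (r : ℂ) x, p x → p (r • x)) (hd : ∀ i, p (d i)) (hc : p c) (x : Vir) : p x := by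
  have h1 : ∀ f : ℤ →₀ ℂ, p ((f, 0) : (ℤ →₀ ℂ) × ℂ) := by
    intro f
    induction f using Finsupp.induction_linear with
    | zero =>
      have := hsmul 0 _ hc
      rw [zero_smul] at this
      exact this
    | add f g hf hg =>
      have := hadd _ _ hf hg
      have e : ((f, 0) : (ℤ →₀ ℂ) × ℂ) + (g, 0) = (f + g, 0) := by simp
      exact e ▸ this
    | single i r =>
      have := hsmul r _ (hd i)
      have e : r • ((Finsupp.single i 1, 0) : (ℤ →₀ ℂ) × ℂ) = (Finsupp.single i r, 0) := by simp
      exact e ▸ this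
  obtain ⟨f, r⟩ := x
  have := hadd _ _ (h1 f) (hsmul r _ hc)
  have e : ((f, 0) : (ℤ →₀ ℂ) × ℂ) + r • ((0, 1) : (ℤ →₀ ℂ) × ℂ) = (f, r) := by simp
  exact e ▸ this

theorem bracketMap_skew (x y : Vir) : bracketMap x y = -bracketMap y x := by
  induction x using induction_basis with
  | hadd a b ha hb => simp [ha, hb, add_comm]
  | hsmul r a ha => simp [ha]
  | hc => simp [bracketMap_c_left, bracketMap_c_right]
  | hd i =>
    induction y using induction_basis with
    | hadd a b ha hb => simp [ha, hb, add_comm]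
    | hsmul r a ha => simp [ha]
    | hc => simp [bracketMap_c_left, bracketMap_c_right]
    | hd j =>
      rw [bracketMap_d_d, bracketMap_d_d, basisBracket, basisBracket, add_comm j i]
      by_cases h : i = -j
      · subst h
        rw [if_pos rfl, if_pos (by simp)]
        push_cast
        module
      · rw [if_neg h, if_neg (by omega)]
        module

theorem bracketMap_jacobi (x y z : Vir) :
    bracketMap x (bracketMap y z)
      = bracketMap (bracketMap x y) z + bracketMap y (bracketMap x z) := by
  induction x using induction_basis with
  | hadd a b ha hb => simp only [map_add, LinearMap.add_apply, ha, hb]; abel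
  | hsmul r a ha => simp only [map_smul, LinearMap.smul_apply, ha, smul_add]
  | hc => simp [bracketMap_c_left]
  | hd i =>
    induction y using induction_basis with
    | hadd a b ha hb => simp only [map_add, LinearMap.add_apply, ha, hb]; abel
    | hsmul r a ha => simp only [map_smul, LinearMap.smul_apply, ha, smul_add]
    | hc => simp [bracketMap_c_left, bracketMap_c_right]
    | hd j =>
      induction z using induction_basis with
      | hadd a b ha hb => simp only [map_add, ha, hb]; abel
      | hsmul r a ha => simp only [map_smul, ha, smul_add]
      | hc => simp [bracketMap_c_right]
      | hd k =>
        have h0 : ∀ (P : Prop) [Decidable P] (r : ℂ) (w : Vir),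
            bracketMap w (if P then r • c else 0) = 0 := by
          intro P _ r w
          split_ifs <;> simp [bracketMap_c_right]
        have h1 : ∀ (P : Prop) [Decidable P] (r : ℂ) (w : Vir),
            bracketMap (if P then r • c else 0) w = 0 := by
          intro P _ r w
          split_ifs <;> simp [bracketMap_c_left]
        simp only [bracketMap_d_d, basisBracket, map_add, LinearMap.add_apply, map_smul,
          LinearMap.smul_apply, h0, h1, add_zero]
        rw [show i + (j + k) = i + j + k by ring, show j + (i + k) = i + j + k by ring]
        by_cases h : i + j + k = 0
        · obtain rfl : k = -(i + j) := by omega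
          rw [if_pos (by omega), if_pos (by omega), if_pos (by omega)]
          push_cast
          module
        · rw [if_neg (by omega), if_neg (by omega), if_neg (by omega)]
          push_cast
          module

instance : LieRing Vir where
  add_lie x y z := by simp [bracket_def]
  lie_add x y z := by simp [bracket_def]
  lie_self x := by
    have h : bracketMap x x + bracketMap x x = 0 := by
      nth_rewrite 1 [bracketMap_skew]
      simp
    rw [← two_smul ℂ, smul_eq_zero] at h
    simpa [bracket_def] using h
  leibniz_lie x y z := by simpa only [bracket_def] using bracketMap_jacobi x y z

instance : LieAlgebra ℂ Vir where
  lie_smul r x y := by simp [bracket_def]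

theorem lie_d_d (i j : ℤ) :
    ⁅d i, d j⁆ = ((j : ℂ) - i) • d (i + j)
      + (if i = -j then (((i : ℂ) ^ 3 - i) / 12) • c else 0) :=
  bracketMap_d_d i j

theorem lie_c_left (x : Vir) : ⁅c, x⁆ = 0 := bracketMap_c_left x

end Vir

open Vir

/-! ### Induced modules -/

section Induced

universe u v w

variable {R : Type u} {L : Type v} {M : Type w} [CommRing R] [LieRing L] [LieAlgebra R L]
  [AddCommGroup M] [Module R M]

/-- The homomorphism `U(𝔥) → U(L)` of a Lie subalgebra `𝔥` of `L`. -/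
def envelopingIncl (𝔥 : LieSubalgebra R L) :
    UniversalEnvelopingAlgebra R 𝔥 →ₐ[R] UniversalEnvelopingAlgebra R L :=
  UniversalEnvelopingAlgebra.lift R ((UniversalEnvelopingAlgebra.ι R).comp 𝔥.incl)

/-- The relations `u x ⊗ m = u ⊗ x m` for `u ∈ U(L)`, `x ∈ U(𝔥)`, `m ∈ M`, as a left
`U(L)`-submodule of `U(L) ⊗_R M`. The `𝔥`-module `M` is given by its representation `ρ`. -/
def inducedRel (𝔥 : LieSubalgebra R L) (ρ : 𝔥 →ₗ⁅R⁆ Module.End R M) :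
    Submodule (UniversalEnvelopingAlgebra R L) (UniversalEnvelopingAlgebra R L ⊗[R] M) :=
  Submodule.span _ {z | ∃ (u : UniversalEnvelopingAlgebra R L)
    (x : UniversalEnvelopingAlgebra R 𝔥) (m : M),
    z = (u * envelopingIncl 𝔥 x) ⊗ₜ[R] m
      - u ⊗ₜ[R] (UniversalEnvelopingAlgebra.lift R ρ x m)}

/-- The induced module `U(L) ⊗_{U(𝔥)} M`, with its left `U(L)`-module structure. -/
abbrev InducedModule (𝔥 : LieSubalgebra R L) (ρ : 𝔥 →ₗ⁅R⁆ Module.End R M) : Type (max v u w) :=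
  (UniversalEnvelopingAlgebra R L ⊗[R] M) ⧸ inducedRel 𝔥 ρ

end Induced

/-- For a `U(Vir)`-module `N`, the submodule `(c - θ) N`. -/
def centralSub (θ : ℂ) (N : Type*) [AddCommGroup N]
    [Module (UniversalEnvelopingAlgebra ℂ Vir) N] :
    Submodule (UniversalEnvelopingAlgebra ℂ Vir) N :=
  Submodule.span _ {z | ∃ x : N,
    z = (UniversalEnvelopingAlgebra.ι ℂ c
      - algebraMap ℂ (UniversalEnvelopingAlgebra ℂ Vir) θ) • x}

/-! ### The subalgebra `𝔟_{λ,n+1}` -/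

/-- `d k - λ ^ (k - n) d n`. -/
def bGen (n : ℕ) (lam : ℂˣ) (k : ℤ) : Vir := d k - ((lam ^ (k - n) : ℂˣ) : ℂ) • d n

theorem lie_bGen (n : ℕ) (lam : ℂˣ) (k l : ℤ) (hk : n + 1 ≤ k) (hl : n + 1 ≤ l) :
    ⁅bGen n lam k, bGen n lam l⁆ = ((l : ℂ) - k) • bGen n lam (k + l)
      - (((n : ℂ) - k) * ((lam ^ (l - n) : ℂˣ) : ℂ)) • bGen n lam (k + n)
      - (((l : ℂ) - n) * ((lam ^ (k - n) : ℂˣ) : ℂ)) • bGen n lam (n + l) := by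
  simp only [bGen, lie_sub, sub_lie, lie_smul, smul_lie, lie_d_d]
  rw [if_neg (by omega), if_neg (by omega), if_neg (by omega)]
  have e1 : lam ^ (k + l - n) = lam ^ (k - n) * lam ^ (l - n) * lam ^ (n : ℤ) := by
    rw [← zpow_add, ← zpow_add]; congr 1; ring
  have e2 : lam ^ (k + n - n) = lam ^ (k - n) * lam ^ (n : ℤ) := by
    rw [← zpow_add]; congr 1; ring
  have e3 : lam ^ (n + l - n) = lam ^ (l - n) * lam ^ (n : ℤ) := by
    rw [← zpow_add]; congr 1; ring
  have e4 : ⁅d (n : ℤ), d (n : ℤ)⁆ = 0 := lie_self _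
  rw [lie_d_d] at e4
  rw [e1, e2, e3, e4]
  push_cast
  module

/-- The Lie subalgebra `𝔟_{λ,n+1} = span {d k - λ ^ (k - n) d n | k ≥ n + 1}` of `Vir`. -/
def bAlg (n : ℕ) (lam : ℂˣ) : LieSubalgebra ℂ Vir where
  __ := Submodule.span ℂ {x : Vir | ∃ k : ℤ, n + 1 ≤ k ∧ x = bGen n lam k}
  lie_mem' := by
    intro x y hx hy
    simp only [AddSubsemigroup.mem_carrier, AddSubmonoid.mem_toSubsemigroup,
      Submodule.mem_toAddSubmonoid] at hx hy ⊢
    induction hx, hy using Submodule.span_induction₂ with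
    | mem_mem x y hx hy =>
      obtain ⟨k, hk, rfl⟩ := hx
      obtain ⟨l, hl, rfl⟩ := hy
      rw [lie_bGen n lam k l hk hl]
      refine Submodule.sub_mem _ (Submodule.sub_mem _ ?_ ?_) ?_ <;>
        exact Submodule.smul_mem _ _ (Submodule.subset_span ⟨_, by omega, rfl⟩)
    | zero_left => simp
    | zero_right => simp
    | add_left x y z _ _ _ hx hy => rw [add_lie]; exact Submodule.add_mem _ hx hy
    | add_right x y z _ _ _ hx hy => rw [lie_add]; exact Submodule.add_mem _ hx hy
    | smul_left r x y _ _ hx => rw [smul_lie]; exact Submodule.smul_mem _ _ hx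
    | smul_right r x y _ _ hx => rw [lie_smul]; exact Submodule.smul_mem _ _ hx

theorem bGen_mem (n : ℕ) (lam : ℂˣ) (k : ℤ) (hk : n + 1 ≤ k) : bGen n lam k ∈ bAlg n lam :=
  Submodule.subset_span ⟨k, hk, rfl⟩

/-! ### The `𝔟_{λ,n+1}`-module `ℂ[t]_{α,h,a}` -/

/-- `F(f) = (h(t) - h(α)) / (t - α) * f - f'`; the division is exact. -/
def opF (α : ℂ) (h : ℂ[X]) : Module.End ℂ ℂ[X] :=
  LinearMap.mulLeft ℂ ((h - Polynomial.C (h.eval α)) /ₘ (Polynomial.X - Polynomial.C α))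
    - Polynomial.derivative

/-- `G(f) = h(α) f + t F(f)`. -/
def opG (α : ℂ) (h : ℂ[X]) : Module.End ℂ ℂ[X] :=
  h.eval α • 1 + (LinearMap.mulLeft ℂ Polynomial.X).comp (opF α h)

theorem opG_opF (α : ℂ) (h f : ℂ[X]) :
    opG α h (opF α h f) = opF α h (opG α h f) + opF α h f := by
  simp [opG, opF, Polynomial.smul_eq_C_mul]
  ring

/-- The parameters `a k`, with the convention `a k = 0` for `k > 2 n`. -/
def aExt (n : ℕ) (a : ℤ → ℂ) (k : ℤ) : ℂ := if k ≤ 2 * n then a k else 0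

/-- The action of `d k - λ ^ (k - n) d n` on `ℂ[t]`:
`f ↦ (k - n) λ ^ k (G(f) - (k + n) α F(f)) + (a k - λ ^ (k - n) a n) f`. -/
def bOp (n : ℕ) (lam : ℂˣ) (α : ℂ) (h : ℂ[X]) (a : ℤ → ℂ) (k : ℤ) : Module.End ℂ ℂ[X] :=
  (((k : ℂ) - n) * ((lam ^ k : ℂˣ) : ℂ)) • (opG α h - (((k : ℂ) + n) * α) • opF α h)
    + (aExt n a k - ((lam ^ (k - n) : ℂˣ) : ℂ) * aExt n a n) • 1

/-- The linear map on `Vir` with `d k ↦ bOp k` and `c ↦ 0`. Since `bOp n = 0`, it sends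
`d k - λ ^ (k - n) d n` to `bOp k`; only its restriction to `𝔟_{λ,n+1}` is used. -/
def bActLin (n : ℕ) (lam : ℂˣ) (α : ℂ) (h : ℂ[X]) (a : ℤ → ℂ) :
    Vir →ₗ[ℂ] Module.End ℂ ℂ[X] :=
  (Finsupp.linearCombination ℂ (bOp n lam α h a)).comp coeff

theorem bActLin_bGen (n : ℕ) (lam : ℂˣ) (α : ℂ) (h : ℂ[X]) (a : ℤ → ℂ) (k : ℤ) :
    bActLin n lam α h a (bGen n lam k) = bOp n lam α h a k := by
  have h0 : bOp n lam α h a n = 0 := by simp [bOp]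
  simp [bActLin, bGen, h0]

theorem bActLin_lie_bGen (n : ℕ) (lam : ℂˣ) (α : ℂ) (h : ℂ[X]) (a : ℤ → ℂ) (k l : ℤ)
    (hk : n + 1 ≤ k) (hl : n + 1 ≤ l) :
    bActLin n lam α h a ⁅bGen n lam k, bGen n lam l⁆
      = ⁅bOp n lam α h a k, bOp n lam α h a l⁆ := by
  rw [lie_bGen n lam k l hk hl]
  simp only [map_sub, map_smul, bActLin_bGen]
  apply LinearMap.ext
  intro f
  have a1 : aExt n a (k + l) = 0 := if_neg (by omega)
  have a2 : aExt n a (k + n) = 0 := if_neg (by omega)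
  have a3 : aExt n a (n + l) = 0 := if_neg (by omega)
  have e1 : lam ^ (k + l - n) = lam ^ (k - n) * lam ^ (l - n) * lam ^ (n : ℤ) := by
    rw [← zpow_add, ← zpow_add]; congr 1; ring
  have e2 : lam ^ (k + n - n) = lam ^ (k - n) * lam ^ (n : ℤ) := by
    rw [← zpow_add]; congr 1; ring
  have e3 : lam ^ (n + l - n) = lam ^ (l - n) * lam ^ (n : ℤ) := by
    rw [← zpow_add]; congr 1; ring
  have e4 : lam ^ k = lam ^ (k - n) * lam ^ (n : ℤ) := by
    rw [← zpow_add]; congr 1; ring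
  have e5 : lam ^ l = lam ^ (l - n) * lam ^ (n : ℤ) := by
    rw [← zpow_add]; congr 1; ring
  simp only [bOp, LieRing.of_associative_ring_bracket, LinearMap.sub_apply,
    LinearMap.add_apply, LinearMap.smul_apply, Module.End.mul_apply, Module.End.one_apply,
    map_add, map_sub, map_smul, opG_opF, a1, a2, a3, e1, e2, e3, zpow_add, e4, e5]
  push_cast
  module

/-- The representation of `𝔟_{λ,n+1}` on `ℂ[t]` that makes it the module `ℂ[t]_{α,h,a}`. -/
def bRep (n : ℕ) (lam : ℂˣ) (α : ℂ) (h : ℂ[X]) (a : ℤ → ℂ) :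
    bAlg n lam →ₗ⁅ℂ⁆ Module.End ℂ ℂ[X] where
  __ := (bActLin n lam α h a).comp (bAlg n lam).toSubmodule.subtype
  map_lie' := by
    rintro ⟨x, hx⟩ ⟨y, hy⟩
    change bActLin n lam α h a ⁅x, y⁆ = ⁅bActLin n lam α h a x, bActLin n lam α h a y⁆
    change x ∈ Submodule.span ℂ _ at hx
    change y ∈ Submodule.span ℂ _ at hy
    induction hx, hy using Submodule.span_induction₂ with
    | mem_mem x y hx hy =>
      obtain ⟨k, hk, rfl⟩ := hx
      obtain ⟨l, hl, rfl⟩ := hy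
      rw [bActLin_lie_bGen n lam α h a k l hk hl, bActLin_bGen, bActLin_bGen]
    | zero_left => simp
    | zero_right => simp
    | add_left x y z _ _ _ hx hy => simp only [add_lie, map_add, hx, hy]
    | add_right x y z _ _ _ hx hy => simp only [lie_add, map_add, hx, hy]
    | smul_left r x y _ _ hx =>
      simp [smul_lie, hx, LieRing.of_associative_ring_bracket, smul_sub]
    | smul_right r x y _ _ hx =>
      simp [lie_smul, hx, LieRing.of_associative_ring_bracket, smul_sub]

/-- The defining formula of the module `ℂ[t]_{α,h,a}`. -/
theorem bRep_bGen (n : ℕ) (lam : ℂˣ) (α : ℂ) (h : ℂ[X]) (a : ℤ → ℂ) (k : ℤ) (hk : n + 1 ≤ k)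
    (f : ℂ[X]) :
    bRep n lam α h a ⟨bGen n lam k, bGen_mem n lam k hk⟩ f
      = (((k : ℂ) - n) * ((lam ^ k : ℂˣ) : ℂ)) • (opG α h f - (((k : ℂ) + n) * α) • opF α h f)
        + (aExt n a k - ((lam ^ (k - n) : ℂˣ) : ℂ) * aExt n a n) • f := by
  change bActLin n lam α h a (bGen n lam k) f = _
  rw [bActLin_bGen]
  rfl

/-! ### The `Vir`-module `Ind_{θ,λ}(ℂ[t]_{α,h,a})` -/

/-- `Ind_{θ,λ}(ℂ[t]_{α,h,a})`: the quotient of `U(Vir) ⊗_{U(𝔟_{λ,n+1})} ℂ[t]_{α,h,a}` by its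
submodule `(c - θ) (U(Vir) ⊗_{U(𝔟_{λ,n+1})} ℂ[t]_{α,h,a})`. -/
def IndMod (n : ℕ) (θ : ℂ) (lam : ℂˣ) (α : ℂ) (h : ℂ[X]) (a : ℤ → ℂ) : Type :=
  InducedModule (bAlg n lam) (bRep n lam α h a) ⧸
    centralSub θ (InducedModule (bAlg n lam) (bRep n lam α h a))

section

variable (n : ℕ) (θ : ℂ) (lam : ℂˣ) (α : ℂ) (h : ℂ[X]) (a : ℤ → ℂ)

instance : AddCommGroup (IndMod n θ lam α h a) :=
  inferInstanceAs (AddCommGroup (InducedModule (bAlg n lam) (bRep n lam α h a) ⧸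
    centralSub θ (InducedModule (bAlg n lam) (bRep n lam α h a))))

instance : Module (UniversalEnvelopingAlgebra ℂ Vir) (IndMod n θ lam α h a) :=
  inferInstanceAs (Module (UniversalEnvelopingAlgebra ℂ Vir)
    (InducedModule (bAlg n lam) (bRep n lam α h a) ⧸
      centralSub θ (InducedModule (bAlg n lam) (bRep n lam α h a))))

instance : Module ℂ (IndMod n θ lam α h a) :=
  inferInstanceAs (Module ℂ (InducedModule (bAlg n lam) (bRep n lam α h a) ⧸
    centralSub θ (InducedModule (bAlg n lam) (bRep n lam α h a))))

instance : IsScalarTower ℂ (UniversalEnvelopingAlgebra ℂ Vir) (IndMod n θ lam α h a) :=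
  inferInstanceAs (IsScalarTower ℂ (UniversalEnvelopingAlgebra ℂ Vir)
    (InducedModule (bAlg n lam) (bRep n lam α h a) ⧸
      centralSub θ (InducedModule (bAlg n lam) (bRep n lam α h a))))

/-- An element `x` of `Vir` acts as its image in `U(Vir)`. -/
instance : LieRingModule Vir (IndMod n θ lam α h a) where
  bracket x v := UniversalEnvelopingAlgebra.ι ℂ x • v
  add_lie x y v := by
    change UniversalEnvelopingAlgebra.ι ℂ (x + y) • v = _
    rw [map_add, add_smul]
  lie_add x v w := smul_add _ v w
  leibniz_lie x y v := by
    change UniversalEnvelopingAlgebra.ι ℂ x • UniversalEnvelopingAlgebra.ι ℂ y • v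
      = UniversalEnvelopingAlgebra.ι ℂ ⁅x, y⁆ • v
        + UniversalEnvelopingAlgebra.ι ℂ y • UniversalEnvelopingAlgebra.ι ℂ x • v
    rw [LieHom.map_lie, LieRing.of_associative_ring_bracket, sub_smul, mul_smul, mul_smul, sub_add_cancel]

instance : LieModule ℂ Vir (IndMod n θ lam α h a) where
  smul_lie r x v := by
    change UniversalEnvelopingAlgebra.ι ℂ (r • x) • v = r • (UniversalEnvelopingAlgebra.ι ℂ x • v)
    rw [map_smul, smul_assoc]
  lie_smul r x v := by
    change UniversalEnvelopingAlgebra.ι ℂ x • r • v = r • (UniversalEnvelopingAlgebra.ι ℂ x • v)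
    rw [← algebraMap_smul (UniversalEnvelopingAlgebra ℂ Vir) r v,
      ← algebraMap_smul (UniversalEnvelopingAlgebra ℂ Vir) r
        (UniversalEnvelopingAlgebra.ι ℂ x • v), smul_smul, smul_smul, Algebra.commutes]

end

end VirInd

end

/-! The induced module is identified with a tensor product Φ ⊗ W, and each factor is then analysed
separately.

Φ is ℂ[s] ⊗ ℂ[t] with the centreless action in which `d k` sends f ⊗ x to λ^k (s f(s - k) ⊗ x + f(s
- k) ⊗ (k G - k² α F) x). W is the universal Whittaker module of central charge θ: it is generated
by a vector v on which `d k` acts by a_k for k ≥ n, which is consistent because brackets of distinct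
such `d k` are multiples of some `d m` with m > 2n. On 1 ⊗ ℂ[t] the combination d_k - λ^(k-n) d_n
loses its s-term, and on 1 ⊗ x ⊗ v it reproduces the defining formula of ℂ[t]_{α,h,a}. Since `d n`
raises the degree in s by exactly one, Φ twisted by a is induced from 𝔟 to the span of the `d k`
with k ≥ n (`exists_phiLift`). The tensor identity Ind(ℂ_a ⊗ Res Φ) ≅ Φ ⊗ Ind ℂ_a then gives
`exists_ind_equiv`. W is realised on an explicit basis of ordered words, whose independence holds by
construction.

Every vector of W is killed by `d k` for large k. A submodule of Φ ⊗ W is therefore stable, for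
large k, under the action on Φ alone, which up to λ^k is polynomial in k; its coefficients can be
separated. When α ≠ 0 and F is injective, this reduces everything to subspaces of ℂ[t] ⊗ W stable
under F, G and Vir (`tens_irreducible`). If deg h = 1, then F is a nonzero constant minus d/dt, and
the reduction continues to submodules of W (`polyTensor_irreducible`). W is irreducible exactly when
a_{2n-1} or a_{2n} is nonzero, by a leading-term argument for a weight filtration
(`whit_irreducible`, `whit_reducible`). In the remaining cases an invariant subspace of ℂ[t] or of W
yields a proper submodule of the tensor product (`exists_invariant_polynomials`,
`exists_invariant_target`). -/

noncomputable section

namespace VirInd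

open Vir

/-! ### Representations of the Virasoro algebra given by operators -/

section Representation

variable {V : Type*} [AddCommGroup V] [Module ℂ V]

/-- The operators `D i` satisfy the Virasoro relations with central charge `θ`. -/
def IsVirAction (θ : ℂ) (D : ℤ → Module.End ℂ V) : Prop :=
  ∀ (i j : ℤ) (v : V), D i (D j v) - D j (D i v)
    = ((j : ℂ) - i) • D (i + j) v + (if i = -j then ((i : ℂ) ^ 3 - i) / 12 * θ else 0) • v

/-- The linear map reading off the coefficient of `c`. -/
def centralCoeff : Vir →ₗ[ℂ] ℂ := LinearMap.snd ℂ (ℤ →₀ ℂ) ℂ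

/-- The linear map `Vir → End V` with `d i ↦ D i` and `c ↦ θ`. -/
def virLin (θ : ℂ) (D : ℤ → Module.End ℂ V) : Vir →ₗ[ℂ] Module.End ℂ V :=
  (Finsupp.linearCombination ℂ D).comp coeff
    + (LinearMap.toSpanSingleton ℂ (Module.End ℂ V) (θ • 1)).comp centralCoeff

theorem virLin_d (θ : ℂ) (D : ℤ → Module.End ℂ V) (i : ℤ) : virLin θ D (d i) = D i := by
  have : centralCoeff (d i) = 0 := rfl
  rw [virLin, LinearMap.add_apply, LinearMap.comp_apply, LinearMap.comp_apply, this]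
  simp

theorem virLin_c (θ : ℂ) (D : ℤ → Module.End ℂ V) : virLin θ D c = θ • 1 := by
  have : centralCoeff c = 1 := rfl
  rw [virLin, LinearMap.add_apply, LinearMap.comp_apply, LinearMap.comp_apply, this]
  simp

/-- The representation of `Vir` given by operators satisfying the Virasoro relations. -/
def virRep (θ : ℂ) (D : ℤ → Module.End ℂ V) (hD : IsVirAction θ D) :
    Vir →ₗ⁅ℂ⁆ Module.End ℂ V where
  __ := virLin θ D
  map_lie' := by
    intro x y
    change virLin θ D ⁅x, y⁆ = ⁅virLin θ D x, virLin θ D y⁆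
    induction x using induction_basis with
    | hadd a b ha hb => simp only [add_lie, map_add, ha, hb]
    | hsmul r a ha =>
      simp only [smul_lie, map_smul, ha, LieRing.of_associative_ring_bracket, smul_sub,
        smul_mul_assoc, mul_smul_comm]
    | hc =>
      rw [lie_c_left, virLin_c, LieRing.of_associative_ring_bracket]
      simp
    | hd i =>
      induction y using induction_basis with
      | hadd a b ha hb => simp only [lie_add, map_add, ha, hb]
      | hsmul r a ha =>
        simp only [lie_smul, map_smul, ha, LieRing.of_associative_ring_bracket, smul_sub,
          smul_mul_assoc, mul_smul_comm]
      | hc =>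
        rw [← lie_skew, lie_c_left, virLin_c, LieRing.of_associative_ring_bracket]
        simp
      | hd j =>
        rw [lie_d_d, virLin_d, virLin_d, LieRing.of_associative_ring_bracket]
        ext v
        rw [LinearMap.sub_apply, Module.End.mul_apply, Module.End.mul_apply, hD i j v]
        split_ifs <;> simp [virLin_d, virLin_c, smul_smul]

theorem virRep_d (θ : ℂ) (D : ℤ → Module.End ℂ V) (hD : IsVirAction θ D) (i : ℤ) :
    virRep θ D hD (d i) = D i := virLin_d θ D i

theorem virRep_c (θ : ℂ) (D : ℤ → Module.End ℂ V) (hD : IsVirAction θ D) :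
    virRep θ D hD c = θ • 1 := virLin_c θ D

end Representation

/-! ### The action on ordered monomials -/

section Words

/-- The words labelling ordered monomials in the `d i` with `i < n`. -/
def IsWord (n : ℤ) (w : List ℤ) : Prop := w.Pairwise (· ≤ ·) ∧ ∀ i ∈ w, i < n

theorem isWord_nil (n : ℤ) : IsWord n [] := by simp [IsWord]

theorem isWord_cons {n x : ℤ} {w : List ℤ} :
    IsWord n (x :: w) ↔ x < n ∧ (∀ y ∈ w, x ≤ y) ∧ IsWord n w := by
  simp only [IsWord, List.pairwise_cons, List.forall_mem_cons]
  tauto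

theorem IsWord.orderedInsert {n x : ℤ} {w : List ℤ} (hw : IsWord n w) (hx : x < n) :
    IsWord n (w.orderedInsert (· ≤ ·) x) := by
  refine ⟨List.Pairwise.orderedInsert x w hw.1, fun i hi => ?_⟩
  rw [List.mem_orderedInsert] at hi
  rcases hi with rfl | hi
  · exact hx
  · exact hw.2 i hi

theorem orderedInsert_eq_cons {x : ℤ} {w : List ℤ} (h : ∀ y ∈ w, x ≤ y) :
    w.orderedInsert (· ≤ ·) x = x :: w := by
  cases w with
  | nil => rfl
  | cons y w => rw [List.orderedInsert, if_pos (h y (by simp))]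

variable (n : ℤ) (a : ℤ → ℂ) (θ : ℂ)

/-- The leading term of `d x` applied to a word. -/
def leadTerm (x : ℤ) (w : List ℤ) : List ℤ →₀ ℂ :=
  if x < n then Finsupp.single (w.orderedInsert (· ≤ ·) x) 1 else 0

/-- The coefficient of the identity in the bracket `[d x, d y]` at central charge `θ`. -/
def cocyc (x y : ℤ) : ℂ := if x = -y then ((x : ℂ) ^ 3 - x) / 12 * θ else 0

/-- The terms of length at most the length of the word in the action of `d x`, computed with a bound
on the depth of the recursion. -/
def lowTerm : ℕ → ℤ → List ℤ → (List ℤ →₀ ℂ)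
  | _, x, [] => if x < n then 0 else Finsupp.single [] (a x)
  -- A default value, never reached when the depth bound is at least the length of the word.
  | 0, _, _ :: _ => 0
  | p + 1, x, y :: w => if x < n ∧ x ≤ y then 0 else
      -- Here `d x` is commuted past `d y`. The words in `lowTerm p x w` need not be sublists of
      -- `w`, so the recursion descends on the bound `p`. The image under `d y` of the leading term
      -- of `d x w` is absent: it is the leading term for `y :: w`.
      Finsupp.linearCombination ℂ (fun u => leadTerm n y u + lowTerm p y u) (lowTerm p x w)
        + ((y : ℂ) - x) • (leadTerm n (x + y) w + lowTerm p (x + y) w)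
        + Finsupp.single w (cocyc θ x y)

/-- The span of the words of length at most `p`. -/
def wordsLE (p : ℕ) : Submodule ℂ (List ℤ →₀ ℂ) :=
  Finsupp.supported ℂ ℂ {u | IsWord n u ∧ u.length ≤ p}

theorem single_mem_wordsLE {p : ℕ} {w : List ℤ} (hw : IsWord n w) (hp : w.length ≤ p) (r : ℂ) :
    Finsupp.single w r ∈ wordsLE n p :=
  Finsupp.single_mem_supported ℂ _ ⟨hw, hp⟩

theorem wordsLE_mono {p q : ℕ} (h : p ≤ q) : wordsLE n p ≤ wordsLE n q :=
  Finsupp.supported_mono fun _ hu => ⟨hu.1, hu.2.trans h⟩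

theorem leadTerm_mem (x : ℤ) {w : List ℤ} (hw : IsWord n w) :
    leadTerm n x w ∈ wordsLE n (w.length + 1) := by
  unfold leadTerm
  split_ifs with h
  · exact single_mem_wordsLE n (hw.orderedInsert h) (by rw [List.orderedInsert_length]) _
  · exact Submodule.zero_mem _

theorem lowTerm_nil (p : ℕ) (x : ℤ) :
    lowTerm n a θ p x [] = if x < n then 0 else Finsupp.single [] (a x) := by
  cases p <;> rfl

theorem linearCombination_mem_of_supported {ι V : Type*} [AddCommGroup V] [Module ℂ V] {s : Set ι}
    {f : ι → V} {N : Submodule ℂ V} (h : ∀ i ∈ s, f i ∈ N) {v : ι →₀ ℂ}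
    (hv : v ∈ Finsupp.supported ℂ ℂ s) : Finsupp.linearCombination ℂ f v ∈ N := by
  rw [Finsupp.linearCombination_apply]
  exact Submodule.sum_mem _ fun i hi => N.smul_mem _ (h i (hv hi))

theorem linearCombination_congr_of_supported {ι V : Type*} [AddCommGroup V] [Module ℂ V]
    {s : Set ι} {f g : ι → V} (h : ∀ i ∈ s, f i = g i) {v : ι →₀ ℂ}
    (hv : v ∈ Finsupp.supported ℂ ℂ s) :
    Finsupp.linearCombination ℂ f v = Finsupp.linearCombination ℂ g v := by
  rw [Finsupp.linearCombination_apply, Finsupp.linearCombination_apply]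
  exact Finset.sum_congr rfl fun i hi => by simp only [h i (hv hi)]

/-- Commuting past one letter leaves `d y` applied to corrections for `w`, `d (x + y)` applied to
`w`, and a multiple of `w`; none is longer than `y :: w`. This bound is what makes induction on
length possible. -/
theorem lowTerm_mem (p : ℕ) : ∀ (x : ℤ) (w : List ℤ), IsWord n w → w.length ≤ p →
    lowTerm n a θ p x w ∈ wordsLE n w.length := by
  induction p with
  | zero =>
    intro x w hw hp
    obtain rfl : w = [] := List.length_eq_zero_iff.1 (by omega)
    rw [lowTerm_nil]
    split_ifs
    · exact Submodule.zero_mem _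
    · exact single_mem_wordsLE n hw le_rfl _
  | succ p ih =>
    intro x w hw hp
    cases w with
    | nil =>
      rw [lowTerm_nil]
      split_ifs
      · exact Submodule.zero_mem _
      · exact single_mem_wordsLE n hw le_rfl _
    | cons y w =>
      have hw' := (isWord_cons.1 hw).2.2
      have hp' : w.length ≤ p := by simpa using hp
      rw [lowTerm]
      split_ifs
      · exact Submodule.zero_mem _
      refine Submodule.add_mem _ (Submodule.add_mem _ ?_ (Submodule.smul_mem _ _
        (Submodule.add_mem _ ?_ ?_))) ?_
      · refine linearCombination_mem_of_supported (fun u hu => ?_) (ih x w hw' hp')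
        have h1 := hu.2
        exact Submodule.add_mem _
          (wordsLE_mono n (by simpa using h1) (leadTerm_mem n y hu.1))
          (wordsLE_mono n (by rw [List.length_cons]; omega) (ih y u hu.1 (h1.trans hp')))
      · exact leadTerm_mem n _ hw'
      · exact wordsLE_mono n (by simp) (ih _ w hw' hp')
      · exact single_mem_wordsLE n hw' (by simp) _

/-- The depth bound is only a device for termination. Independence of it allows the recursion to be
rewritten in terms of `wordOp` in `wordAct_cons`. -/
theorem lowTerm_congr (p : ℕ) : ∀ (q : ℕ) (x : ℤ) (w : List ℤ), IsWord n w → w.length ≤ p →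
    w.length ≤ q → lowTerm n a θ p x w = lowTerm n a θ q x w := by
  induction p with
  | zero =>
    intro q x w hw hp _
    obtain rfl : w = [] := List.length_eq_zero_iff.1 (by omega)
    rw [lowTerm_nil, lowTerm_nil]
  | succ p ih =>
    intro q x w hw hp hq
    cases w with
    | nil => rw [lowTerm_nil, lowTerm_nil]
    | cons y w =>
      obtain ⟨q, rfl⟩ : ∃ q', q = q' + 1 := ⟨q - 1, by simp at hq; omega⟩
      have hw' := (isWord_cons.1 hw).2.2
      have hp' : w.length ≤ p := by simpa using hp
      have hq' : w.length ≤ q := by simpa using hq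
      rw [lowTerm, lowTerm, ih q x w hw' hp' hq', ih q (x + y) w hw' hp' hq',
        linearCombination_congr_of_supported (fun u hu => ?_) (lowTerm_mem n a θ q x w hw' hq')]
      rw [ih q y u hu.1 (hu.2.trans hp') (hu.2.trans hq')]

/-- The action of `d x` on a word. -/
def wordAct (x : ℤ) (w : List ℤ) : List ℤ →₀ ℂ := leadTerm n x w + lowTerm n a θ w.length x w

/-- The linear extension of `wordAct`. -/
def wordOp (x : ℤ) : Module.End ℂ (List ℤ →₀ ℂ) := Finsupp.linearCombination ℂ (wordAct n a θ x)

theorem wordOp_single (x : ℤ) (w : List ℤ) (r : ℂ) :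
    wordOp n a θ x (Finsupp.single w r) = r • wordAct n a θ x w := by
  simp [wordOp]

theorem wordAct_nil (x : ℤ) : wordAct n a θ x []
    = if x < n then Finsupp.single [x] 1 else Finsupp.single [] (a x) := by
  rw [wordAct, leadTerm, lowTerm_nil]
  split_ifs <;> simp

theorem wordAct_of_le {x : ℤ} {w : List ℤ} (hx : x < n) (h : ∀ y ∈ w, x ≤ y) :
    wordAct n a θ x w = Finsupp.single (x :: w) 1 := by
  cases w with
  | nil => simp [wordAct_nil, hx]
  | cons y w =>
    rw [wordAct, leadTerm, if_pos hx, orderedInsert_eq_cons h, List.length_cons, lowTerm,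
      if_pos ⟨hx, h y (by simp)⟩, add_zero]

/-- The recursion was designed to give this commutation relation. Because `y` precedes every letter
of `w` inserted with `x`, applying `d y` to the leading term just prepends `y`. -/
theorem wordAct_cons {x y : ℤ} {w : List ℤ} (hw : IsWord n (y :: w)) (h : ¬(x < n ∧ x ≤ y)) :
    wordAct n a θ x (y :: w) = wordOp n a θ y (wordAct n a θ x w)
      + ((y : ℂ) - x) • wordAct n a θ (x + y) w + Finsupp.single w (cocyc θ x y) := by
  obtain ⟨hy, hyw, hw'⟩ := isWord_cons.1 hw
  have e1 : wordOp n a θ y (lowTerm n a θ w.length x w) = Finsupp.linearCombination ℂ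
      (fun u => leadTerm n y u + lowTerm n a θ w.length y u) (lowTerm n a θ w.length x w) := by
    refine linearCombination_congr_of_supported (fun u hu => ?_)
      (lowTerm_mem n a θ _ x w hw' le_rfl)
    rw [wordAct, lowTerm_congr n a θ u.length w.length y u hu.1 le_rfl hu.2]
  have e2 : wordOp n a θ y (leadTerm n x w) = leadTerm n x (y :: w) := by
    unfold leadTerm
    split_ifs with hx
    · rw [wordOp_single, one_smul, wordAct_of_le n a θ hy, List.orderedInsert, if_neg (by tauto)]
      intro z hz
      rw [List.mem_orderedInsert] at hz
      rcases hz with rfl | hz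
      · by_contra h'
        exact h ⟨hx, by omega⟩
      · exact hyw z hz
    · simp
  rw [wordAct, List.length_cons, lowTerm, if_neg h, wordAct.eq_1 n a θ x w, map_add, e1, e2,
    wordAct]
  abel

theorem wordAct_mem (x : ℤ) {w : List ℤ} (hw : IsWord n w) :
    wordAct n a θ x w ∈ wordsLE n (w.length + 1) :=
  Submodule.add_mem _ (leadTerm_mem n x hw)
    (wordsLE_mono n (by omega) (lowTerm_mem n a θ _ x w hw le_rfl))

end Words

/-! ### The Virasoro relations on ordered words -/

section WhittakerModule

variable (n : ℤ) (a : ℤ → ℂ) (θ : ℂ)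

/-- The linear action of `Vir` on linear combinations of words. It is a representation on the span of
the words in the sense of `IsWord`. -/
def wordLin : Vir →ₗ[ℂ] Module.End ℂ (List ℤ →₀ ℂ) := virLin θ (wordOp n a θ)

theorem wordLin_d_single (x : ℤ) (w : List ℤ) :
    wordLin n a θ (d x) (Finsupp.single w 1) = wordAct n a θ x w := by
  rw [wordLin, virLin_d, wordOp_single, one_smul]

theorem wordLin_c (v : List ℤ →₀ ℂ) : wordLin n a θ c v = θ • v := by
  rw [wordLin, virLin_c]
  simp

theorem wordLin_lie (x y : ℤ) (v : List ℤ →₀ ℂ) : wordLin n a θ ⁅d x, d y⁆ v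
    = ((y : ℂ) - x) • wordLin n a θ (d (x + y)) v + cocyc θ x y • v := by
  rw [lie_d_d, cocyc]
  split_ifs <;> simp [wordLin_c, smul_smul]

/-- The vectors on which the Virasoro relations hold. -/
def commSub : Submodule ℂ (List ℤ →₀ ℂ) where
  carrier := {v | ∀ X Y : Vir, wordLin n a θ X (wordLin n a θ Y v)
    - wordLin n a θ Y (wordLin n a θ X v) = wordLin n a θ ⁅X, Y⁆ v}
  add_mem' := by
    intro u v hu hv X Y
    simp only [map_add, ← hu X Y, ← hv X Y]
    abel
  zero_mem' := by simp
  smul_mem' := by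
    intro r v hv X Y
    simp only [map_smul, ← hv X Y, smul_sub]

theorem mem_commSub {v : List ℤ →₀ ℂ} : v ∈ commSub n a θ ↔ ∀ X Y : Vir,
    wordLin n a θ X (wordLin n a θ Y v) - wordLin n a θ Y (wordLin n a θ X v)
      = wordLin n a θ ⁅X, Y⁆ v := Iff.rfl

theorem mem_commSub_of_basis {v : List ℤ →₀ ℂ} (h : ∀ x y : ℤ,
    wordLin n a θ (d x) (wordLin n a θ (d y) v) - wordLin n a θ (d y) (wordLin n a θ (d x) v)
      = wordLin n a θ ⁅d x, d y⁆ v) : v ∈ commSub n a θ := by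
  intro X Y
  induction X using induction_basis with
  | hadd X X' hX hX' =>
    simp only [map_add, add_lie, LinearMap.add_apply, ← hX, ← hX']
    abel
  | hsmul r X hX => simp only [map_smul, smul_lie, LinearMap.smul_apply, ← hX, smul_sub]
  | hc => simp [lie_c_left, wordLin_c]
  | hd x =>
    induction Y using induction_basis with
    | hadd X X' hX hX' =>
      simp only [map_add, lie_add, LinearMap.add_apply, ← hX, ← hX']
      abel
    | hsmul r X hX => simp only [map_smul, lie_smul, LinearMap.smul_apply, ← hX, smul_sub]
    | hc => rw [← lie_skew]; simp [lie_c_left, wordLin_c]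
    | hd y => exact h x y

theorem wordsLE_le_of_single {N : Submodule ℂ (List ℤ →₀ ℂ)} {p : ℕ}
    (h : ∀ w, IsWord n w → w.length ≤ p → Finsupp.single w 1 ∈ N) : wordsLE n p ≤ N := by
  rw [wordsLE, Finsupp.supported_eq_span_single, Submodule.span_le]
  rintro _ ⟨w, hw, rfl⟩
  exact h w hw.1 hw.2

theorem comm_of_isWord_cons_aux {x y : ℤ} {w : List ℤ} (hw : IsWord n (y :: w))
    (h : ¬(x < n ∧ x ≤ y)) :
    wordLin n a θ (d x) (wordLin n a θ (d y) (Finsupp.single w 1))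
      - wordLin n a θ (d y) (wordLin n a θ (d x) (Finsupp.single w 1))
      = wordLin n a θ ⁅d x, d y⁆ (Finsupp.single w 1) := by
  obtain ⟨hy, hyw, hw'⟩ := isWord_cons.1 hw
  rw [wordLin_lie]
  simp only [wordLin_d_single, wordAct_of_le n a θ hy hyw, wordAct_cons n a θ hw h]
  rw [wordLin, virLin_d, Finsupp.smul_single, smul_eq_mul, mul_one]
  abel

/-- If `x` can itself be put in front of `y :: w`, the product is already ordered; exchanging `x`
and `y` and using antisymmetry reduces to the auxiliary case. -/
theorem comm_of_isWord_cons (x : ℤ) {y : ℤ} {w : List ℤ} (hw : IsWord n (y :: w)) :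
    wordLin n a θ (d x) (wordLin n a θ (d y) (Finsupp.single w 1))
      - wordLin n a θ (d y) (wordLin n a θ (d x) (Finsupp.single w 1))
      = wordLin n a θ ⁅d x, d y⁆ (Finsupp.single w 1) := by
  by_cases h : x < n ∧ x ≤ y
  · rcases eq_or_lt_of_le h.2 with rfl | hxy
    · simp
    · obtain ⟨hy, hyw, hw'⟩ := isWord_cons.1 hw
      have := comm_of_isWord_cons_aux n a θ (x := y) (y := x) (w := w)
        (isWord_cons.2 ⟨h.1, fun z hz => h.2.trans (hyw z hz), hw'⟩) (by omega)
      rw [← lie_skew, map_neg, LinearMap.neg_apply, ← this]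
      abel
  · exact comm_of_isWord_cons_aux n a θ hw h

variable {n a}

/-- Induction on length. On the empty word with x, y ≥ n the relation amounts to a_{x+y} = 0 for x ≠
y, which holds since x + y > 2n. On `z :: u`, when neither `x` nor `y` can be put in front, the
relation for x and y follows from the Jacobi identity and relations involving `z`. -/
theorem wordsLE_le_commSub (hn : 1 ≤ n) (ha : ∀ k, 2 * n < k → a k = 0) (p : ℕ) : wordsLE n p ≤ commSub n a θ := by
  induction p with
  | zero =>
    refine wordsLE_le_of_single n fun w hw hp => mem_commSub_of_basis n a θ fun x y => ?_
    obtain rfl : w = [] := List.length_eq_zero_iff.1 (by omega)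
    by_cases hy : y < n
    · exact comm_of_isWord_cons n a θ x (isWord_cons.2 ⟨hy, by simp, hw⟩)
    by_cases hx : x < n
    · have := comm_of_isWord_cons n a θ y (isWord_cons.2 ⟨hx, by simp, hw⟩)
      rw [← lie_skew, map_neg, LinearMap.neg_apply, ← this]
      abel
    · rw [wordLin_lie]
      simp only [wordLin_d_single, wordAct_nil, if_neg hx, if_neg hy]
      rw [if_neg (by omega), cocyc, if_neg (by omega), wordLin, virLin_d, virLin_d, wordOp_single,
        wordOp_single, wordAct_nil, wordAct_nil, if_neg hx, if_neg hy]
      rcases eq_or_ne x y with rfl | hxy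
      · simp
      · rw [ha (x + y) (by omega)]
        simp [mul_comm]
  | succ p ih =>
    refine wordsLE_le_of_single n fun w hw hp => mem_commSub_of_basis n a θ fun x y => ?_
    cases w with
    | nil => exact ih (single_mem_wordsLE n hw (by simp) 1) _ _
    | cons z u =>
    by_cases hy : y < n ∧ y ≤ z
    · exact comm_of_isWord_cons n a θ x (isWord_cons.2 ⟨hy.1, fun i hi => by
        rcases List.mem_cons.1 hi with rfl | hi
        · exact hy.2
        · exact hy.2.trans ((isWord_cons.1 hw).2.1 i hi), hw⟩)
    by_cases hx : x < n ∧ x ≤ z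
    · have := comm_of_isWord_cons n a θ y (w := z :: u) (isWord_cons.2 ⟨hx.1, fun i hi => by
        rcases List.mem_cons.1 hi with rfl | hi
        · exact hx.2
        · exact hx.2.trans ((isWord_cons.1 hw).2.1 i hi), hw⟩)
      rw [← lie_skew, map_neg, LinearMap.neg_apply, ← this]
      abel
    obtain ⟨hz, hzu, hu⟩ := isWord_cons.1 hw
    have hp' : u.length ≤ p := by simpa using hp
    -- The vector `d y u` is a leading word before which `z` may be written, plus words no longer
    -- than `u`. The first is covered by `comm_of_isWord_cons`, the rest by the induction
    -- hypothesis.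
    have key : ∀ x y : ℤ, ¬(y < n ∧ y ≤ z) →
        wordLin n a θ (d x) (wordLin n a θ (d z) (wordLin n a θ (d y) (Finsupp.single u 1)))
          - wordLin n a θ (d z) (wordLin n a θ (d x) (wordLin n a θ (d y) (Finsupp.single u 1)))
          = wordLin n a θ ⁅d x, d z⁆ (wordLin n a θ (d y) (Finsupp.single u 1)) := by
      intro x y hy
      have hlow := ih (wordsLE_mono n hp' (lowTerm_mem n a θ _ y u hu le_rfl)) (d x) (d z)
      rw [wordLin_d_single, wordAct, leadTerm]
      by_cases hyn : y < n
      · have := comm_of_isWord_cons n a θ x (y := z) (w := u.orderedInsert (· ≤ ·) y)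
          (isWord_cons.2 ⟨hz, fun i hi => ?_, hu.orderedInsert hyn⟩)
        · rw [if_pos hyn]
          simp only [map_add, ← this, ← hlow]
          abel
        · rw [List.mem_orderedInsert] at hi
          rcases hi with rfl | hi
          · by_contra h'
            exact hy ⟨hyn, by omega⟩
          · exact hzu i hi
      · rw [if_neg hyn, zero_add]
        exact hlow
    have hu' := (mem_commSub n a θ).1 (ih (single_mem_wordsLE n hu hp' 1))
    have e0 : Finsupp.single (z :: u) 1 = wordLin n a θ (d z) (Finsupp.single u 1) := by
      rw [wordLin_d_single, wordAct_of_le n a θ hz hzu]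
    have h1 := key x y hy
    have h2 := key y x hx
    have h3 := congrArg (wordLin n a θ (d x)) (hu' (d y) (d z))
    have h4 := congrArg (wordLin n a θ (d y)) (hu' (d x) (d z))
    have h5 := hu' (d x) ⁅d y, d z⁆
    have h6 := hu' (d y) ⁅d x, d z⁆
    have h7 := hu' ⁅d x, d y⁆ (d z)
    have h8 := congrArg (wordLin n a θ (d z)) (hu' (d x) (d y))
    rw [lie_lie, map_sub, LinearMap.sub_apply] at h7
    rw [e0]
    simp only [map_sub] at h3 h4 h8
    -- These are the eight relations by which x and y are carried past z in both orders; the double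
    -- brackets cancel by the Jacobi identity, which entered through `lie_lie`.
    linear_combination (norm := module) h1 - h2 + h3 - h4 + h5 - h6 - h7 + h8

end WhittakerModule

/-! ### Monomials in a representation with central charge -/

section Rep

variable {V : Type*} [AddCommGroup V] [Module ℂ V]

theorem rep_comm (ρ : Vir →ₗ⁅ℂ⁆ Module.End ℂ V) (x y : Vir) (v : V) :
    ρ x (ρ y v) = ρ y (ρ x v) + ρ ⁅x, y⁆ v := by
  rw [LieHom.map_lie, LieRing.of_associative_ring_bracket, LinearMap.sub_apply,
    Module.End.mul_apply, Module.End.mul_apply]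
  abel

/-- The representation `ρ` has central charge `θ`. -/
def HasCharge (ρ : Vir →ₗ⁅ℂ⁆ Module.End ℂ V) (θ : ℂ) : Prop := ∀ v, ρ c v = θ • v

theorem rep_d_comm {ρ : Vir →ₗ⁅ℂ⁆ Module.End ℂ V} {θ : ℂ} (hρ : HasCharge ρ θ) (x y : ℤ) (v : V) :
    ρ (d x) (ρ (d y) v)
      = ρ (d y) (ρ (d x) v) + ((y : ℂ) - x) • ρ (d (x + y)) v + cocyc θ x y • v := by
  rw [rep_comm, lie_d_d, cocyc, add_assoc]
  congr 1
  split_ifs <;> simp [hρ v, smul_smul]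

/-- The ordered product of the `d i` for `i` in a word, applied to a vector. -/
def mono (ρ : Vir →ₗ⁅ℂ⁆ Module.End ℂ V) (y : V) (w : List ℤ) : V :=
  w.foldr (fun i z => ρ (d i) z) y

@[simp] theorem mono_nil (ρ : Vir →ₗ⁅ℂ⁆ Module.End ℂ V) (y : V) : mono ρ y [] = y := rfl

@[simp] theorem mono_cons (ρ : Vir →ₗ⁅ℂ⁆ Module.End ℂ V) (y : V) (i : ℤ) (w : List ℤ) :
    mono ρ y (i :: w) = ρ (d i) (mono ρ y w) := rfl

theorem mono_append (ρ : Vir →ₗ⁅ℂ⁆ Module.End ℂ V) (y : V) (w w' : List ℤ) :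
    mono ρ y (w ++ w') = mono ρ (mono ρ y w') w := by
  simp [mono]

end Rep

/-! ### The universal Whittaker module and its universal property -/

section Whittaker

variable (n : ℤ) (a : ℤ → ℂ) (θ : ℂ)

/-- The span of the ordered words. -/
def wordSpan : Submodule ℂ (List ℤ →₀ ℂ) := Finsupp.supported ℂ ℂ {w | IsWord n w}

theorem wordOp_mem (x : ℤ) {v : List ℤ →₀ ℂ} (hv : v ∈ wordSpan n) : wordOp n a θ x v ∈ wordSpan n :=
  linearCombination_mem_of_supported (fun _ hw =>
    Finsupp.supported_mono (fun _ hu => hu.1) (wordAct_mem n a θ x hw)) hv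

/-- The underlying space of the universal Whittaker module: the span of the ordered words. -/
def Whit (n : ℤ) : Type := wordSpan n

instance : AddCommGroup (Whit n) := inferInstanceAs (AddCommGroup (wordSpan n))

instance : Module ℂ (Whit n) := inferInstanceAs (Module ℂ (wordSpan n))

/-- The inclusion of the Whittaker module into the linear combinations of words. -/
def Whit.incl (n : ℤ) : Whit n →ₗ[ℂ] (List ℤ →₀ ℂ) := (wordSpan n).subtype

theorem Whit.ext {n : ℤ} {u v : Whit n} (h : Whit.incl n u = Whit.incl n v) : u = v := Subtype.ext h

theorem Whit.incl_mem {n : ℤ} (v : Whit n) : Whit.incl n v ∈ wordSpan n :=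
  Subtype.property (p := (· ∈ wordSpan n)) v

/-- The action of `d x` on the Whittaker module. -/
def whitOp (x : ℤ) : Module.End ℂ (Whit n) :=
  LinearMap.restrict (p := wordSpan n) (q := wordSpan n) (wordOp n a θ x)
    fun _ hv => wordOp_mem n a θ x hv

variable {n a}

theorem wordSpan_le_commSub (hn : 1 ≤ n) (ha : ∀ k, 2 * n < k → a k = 0) :
    wordSpan n ≤ commSub n a θ := by
  rw [wordSpan, Finsupp.supported_eq_span_single, Submodule.span_le]
  rintro _ ⟨w, hw, rfl⟩
  exact wordsLE_le_commSub θ hn ha _ (single_mem_wordsLE n hw le_rfl 1)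

theorem isVirAction_whitOp (hn : 1 ≤ n) (ha : ∀ k, 2 * n < k → a k = 0) :
    IsVirAction θ (whitOp n a θ) := by
  intro i j v
  have := wordSpan_le_commSub θ hn ha v.incl_mem (d i) (d j)
  rw [wordLin_lie] at this
  simp only [wordLin, virLin_d, cocyc] at this
  apply Whit.ext
  rw [map_sub, map_add, map_smul, map_smul]
  exact this

/-- The Whittaker module: it is generated by a vector on which `d k` acts by `a k` for `k ≥ n`. -/
def whitRep (hn : 1 ≤ n) (ha : ∀ k, 2 * n < k → a k = 0) : Vir →ₗ⁅ℂ⁆ Module.End ℂ (Whit n) :=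
  virRep θ (whitOp n a θ) (isVirAction_whitOp θ hn ha)

/-- The basis vector of the Whittaker module labelled by a word. -/
def wordVec {w : List ℤ} (hw : IsWord n w) : Whit n :=
  (⟨Finsupp.single w 1, Finsupp.single_mem_supported ℂ 1 hw⟩ : wordSpan n)

theorem incl_wordVec {w : List ℤ} (hw : IsWord n w) :
    Whit.incl n (wordVec hw) = Finsupp.single w 1 := rfl

/-- The generator of the Whittaker module. -/
def vac (n : ℤ) : Whit n := wordVec (isWord_nil n)

theorem vac_ne_zero (n : ℤ) : vac n ≠ 0 := by
  intro h
  have := congrArg (fun v : Whit n => Whit.incl n v []) h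
  simp [vac, incl_wordVec] at this

section

variable (hn : 1 ≤ n) (ha : ∀ k, 2 * n < k → a k = 0)

theorem whitRep_hasCharge : HasCharge (whitRep θ hn ha) θ := by
  intro v
  rw [whitRep, virRep_c]
  simp

theorem incl_whitRep_d (x : ℤ) (v : Whit n) :
    Whit.incl n (whitRep θ hn ha (d x) v) = wordOp n a θ x (Whit.incl n v) := by
  rw [whitRep, virRep_d]
  rfl

theorem whitRep_wordVec {x : ℤ} {w : List ℤ} (hw : IsWord n (x :: w)) :
    whitRep θ hn ha (d x) (wordVec (isWord_cons.1 hw).2.2) = wordVec hw := by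
  apply Whit.ext
  rw [incl_whitRep_d, incl_wordVec, wordOp_single, one_smul, wordAct_of_le n a θ (isWord_cons.1 hw).1
    (isWord_cons.1 hw).2.1, incl_wordVec]

theorem whitRep_vac {k : ℤ} (hk : n ≤ k) : whitRep θ hn ha (d k) (vac n) = a k • vac n := by
  apply Whit.ext
  rw [incl_whitRep_d, vac, incl_wordVec, wordOp_single, one_smul, wordAct_nil, if_neg (by omega), map_smul, incl_wordVec]
  simp

theorem mono_whitRep {w : List ℤ} (hw : IsWord n w) :
    mono (whitRep θ hn ha) (vac n) w = wordVec hw := by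
  induction w with
  | nil => rfl
  | cons i w ih => rw [mono_cons, ih (isWord_cons.1 hw).2.2, whitRep_wordVec]

theorem whit_le_of_wordVec {N : Submodule ℂ (Whit n)}
    (h : ∀ w (hw : IsWord n w), wordVec hw ∈ N) : N = ⊤ := by
  have : wordSpan n ≤ N.map (Whit.incl n) := by
    conv_lhs => rw [wordSpan, Finsupp.supported_eq_span_single]
    rw [Submodule.span_le]
    rintro _ ⟨w, hw, rfl⟩
    exact ⟨wordVec hw, h w hw, rfl⟩
  rw [eq_top_iff]
  rintro v -
  obtain ⟨v', hv', e⟩ := this v.incl_mem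
  rwa [← Whit.ext e]

/-- A submodule of the Whittaker module containing the generator is everything. -/
theorem eq_top_of_vac_mem {N : Submodule ℂ (Whit n)}
    (hN : ∀ i, ∀ v ∈ N, whitRep θ hn ha (d i) v ∈ N) (hv : vac n ∈ N) : N = ⊤ := by
  refine whit_le_of_wordVec fun w hw => ?_
  induction w with
  | nil => exact hv
  | cons i w ih =>
    rw [← whitRep_wordVec θ hn ha hw]
    exact hN _ _ (ih _)

end

variable {V : Type*} [AddCommGroup V] [Module ℂ V] {ρ : Vir →ₗ⁅ℂ⁆ Module.End ℂ V}

/-- The recursion for `wordAct` uses only the Virasoro relations and the scalars by which `d k`, k ≥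
n, acts on the generator. Both are available for `y` in `V`, so the same rewriting is valid there.
-/
theorem linearCombination_mono_wordAct (hρ : HasCharge ρ θ) {y : V}
    (hy : ∀ k, n ≤ k → ρ (d k) y = a k • y) (p : ℕ) : ∀ (x : ℤ) (w : List ℤ), IsWord n w →
    w.length ≤ p →
    Finsupp.linearCombination ℂ (mono ρ y) (wordAct n a θ x w) = ρ (d x) (mono ρ y w) := by
  have hnil : ∀ x, Finsupp.linearCombination ℂ (mono ρ y) (wordAct n a θ x [])
      = ρ (d x) (mono ρ y []) := by
    intro x
    rw [wordAct_nil]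
    split_ifs with h
    · simp
    · simp [hy x (by omega)]
  induction p with
  | zero =>
    intro x w hw hp
    obtain rfl : w = [] := List.length_eq_zero_iff.1 (by omega)
    exact hnil x
  | succ p ih =>
    intro x w hw hp
    cases w with
    | nil => exact hnil x
    | cons z w =>
      obtain ⟨hz, hzw, hw'⟩ := isWord_cons.1 hw
      have hp' : w.length ≤ p := by simpa using hp
      by_cases h : x < n ∧ x ≤ z
      · rw [wordAct_of_le n a θ h.1 (fun i hi => by
          rcases List.mem_cons.1 hi with rfl | hi
          · exact h.2
          · exact h.2.trans (hzw i hi))]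
        simp
      · have e : ∀ v ∈ wordsLE n p, Finsupp.linearCombination ℂ (mono ρ y) (wordOp n a θ z v)
            = ρ (d z) (Finsupp.linearCombination ℂ (mono ρ y) v) := by
          intro v hv
          have : wordsLE n p ≤ LinearMap.eqLocus
              ((Finsupp.linearCombination ℂ (mono ρ y)).comp (wordOp n a θ z))
              ((ρ (d z)).comp (Finsupp.linearCombination ℂ (mono ρ y))) := by
            refine wordsLE_le_of_single n fun u hu hup => ?_
            simpa [wordOp_single] using ih z u hu hup
          exact this hv
        have e2 : Finsupp.linearCombination ℂ (mono ρ y) (wordOp n a θ z (leadTerm n x w))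
            = ρ (d z) (Finsupp.linearCombination ℂ (mono ρ y) (leadTerm n x w)) := by
          unfold leadTerm
          split_ifs with hx
          · rw [wordOp_single, wordAct_of_le n a θ hz]
            · simp
            · intro i hi
              rw [List.mem_orderedInsert] at hi
              rcases hi with rfl | hi
              · by_contra h'
                exact h ⟨hx, by omega⟩
              · exact hzw i hi
          · simp
        have e3 : Finsupp.linearCombination ℂ (mono ρ y) (wordOp n a θ z (wordAct n a θ x w))
            = ρ (d z) (ρ (d x) (mono ρ y w)) := by
          rw [← ih x w hw' hp', wordAct, map_add, map_add, e2,
            e _ (wordsLE_mono n hp' (lowTerm_mem n a θ _ x w hw' le_rfl)), map_add, map_add]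
        rw [wordAct_cons n a θ hw h, map_add, map_add, e3, map_smul, ih _ w hw' hp', mono_cons,
          rep_d_comm hρ x z]
        simp

/-- The homomorphism from the Whittaker module determined by the image of its generator. -/
def whitLift (ρ : Vir →ₗ⁅ℂ⁆ Module.End ℂ V) (y : V) : Whit n →ₗ[ℂ] V :=
  (Finsupp.linearCombination ℂ (mono ρ y)).comp (Whit.incl n)

theorem whitLift_wordVec (ρ : Vir →ₗ⁅ℂ⁆ Module.End ℂ V) (y : V) {w : List ℤ} (hw : IsWord n w) :
    whitLift ρ y (wordVec hw) = mono ρ y w := by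
  simp [whitLift, incl_wordVec]

theorem whitLift_vac (ρ : Vir →ₗ⁅ℂ⁆ Module.End ℂ V) (y : V) :
    whitLift ρ y (vac n) = y := whitLift_wordVec ρ y (isWord_nil n)

theorem whitLift_rep (hn : 1 ≤ n) (ha : ∀ k, 2 * n < k → a k = 0) (hρ : HasCharge ρ θ) {y : V}
    (hy : ∀ k, n ≤ k → ρ (d k) y = a k • y) (x : ℤ) (v : Whit n) :
    whitLift ρ y (whitRep θ hn ha (d x) v) = ρ (d x) (whitLift ρ y v) := by
  have : LinearMap.eqLocus ((whitLift ρ y).comp (whitRep θ hn ha (d x)))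
      ((ρ (d x)).comp (whitLift (n := n) ρ y)) = ⊤ := by
    refine whit_le_of_wordVec fun w hw => ?_
    have := linearCombination_mono_wordAct θ hρ hy w.length x w hw le_rfl
    rw [LinearMap.mem_eqLocus, LinearMap.comp_apply, LinearMap.comp_apply, whitLift_wordVec,
      ← this, whitLift, LinearMap.comp_apply, incl_whitRep_d, incl_wordVec,
      wordOp_single, one_smul]
  have hv : v ∈ LinearMap.eqLocus ((whitLift ρ y).comp (whitRep θ hn ha (d x)))
      ((ρ (d x)).comp (whitLift (n := n) ρ y)) := this ▸ Submodule.mem_top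
  exact hv

end Whittaker

/-! ### Irreducibility of the Whittaker module -/

section Weight

/-- The weight of a word, where `i` has weight `r - i`. -/
def wordWt (r : ℤ) (w : List ℤ) : ℤ := (w.map fun i => r - i).sum

@[simp] theorem wordWt_nil (r : ℤ) : wordWt r [] = 0 := rfl

@[simp] theorem wordWt_cons (r i : ℤ) (w : List ℤ) : wordWt r (i :: w) = r - i + wordWt r w := by
  simp [wordWt]

theorem wordWt_perm {r : ℤ} {w w' : List ℤ} (h : w.Perm w') : wordWt r w = wordWt r w' :=
  (h.map _).sum_eq

theorem wordWt_nonneg {n r : ℤ} (hr : n ≤ r) {w : List ℤ} (hw : ∀ i ∈ w, i < n) :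
    0 ≤ wordWt r w := by
  induction w with
  | nil => simp
  | cons i w ih =>
    rw [List.forall_mem_cons] at hw
    have := ih hw.2
    rw [wordWt_cons]
    omega

theorem le_wordWt {n r : ℤ} (hr : n ≤ r) {w : List ℤ} (hw : ∀ i ∈ w, i < n) {i : ℤ}
    (hi : i ∈ w) : r - i ≤ wordWt r w := by
  induction w with
  | nil => simp at hi
  | cons j w ih =>
    rw [List.forall_mem_cons] at hw
    have h0 := wordWt_nonneg hr hw.2
    rw [wordWt_cons]
    rcases List.mem_cons.1 hi with rfl | hi
    · omega
    · have := ih hw.2 hi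
      omega

variable {V : Type*} [AddCommGroup V] [Module ℂ V]

/-- The span of the monomials of weight at most `q` applied to `y`. -/
def wtLE (ρ : Vir →ₗ⁅ℂ⁆ Module.End ℂ V) (y : V) (n r q : ℤ) : Submodule ℂ V :=
  Submodule.span ℂ {v | ∃ w : List ℤ, (∀ i ∈ w, i < n) ∧ wordWt r w ≤ q ∧ v = mono ρ y w}

variable {ρ : Vir →ₗ⁅ℂ⁆ Module.End ℂ V} {y : V} {n r : ℤ} {a : ℤ → ℂ} {θ : ℂ}

theorem mono_mem_wtLE {q : ℤ} {w : List ℤ} (hw : ∀ i ∈ w, i < n) (hq : wordWt r w ≤ q) :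
    mono ρ y w ∈ wtLE ρ y n r q :=
  Submodule.subset_span ⟨w, hw, hq, rfl⟩

theorem wtLE_mono {q q' : ℤ} (h : q ≤ q') : wtLE ρ y n r q ≤ wtLE ρ y n r q' :=
  Submodule.span_mono fun _ ⟨w, hw, hq, e⟩ => ⟨w, hw, hq.trans h, e⟩

theorem rep_mem_wtLE {q q' i : ℤ} (hi : i < n) (h : r - i + q ≤ q') {v : V}
    (hv : v ∈ wtLE ρ y n r q) : ρ (d i) v ∈ wtLE ρ y n r q' := by
  suffices wtLE ρ y n r q ≤ (wtLE ρ y n r q').comap (ρ (d i)) from this hv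
  rw [wtLE, Submodule.span_le]
  rintro _ ⟨w, hw, hq, rfl⟩
  exact mono_mem_wtLE (w := i :: w) (List.forall_mem_cons.2 ⟨hi, hw⟩)
    (by rw [wordWt_cons]; omega)

/-- Moving `d k` past a letter i turns it into `d (k + i)`. If k + i < n, this is a letter whose
weight is smaller by k; otherwise it is moved on to the right, and a scalar a_{k+i} replaces the
letter. -/
theorem rep_sub_mono_mem_wtLE (hn : 1 ≤ n) (hr : n ≤ r) (ha : ∀ k, r < k → a k = 0)
    (hρ : HasCharge ρ θ) (hy : ∀ k, n ≤ k → ρ (d k) y = a k • y) {w : List ℤ}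
    (hw : ∀ i ∈ w, i < n) : ∀ k q : ℤ, n ≤ k → wordWt r w - k ≤ q →
    ρ (d k) (mono ρ y w) - a k • mono ρ y w ∈ wtLE ρ y n r q := by
  induction w with
  | nil =>
    intro k q hk _
    simp [hy k hk]
  | cons i w ih =>
    intro k q hk hq
    rw [List.forall_mem_cons] at hw
    rw [wordWt_cons] at hq
    have ih' := ih hw.2
    have e : ρ (d k) (mono ρ y (i :: w)) - a k • mono ρ y (i :: w)
        = ρ (d i) (ρ (d k) (mono ρ y w) - a k • mono ρ y w)
          + ((i : ℂ) - k) • ρ (d (k + i)) (mono ρ y w) + cocyc θ k i • mono ρ y w := by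
      rw [mono_cons, rep_d_comm hρ, map_sub, map_smul]
      abel
    rw [e]
    refine Submodule.add_mem _ (Submodule.add_mem _ ?_ (Submodule.smul_mem _ _ ?_)) ?_
    · exact rep_mem_wtLE hw.1 (by omega) (ih' k (wordWt r w - k) hk le_rfl)
    · by_cases hki : k + i < n
      · exact mono_mem_wtLE (w := (k + i) :: w) (List.forall_mem_cons.2 ⟨hki, hw.2⟩)
          (by rw [wordWt_cons]; omega)
      · rw [← sub_add_cancel (ρ (d (k + i)) (mono ρ y w)) (a (k + i) • mono ρ y w)]
        refine Submodule.add_mem _ (ih' _ _ (by omega) (by omega)) ?_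
        -- Losing the letter i costs weight r - i, which is at least k unless k + i > r; in that
        -- case the scalar vanishes.
        by_cases hk' : r < k + i
        · simp [ha _ hk']
        · exact Submodule.smul_mem _ _ (mono_mem_wtLE hw.2 (by omega))
    · rw [cocyc]
      split_ifs
      · exact Submodule.smul_mem _ _ (mono_mem_wtLE hw.2 (by omega))
      · simp

theorem rep_sub_mem_wtLE (hn : 1 ≤ n) (hr : n ≤ r) (ha : ∀ k, r < k → a k = 0)
    (hρ : HasCharge ρ θ) (hy : ∀ k, n ≤ k → ρ (d k) y = a k • y) {k q q' : ℤ} (hk : n ≤ k)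
    (hq : q - k ≤ q') {v : V} (hv : v ∈ wtLE ρ y n r q) :
    ρ (d k) v - a k • v ∈ wtLE ρ y n r q' := by
  suffices wtLE ρ y n r q ≤ (wtLE ρ y n r q').comap (ρ (d k) - a k • LinearMap.id) from this hv
  rw [wtLE, Submodule.span_le]
  rintro _ ⟨w, hw, hw', rfl⟩
  exact rep_sub_mono_mem_wtLE hn hr ha hρ hy hw k q' hk (by omega)

theorem eq_cons_erase {n j : ℤ} {w : List ℤ} (hw : IsWord n w) (hj : ∀ i ∈ w, j ≤ i)
    (h : j ∈ w) : w = j :: w.erase j := by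
  cases w with
  | nil => simp at h
  | cons i w =>
    have h1 : i ≤ j := by
      rcases List.mem_cons.1 h with rfl | h
      · exact le_rfl
      · exact (isWord_cons.1 hw).2.1 j h
    obtain rfl : i = j := le_antisymm h1 (hj i (by simp))
    simp

/-- With k = r - j, each letter j met by `d k` becomes `d r`, which contributes the scalar a_r and
costs exactly k in weight. A letter i > j gives k + i > r, where a vanishes, hence strictly lower
weight. Letters below j would give further terms of the same weight, so minimality of j is
essential. -/
theorem rep_sub_mono_leading (hn : 1 ≤ n) (hr : n ≤ r) (ha : ∀ k, r < k → a k = 0)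
    (hρ : HasCharge ρ θ) (hy : ∀ k, n ≤ k → ρ (d k) y = a k • y) {j k : ℤ} (hjk : j + k = r)
    (hk : n ≤ k) {w : List ℤ} (hw : IsWord n w) (hj : ∀ i ∈ w, j ≤ i) :
    ρ (d k) (mono ρ y w) - a k • mono ρ y w
      - (w.count j * ((j : ℂ) - k) * a r) • mono ρ y (w.erase j)
      ∈ wtLE ρ y n r (wordWt r w - k - 1) := by
  induction w with
  | nil => simp [hy k hk]
  | cons i w ih =>
    obtain ⟨hi, hiw, hw'⟩ := isWord_cons.1 hw
    rw [List.forall_mem_cons] at hj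
    have ih' := ih hw' hj.2
    have hc : cocyc θ k i = 0 := if_neg (by omega)
    have e : ρ (d k) (mono ρ y (i :: w)) - a k • mono ρ y (i :: w)
        = ρ (d i) (ρ (d k) (mono ρ y w) - a k • mono ρ y w)
          + ((i : ℂ) - k) • ρ (d (k + i)) (mono ρ y w) := by
      rw [mono_cons, rep_d_comm hρ, map_sub, map_smul, hc]
      module
    have hA : ρ (d (k + i)) (mono ρ y w) - a (k + i) • mono ρ y w
        ∈ wtLE ρ y n r (wordWt r (i :: w) - k - 1) :=
      rep_sub_mono_mem_wtLE hn hr ha hρ hy hw'.2 _ _ (by omega) (by rw [wordWt_cons]; omega)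
    rw [e]
    rcases eq_or_lt_of_le hj.1 with rfl | hij
    · have h1 : ρ (d j) (ρ (d k) (mono ρ y w) - a k • mono ρ y w)
          - (w.count j * ((j : ℂ) - k) * a r) • mono ρ y w
          ∈ wtLE ρ y n r (wordWt r (j :: w) - k - 1) := by
        have := rep_mem_wtLE (q' := wordWt r (j :: w) - k - 1) hi
          (by rw [wordWt_cons]; omega) ih'
        rw [map_sub, map_smul] at this
        by_cases hjw : j ∈ w
        · have e2 : mono ρ y w = ρ (d j) (mono ρ y (w.erase j)) := by
            conv_lhs => rw [eq_cons_erase hw' hj.2 hjw, mono_cons]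
          rwa [← e2] at this
        · rw [List.count_eq_zero_of_not_mem hjw] at this ⊢
          simpa using this
      have h2 := Submodule.add_mem _ h1 (Submodule.smul_mem _ ((j : ℂ) - k) hA)
      rw [show k + j = r by omega] at h2 ⊢
      rw [List.count_cons_self, List.erase_cons_head]
      convert h2 using 1
      push_cast
      module
    · have hjw : j ∉ w := fun h => by have := hiw j h; omega
      have hjw' : j ∉ i :: w := by simp [hjw, hij.ne]
      rw [List.count_eq_zero_of_not_mem hjw] at ih'
      rw [List.count_eq_zero_of_not_mem hjw']
      rw [ha (k + i) (by omega)] at hA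
      simp only [Nat.cast_zero, zero_mul, zero_smul, sub_zero] at ih' hA ⊢
      exact Submodule.add_mem _ (rep_mem_wtLE hi (by rw [wordWt_cons]; omega) ih')
        (Submodule.smul_mem _ _ hA)

/-- Exchanging two neighbouring letters leaves a bracket: the pair is replaced by `d` of their sum
or by a scalar, and either way the weight drops. -/
theorem mono_sub_mono_mem_wtLE (hn : 1 ≤ n) (hr : n ≤ r) (ha : ∀ k, r < k → a k = 0)
    (hρ : HasCharge ρ θ) (hy : ∀ k, n ≤ k → ρ (d k) y = a k • y) {w w' : List ℤ}
    (h : w.Perm w') (hw : ∀ i ∈ w, i < n) :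
    mono ρ y w - mono ρ y w' ∈ wtLE ρ y n r (wordWt r w - 1) := by
  induction h with
  | nil => simp
  | cons i h ih =>
    rw [List.forall_mem_cons] at hw
    rw [mono_cons, mono_cons, ← map_sub, wordWt_cons]
    exact rep_mem_wtLE hw.1 (by omega) (ih hw.2)
  | swap i j w =>
    rw [List.forall_mem_cons, List.forall_mem_cons] at hw
    obtain ⟨hj, hi, hw⟩ := hw
    simp only [mono_cons, wordWt_cons]
    rw [rep_d_comm hρ, add_assoc, add_sub_cancel_left]
    refine Submodule.add_mem _ (Submodule.smul_mem _ _ ?_)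
      (Submodule.smul_mem _ _ (mono_mem_wtLE hw (by omega)))
    by_cases hij : j + i < n
    · exact mono_mem_wtLE (w := (j + i) :: w) (List.forall_mem_cons.2 ⟨hij, hw⟩)
        (by rw [wordWt_cons]; omega)
    · rw [← sub_add_cancel (ρ (d (j + i)) (mono ρ y w)) (a (j + i) • mono ρ y w)]
      exact Submodule.add_mem _
        (rep_sub_mono_mem_wtLE hn hr ha hρ hy hw _ _ (by omega) (by omega))
        (Submodule.smul_mem _ _ (mono_mem_wtLE hw (by omega)))
  | trans h1 h2 ih1 ih2 =>
    have := Submodule.add_mem _ (ih1 hw)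
      (wordWt_perm (r := r) h1 ▸ ih2 fun i hi => hw i (h1.mem_iff.2 hi))
    rwa [sub_add_sub_cancel] at this

/-- Sort each monomial; the error has smaller weight, and weights are nonnegative, so the process
stops. -/
theorem wtLE_le_span_isWord (hn : 1 ≤ n) (hr : n ≤ r) (ha : ∀ k, r < k → a k = 0)
    (hρ : HasCharge ρ θ) (hy : ∀ k, n ≤ k → ρ (d k) y = a k • y) (N : ℕ) : ∀ q : ℤ, q < N →
    wtLE ρ y n r q ≤
      Submodule.span ℂ {v | ∃ w : List ℤ, IsWord n w ∧ wordWt r w ≤ q ∧ v = mono ρ y w} := by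
  induction N with
  | zero =>
    intro q hq
    rw [wtLE, Submodule.span_le]
    rintro _ ⟨w, hw, hq', rfl⟩
    have := wordWt_nonneg hr hw
    push_cast at hq
    omega
  | succ N ih =>
    intro q hq
    rw [wtLE, Submodule.span_le]
    rintro _ ⟨w, hw, hq', rfl⟩
    have hp : (w.mergeSort (· ≤ ·)).Perm w := List.mergeSort_perm w _
    rw [SetLike.mem_coe, ← sub_add_cancel (mono ρ y w) (mono ρ y (w.mergeSort (· ≤ ·)))]
    push_cast at hq
    refine Submodule.add_mem _ ?_ (Submodule.subset_span
      ⟨_, ⟨?_, fun i hi => hw i (hp.mem_iff.1 hi)⟩, (wordWt_perm hp).trans_le hq', rfl⟩)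
    · have := ih (q - 1) (by omega) (wtLE_mono (by omega)
        (mono_sub_mono_mem_wtLE hn hr ha hρ hy hp.symm hw))
      refine Submodule.span_mono ?_ this
      rintro _ ⟨u, hu, hu', e⟩
      exact ⟨u, hu, by omega, e⟩
    · have := List.pairwise_mergeSort (le := fun a b : ℤ => decide (a ≤ b))
        (by simp only [decide_eq_true_eq]; intros; omega)
        (by simp only [Bool.or_eq_true, decide_eq_true_eq]; intros; omega) w
      simpa using this

end Weight

/-! ### Submodules of the Whittaker module -/

section WhitIrreducible

variable {n : ℤ} {a : ℤ → ℂ} (θ : ℂ) (hn : 1 ≤ n) (ha : ∀ k, 2 * n < k → a k = 0)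

theorem incl_eq_zero_of_mem_wtLE {r : ℤ} (hr : n ≤ r) (har : ∀ k, r < k → a k = 0) {q : ℤ}
    {v : Whit n} (hv : v ∈ wtLE (whitRep θ hn ha) (vac n) n r q) {w : List ℤ}
    (hw : q < wordWt r w) : Whit.incl n v w = 0 := by
  have h1 := wtLE_le_span_isWord hn hr har (whitRep_hasCharge θ hn ha)
    (fun k hk => whitRep_vac θ hn ha hk) (q.toNat + 1) q (by omega) hv
  suffices Submodule.span ℂ {v | ∃ w : List ℤ, IsWord n w ∧ wordWt r w ≤ q ∧
      v = mono (whitRep θ hn ha) (vac n) w} ≤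
      LinearMap.ker ((Finsupp.lapply (R := ℂ) w).comp (Whit.incl n)) from this h1
  rw [Submodule.span_le]
  rintro _ ⟨u, hu, huq, rfl⟩
  rw [mono_whitRep θ hn ha hu, SetLike.mem_coe, LinearMap.mem_ker, LinearMap.comp_apply,
    incl_wordVec, Finsupp.lapply_apply, Finsupp.single_eq_of_ne]
  rintro rfl
  omega

theorem sum_mono_incl (v : Whit n) : Finsupp.linearCombination ℂ
    (mono (whitRep θ hn ha) (vac n)) (Whit.incl n v) = v := by
  have : LinearMap.eqLocus (whitLift (whitRep θ hn ha) (vac n)) LinearMap.id = ⊤ :=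
    whit_le_of_wordVec fun w hw => by
      rw [LinearMap.mem_eqLocus, whitLift_wordVec, mono_whitRep θ hn ha hw, LinearMap.id_apply]
  have hv : v ∈ LinearMap.eqLocus (whitLift (whitRep θ hn ha) (vac n)) LinearMap.id :=
    this ▸ Submodule.mem_top
  exact hv

theorem isWord_of_mem_support {v : Whit n} {w : List ℤ} (hw : w ∈ (Whit.incl n v).support) :
    IsWord n w := v.incl_mem hw

theorem mem_wtLE_of_support {r q : ℤ} {v : Whit n}
    (h : ∀ w ∈ (Whit.incl n v).support, wordWt r w ≤ q) :
    v ∈ wtLE (whitRep θ hn ha) (vac n) n r q := by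
  rw [← sum_mono_incl θ hn ha v, Finsupp.linearCombination_apply]
  exact Submodule.sum_mem _ fun w hw => Submodule.smul_mem _ _
    (mono_mem_wtLE (isWord_of_mem_support hw).2 (h w hw))

theorem exists_min_letter (S : Finset (List ℤ)) (h : ∃ w ∈ S, w ≠ []) :
    ∃ w ∈ S, ∃ j ∈ w, ∀ u ∈ S, ∀ i ∈ u, j ≤ i := by
  have hne : (S.biUnion List.toFinset).Nonempty := by
    obtain ⟨w, hw, hw'⟩ := h
    obtain ⟨i, hi⟩ := List.exists_mem_of_ne_nil w hw'
    exact ⟨i, Finset.mem_biUnion.2 ⟨w, hw, by simpa using hi⟩⟩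
  obtain ⟨w, hw, hj⟩ := Finset.mem_biUnion.1 (Finset.min'_mem _ hne)
  exact ⟨w, hw, _, by simpa using hj, fun u hu i hi =>
    Finset.min'_le _ _ (Finset.mem_biUnion.2 ⟨u, hu, List.mem_toFinset.2 hi⟩)⟩

/-- Descent on weight: as long as a nonzero vector of `N` has positive weight, a suitable `d k - a
k` strictly lowers the weight without killing the vector. A nonzero vector of weight zero is a
multiple of the generator. -/
theorem vac_mem_of_mem_wtLE {r : ℤ} (hr : 2 * n - 1 ≤ r) (har : ∀ k, r < k → a k = 0)
    (hr0 : a r ≠ 0) {N : Submodule ℂ (Whit n)}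
    (hN : ∀ i, ∀ v ∈ N, whitRep θ hn ha (d i) v ∈ N) (p : ℕ) : ∀ q : ℤ, q < p → ∀ v ∈ N, v ≠ 0 →
    v ∈ wtLE (whitRep θ hn ha) (vac n) n r q → vac n ∈ N := by
  have hrn : n ≤ r := by omega
  induction p with
  | zero =>
    intro q hq v _ hv0 hv
    refine absurd (Whit.ext (n := n) ?_) hv0
    rw [map_zero]
    ext w
    by_cases hw : IsWord n w
    · exact incl_eq_zero_of_mem_wtLE θ hn ha hrn har hv
        (by have := wordWt_nonneg hrn hw.2; push_cast at hq; omega)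
    · by_contra h
      exact hw (isWord_of_mem_support (Finsupp.mem_support_iff.2 h))
  | succ p ih =>
    intro q hq v hvN hv0 hv
    push_cast at hq
    have hle : ∀ w ∈ (Whit.incl n v).support, wordWt r w ≤ q := fun w hw => by
      by_contra h
      exact Finsupp.mem_support_iff.1 hw
        (incl_eq_zero_of_mem_wtLE θ hn ha hrn har hv (by omega))
    by_cases hT : ∃ w ∈ (Whit.incl n v).support, wordWt r w = q
    swap
    · exact ih (q - 1) (by omega) v hvN hv0 (mem_wtLE_of_support θ hn ha fun w hw =>
        Int.le_sub_one_of_lt (lt_of_le_of_ne (hle w hw) fun h => hT ⟨w, hw, h⟩))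
    by_cases hq0 : q ≤ 0
    · have hs : ∀ w ∈ (Whit.incl n v).support, w = [] := fun w hw => by
        by_contra h
        obtain ⟨i, hi⟩ := List.exists_mem_of_ne_nil w h
        have h1 := (isWord_of_mem_support hw).2
        have := le_wordWt hrn h1 hi
        have := h1 i hi
        have := hle w hw
        omega
      have hv' : v = Whit.incl n v [] • vac n := by
        conv_lhs => rw [← sum_mono_incl θ hn ha v]
        rw [Finsupp.linearCombination_apply, Finsupp.sum_eq_single []]
        · rfl
        · intro w hw hw'
          exact absurd (hs w (Finsupp.mem_support_iff.2 hw)) hw'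
        · simp
      have hc : Whit.incl n v [] ≠ 0 := fun h => hv0 (by rw [hv', h, zero_smul])
      rw [hv'] at hvN
      exact (N.smul_mem_iff hc).1 hvN
    · obtain ⟨w₀, hw₀, j, hj, hmin⟩ := exists_min_letter
        ((Whit.incl n v).support.filter fun w => wordWt r w = q) (by
          obtain ⟨w, hw, hwq⟩ := hT
          refine ⟨w, Finset.mem_filter.2 ⟨hw, hwq⟩, ?_⟩
          rintro rfl
          rw [wordWt_nil] at hwq
          omega)
      rw [Finset.mem_filter] at hw₀
      obtain ⟨hw₀s, hw₀q⟩ := hw₀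
      have hw₀w := isWord_of_mem_support hw₀s
      have hjn := hw₀w.2 j hj
      have hjw := le_wordWt hrn hw₀w.2 hj
      set ρ := whitRep θ hn ha with hρdef
      have hρ : HasCharge ρ θ := whitRep_hasCharge θ hn ha
      have hy : ∀ k, n ≤ k → ρ (d k) (vac n) = a k • vac n :=
        fun k hk => whitRep_vac θ hn ha hk
      -- This k sends the smallest letter j to r. As j ≤ n - 1 and r ≥ 2n - 1, it satisfies k ≥ n,
      -- so `d k - a k` lowers the weight by k.
      obtain ⟨k, hk⟩ : ∃ k, k = r - j := ⟨_, rfl⟩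
      have hjk : j + k = r := by omega
      have hkn : n ≤ k := by omega
      refine ih (q - k) (by omega) (ρ (d k) v - a k • v)
        (N.sub_mem (hN _ _ hvN) (N.smul_mem _ hvN)) ?_
        (rep_sub_mem_wtLE hn hrn har hρ hy hkn le_rfl hv)
      have e₀ := eq_cons_erase hw₀w (fun i hi =>
        hmin w₀ (Finset.mem_filter.2 ⟨hw₀s, hw₀q⟩) i hi) hj
      have hu₀ : IsWord n (w₀.erase j) := by
        rw [e₀] at hw₀w
        exact (isWord_cons.1 hw₀w).2.2
      have hu₀q : wordWt r (w₀.erase j) = q - k := by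
        rw [e₀, wordWt_cons] at hw₀q
        omega
      set L : Whit n →ₗ[ℂ] ℂ := ((Finsupp.lapply (R := ℂ) (w₀.erase j)).comp (Whit.incl n)).comp
        (ρ (d k) - a k • LinearMap.id) with hL
      have hLapp : ∀ u, L u = Whit.incl n (ρ (d k) u - a k • u) (w₀.erase j) := fun u => rfl
      have hcoef : ∀ w ∈ (Whit.incl n v).support, wordWt r w = q → L (mono ρ (vac n) w)
          = w.count j * ((j : ℂ) - k) * a r *
            (Finsupp.single (w.erase j) (1 : ℂ) (w₀.erase j)) := by
        intro w hw hwq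
        have hww := isWord_of_mem_support hw
        have h1 := rep_sub_mono_leading hn hrn har hρ hy hjk hkn hww
          (fun i hi => hmin w (Finset.mem_filter.2 ⟨hw, hwq⟩) i hi)
        have h2 := incl_eq_zero_of_mem_wtLE θ hn ha hrn har h1 (w := w₀.erase j) (by omega)
        have hwe : IsWord n (w.erase j) :=
          ⟨hww.1.sublist List.erase_sublist, fun i hi => hww.2 i (List.mem_of_mem_erase hi)⟩
        rw [map_sub, Finsupp.sub_apply, sub_eq_zero] at h2
        rw [hLapp, h2, mono_whitRep θ hn ha hwe, map_smul, incl_wordVec, Finsupp.smul_apply,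
          smul_eq_mul]
      -- Among top-weight words only w₀ contributes: a word containing its minimal possible letter j
      -- begins with j and is recovered by prepending j to its erasure. Words of lower weight end up
      -- below weight q - k.
      have hsum : L v = Whit.incl n v w₀ * L (mono ρ (vac n) w₀) := by
        conv_lhs => rw [← sum_mono_incl θ hn ha v]
        rw [Finsupp.linearCombination_apply, map_finsuppSum, Finsupp.sum, Finset.sum_eq_single w₀]
        · rw [map_smul, smul_eq_mul]
        · intro w hw hne
          rw [map_smul]
          by_cases hwq : wordWt r w = q
          · rw [hcoef w hw hwq]
            by_cases hjw : j ∈ w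
            · rw [Finsupp.single_eq_of_ne, mul_zero, smul_zero]
              intro h
              apply hne
              rw [e₀, h]
              exact eq_cons_erase (isWord_of_mem_support hw) (fun i hi =>
                hmin w (Finset.mem_filter.2 ⟨hw, hwq⟩) i hi) hjw
            · rw [List.count_eq_zero_of_not_mem hjw]
              simp
          · have hwq' := lt_of_le_of_ne (hle w hw) hwq
            rw [hLapp, incl_eq_zero_of_mem_wtLE θ hn ha hrn har
              (rep_sub_mono_mem_wtLE hn hrn har hρ hy (isWord_of_mem_support hw).2 k _ hkn le_rfl)
              (by omega), smul_zero]
        · intro h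
          exact absurd hw₀s h
      intro hzero
      have : L v = 0 := by rw [hLapp, hzero]; simp
      rw [hsum, hcoef w₀ hw₀s hw₀q, Finsupp.single_eq_same, mul_one] at this
      have hcount : (w₀.count j : ℂ) ≠ 0 := by
        rw [Nat.cast_ne_zero]
        exact (List.count_pos_iff.2 hj).ne'
      have hjk' : ((j : ℂ) - k) ≠ 0 := by
        rw [sub_ne_zero]
        exact_mod_cast (by omega : j ≠ k)
      exact mul_ne_zero (Finsupp.mem_support_iff.1 hw₀s)
        (mul_ne_zero (mul_ne_zero hcount hjk') hr0) this

/-- The Whittaker module is irreducible when `a (2 n - 1)` or `a (2 n)` is nonzero. -/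
theorem whit_irreducible (h : a (2 * n - 1) ≠ 0 ∨ a (2 * n) ≠ 0) {N : Submodule ℂ (Whit n)}
    (hN : ∀ i, ∀ v ∈ N, whitRep θ hn ha (d i) v ∈ N) (hN0 : N ≠ ⊥) : N = ⊤ := by
  obtain ⟨v, hv, hv0⟩ := N.exists_mem_ne_zero_of_ne_bot hN0
  refine eq_top_of_vac_mem θ hn ha hN ?_
  -- The index r is the last one at which a does not vanish; by hypothesis it is 2n or 2n - 1.
  obtain ⟨r, hr, har, hr0⟩ : ∃ r, 2 * n - 1 ≤ r ∧ (∀ k, r < k → a k = 0) ∧ a r ≠ 0 := by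
    by_cases h2 : a (2 * n) = 0
    · refine ⟨2 * n - 1, le_rfl, fun k hk => ?_, h.resolve_right (not_not.2 h2)⟩
      rcases eq_or_lt_of_le (show 2 * n ≤ k by omega) with rfl | hk
      · exact h2
      · exact ha k hk
    · exact ⟨2 * n, by omega, ha, h2⟩
  obtain ⟨q, hq⟩ : ∃ q : ℤ, ∀ w ∈ (Whit.incl n v).support, wordWt r w ≤ q := by
    obtain ⟨q, hq⟩ := ((Whit.incl n v).support.image (wordWt r)).bddAbove
    exact ⟨q, fun w hw => hq (Finset.mem_image_of_mem _ hw)⟩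
  exact vac_mem_of_mem_wtLE θ hn ha hr har hr0 hN (q.toNat + 1) q (by omega) v hv hv0
    (mem_wtLE_of_support θ hn ha hq)

/-- The Whittaker module is reducible when `a (2 n - 1) = a (2 n) = 0`. -/
theorem whit_reducible (h1 : a (2 * n - 1) = 0) (h2 : a (2 * n) = 0) :
    ∃ N : Submodule ℂ (Whit n), (∀ i, ∀ v ∈ N, whitRep θ hn ha (d i) v ∈ N) ∧ N ≠ ⊥ ∧ N ≠ ⊤ := by
  set ρ := whitRep θ hn ha with hρdef
  have hw1 : IsWord n [n - 1] := isWord_cons.2 ⟨by omega, by simp, isWord_nil n⟩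
  have hy : ∀ k, n ≤ k → ρ (d k) (wordVec hw1) = a k • wordVec hw1 := by
    intro k hk
    rw [← whitRep_wordVec θ hn ha hw1, ← hρdef]
    change ρ (d k) (ρ (d (n - 1)) (vac n)) = a k • ρ (d (n - 1)) (vac n)
    -- Moving `d k` past `d (n - 1)` produces `d (k + n - 1)` with k + n - 1 ≥ 2n - 1, which kills
    -- the generator. Thus `d (n - 1)` applied to the generator is again a Whittaker vector of the
    -- same type.
    have h0 : a (k + (n - 1)) = 0 := by
      rcases eq_or_lt_of_le (show n ≤ k by omega) with rfl | hk
      · rw [show n + (n - 1) = 2 * n - 1 by ring, h1]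
      · rcases eq_or_lt_of_le (show n + 1 ≤ k by omega) with rfl | hk
        · rw [show n + 1 + (n - 1) = 2 * n by ring, h2]
        · exact ha _ (by omega)
    rw [rep_d_comm (whitRep_hasCharge θ hn ha), cocyc, if_neg (by omega), hρdef,
      whitRep_vac θ hn ha hk, whitRep_vac θ hn ha (show n ≤ k + (n - 1) by omega), h0]
    simp
  refine ⟨LinearMap.range (whitLift (n := n) ρ (wordVec hw1)), ?_, ?_, ?_⟩
  · rintro i _ ⟨v, rfl⟩
    exact ⟨ρ (d i) v, whitLift_rep θ hn ha (whitRep_hasCharge θ hn ha) hy i v⟩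
  · intro h
    have : wordVec hw1 ∈ LinearMap.range (whitLift (n := n) ρ (wordVec hw1)) :=
      ⟨vac n, whitLift_vac _ _⟩
    rw [h, Submodule.mem_bot] at this
    have := congrArg (fun v => Whit.incl n v [n - 1]) this
    simp [incl_wordVec] at this
  · intro h
    -- The letter n - 1 is the largest one allowed, so appending it keeps a word ordered. The
    -- submodule is therefore spanned by nonempty words and misses the generator.
    have hker : (Finsupp.lapply (R := ℂ) []).comp
        ((Whit.incl n).comp (whitLift (n := n) ρ (wordVec hw1))) = 0 := by
      have : LinearMap.ker ((Finsupp.lapply (R := ℂ) []).comp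
          ((Whit.incl n).comp (whitLift (n := n) ρ (wordVec hw1)))) = ⊤ := by
        refine whit_le_of_wordVec fun w hw => ?_
        have hw' : IsWord n (w ++ [n - 1]) := by
          refine ⟨List.pairwise_append.2 ⟨hw.1, by simp, fun i hi j hj => ?_⟩, fun i hi => ?_⟩
          · have := hw.2 i hi
            rw [List.mem_singleton] at hj
            omega
          · rcases List.mem_append.1 hi with hi | hi
            · exact hw.2 i hi
            · exact hw1.2 i hi
        have e : mono ρ (wordVec hw1) w = wordVec hw' := by
          rw [← mono_whitRep θ hn ha hw', mono_append, ← mono_whitRep θ hn ha hw1]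
        rw [LinearMap.mem_ker, LinearMap.comp_apply, LinearMap.comp_apply, whitLift_wordVec, e,
          incl_wordVec]
        simp
      exact LinearMap.ker_eq_top.1 this
    have hv : vac n ∈ LinearMap.range (whitLift (n := n) ρ (wordVec hw1)) := h ▸ Submodule.mem_top
    obtain ⟨v, hv⟩ := hv
    have := LinearMap.congr_fun hker v
    rw [LinearMap.comp_apply, LinearMap.comp_apply, hv] at this
    simp [vac, incl_wordVec] at this

end WhitIrreducible

/-! ### Tensor products with polynomial modules -/

section TensorRep

variable {Z : Type*} [AddCommGroup Z] [Module ℂ Z]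

/-- The substitution `f(s) ↦ f(s - k)`. -/
def shift (k : ℤ) : ℂ[X] →ₗ[ℂ] ℂ[X] :=
  (Polynomial.aeval (Polynomial.X - Polynomial.C (k : ℂ)) : ℂ[X] →ₐ[ℂ] ℂ[X]).toLinearMap

theorem shift_mul (k : ℤ) (f g : ℂ[X]) : shift k (f * g) = shift k f * shift k g :=
  map_mul (Polynomial.aeval (Polynomial.X - Polynomial.C (k : ℂ)) : ℂ[X] →ₐ[ℂ] ℂ[X]) f g

@[simp] theorem shift_X (k : ℤ) :
    shift k Polynomial.X = Polynomial.X - Polynomial.C (k : ℂ) := by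
  simp [shift]

@[simp] theorem shift_one (k : ℤ) : shift k 1 = 1 :=
  map_one (Polynomial.aeval (Polynomial.X - Polynomial.C (k : ℂ)) : ℂ[X] →ₐ[ℂ] ℂ[X])

theorem shift_pow (k : ℤ) (j : ℕ) :
    shift k (Polynomial.X ^ j) = (Polynomial.X - Polynomial.C (k : ℂ)) ^ j := by
  simp [shift]

theorem shift_shift (i j : ℤ) (f : ℂ[X]) : shift i (shift j f) = shift (i + j) f := by
  have : (Polynomial.aeval (Polynomial.X - Polynomial.C (i : ℂ)) : ℂ[X] →ₐ[ℂ] ℂ[X]).comp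
      (Polynomial.aeval (Polynomial.X - Polynomial.C (j : ℂ)) : ℂ[X] →ₐ[ℂ] ℂ[X])
      = Polynomial.aeval (Polynomial.X - Polynomial.C ((i + j : ℤ) : ℂ)) := by
    ext
    simp
    ring
  exact DFunLike.congr_fun this f

/-- Multiplication by the variable. -/
def mulX : ℂ[X] →ₗ[ℂ] ℂ[X] := LinearMap.mulLeft ℂ Polynomial.X

@[simp] theorem mulX_apply (f : ℂ[X]) : mulX f = Polynomial.X * f := rfl

variable (lam : ℂˣ) (α : ℂ) (F G : Module.End ℂ Z) (ρ : Vir →ₗ⁅ℂ⁆ Module.End ℂ Z)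

/-- The operator `k G - k ^ 2 α F`. -/
def kOp (k : ℤ) : Module.End ℂ Z := (k : ℂ) • G - ((k : ℂ) ^ 2 * α) • F

theorem kOp_apply (k : ℤ) (z : Z) :
    kOp α F G k z = (k : ℂ) • G z - ((k : ℂ) ^ 2 * α) • F z := rfl

/-- The operator `f ⊗ z ↦ s f(s - k) ⊗ z + f(s - k) ⊗ (k G - k ^ 2 α F) z`. -/
def polyOp (k : ℤ) : Module.End ℂ (ℂ[X] ⊗[ℂ] Z) :=
  TensorProduct.map (mulX.comp (shift k)) LinearMap.id
    + TensorProduct.map (shift k) (kOp α F G k)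

theorem polyOp_tmul (k : ℤ) (f : ℂ[X]) (z : Z) : polyOp α F G k (f ⊗ₜ z)
    = (Polynomial.X * shift k f) ⊗ₜ z + shift k f ⊗ₜ kOp α F G k z := rfl

/-- The operator by which `d k` acts on `ℂ[s] ⊗ Z`. -/
def tensOp (k : ℤ) : Module.End ℂ (ℂ[X] ⊗[ℂ] Z) :=
  ((lam ^ k : ℂˣ) : ℂ) • polyOp α F G k + TensorProduct.map LinearMap.id (ρ (d k))

theorem tensOp_apply (k : ℤ) (u : ℂ[X] ⊗[ℂ] Z) : tensOp lam α F G ρ k u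
    = ((lam ^ k : ℂˣ) : ℂ) • polyOp α F G k u + TensorProduct.map LinearMap.id (ρ (d k)) u := rfl

theorem tensOp_tmul (k : ℤ) (f : ℂ[X]) (z : Z) : tensOp lam α F G ρ k (f ⊗ₜ z)
    = ((lam ^ k : ℂˣ) : ℂ) • ((Polynomial.X * shift k f) ⊗ₜ z + shift k f ⊗ₜ kOp α F G k z)
      + f ⊗ₜ ρ (d k) z := rfl

variable {F G ρ}

/-- Writing A_k for `kOp` at k, the relations for the polynomial part require j A_j - i A_i + [A_i,
A_j] = (j - i) A_{i+j}. This commutator is precisely what makes up for the cubic discrepancy in the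
F-terms. -/
theorem kOp_comm (hGF : ∀ z, G (F z) = F (G z) + F z) (i j : ℤ) (z : Z) :
    kOp α F G i (kOp α F G j z) - kOp α F G j (kOp α F G i z)
      = -((i : ℂ) * j * (j - i) * α) • F z := by
  simp only [kOp_apply, map_sub, map_smul, hGF]
  module

/-- The operator is a sum of two commuting actions: a centreless one, by `kOp_comm`, and the given
one of charge θ. They commute because F and G commute with ρ. -/
theorem isVirAction_tensOp {θ : ℂ} (hρ : HasCharge ρ θ) (hGF : ∀ z, G (F z) = F (G z) + F z)
    (hF : ∀ k z, ρ (d k) (F z) = F (ρ (d k) z)) (hG : ∀ k z, ρ (d k) (G z) = G (ρ (d k) z)) :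
    IsVirAction θ (tensOp lam α F G ρ) := by
  intro i j u
  have hcomm := kOp_comm α hGF
  have hk : ∀ i j z, ρ (d i) (kOp α F G j z) = kOp α F G j (ρ (d i) z) := by
    intro i j z
    simp only [kOp_apply, map_sub, map_smul, hF, hG]
  induction u using TensorProduct.induction_on with
  | zero => simp
  | add u v hu hv =>
    simp only [map_add, smul_add]
    rw [add_sub_add_comm, hu, hv]
    abel
  | tmul f z =>
    have e := congrArg (fun y => (shift (i + j) f) ⊗ₜ[ℂ] y) (hcomm i j z)
    have e2 := congrArg (fun y => f ⊗ₜ[ℂ] y) (rep_d_comm hρ i j z)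
    have hlam : lam ^ (i + j) = lam ^ i * lam ^ j := zpow_add lam i j
    rw [← cocyc]
    simp only [tensOp_tmul, map_add, map_smul, shift_mul, shift_shift, shift_X, hk, add_comm j i]
    simp only [TensorProduct.tmul_sub, TensorProduct.tmul_add, TensorProduct.tmul_smul,
      kOp_apply α F G (i + j), neg_smul, TensorProduct.tmul_neg] at e e2 ⊢
    have p1 : ∀ (y : Z) (k : ℤ) (g : ℂ[X]), ((Polynomial.X - Polynomial.C (k : ℂ)) * g) ⊗ₜ[ℂ] y
        = (Polynomial.X * g) ⊗ₜ[ℂ] y - (k : ℂ) • (g ⊗ₜ[ℂ] y) := by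
      intro y k g
      rw [sub_mul, TensorProduct.sub_tmul, ← Polynomial.smul_eq_C_mul, TensorProduct.smul_tmul']
    have p2 : ∀ (y : Z) (k : ℤ) (g : ℂ[X]),
        (Polynomial.X * ((Polynomial.X - Polynomial.C (k : ℂ)) * g)) ⊗ₜ[ℂ] y
        = (Polynomial.X * (Polynomial.X * g)) ⊗ₜ[ℂ] y - (k : ℂ) • ((Polynomial.X * g) ⊗ₜ[ℂ] y) := by
      intro y k g
      rw [mul_left_comm, p1, mul_left_comm]
    simp only [p1, p2, hlam, Units.val_mul]
    have q : ∀ k, (shift (i + j) f) ⊗ₜ[ℂ] kOp α F G k z = (k : ℂ) • (shift (i + j) f) ⊗ₜ[ℂ] G z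
        - ((k : ℂ) ^ 2 * α) • (shift (i + j) f) ⊗ₜ[ℂ] F z := by
      intro k
      rw [kOp_apply, TensorProduct.tmul_sub, TensorProduct.tmul_smul, TensorProduct.tmul_smul]
    rw [q, q]
    push_cast
    linear_combination (norm := module) ((lam ^ i : ℂˣ) : ℂ) • ((lam ^ j : ℂˣ) : ℂ) • e + e2

/-- The tensor product of `Z` with a polynomial module over the Virasoro algebra. -/
def tensRep {θ : ℂ} (hρ : HasCharge ρ θ) (hGF : ∀ z, G (F z) = F (G z) + F z)
    (hF : ∀ k z, ρ (d k) (F z) = F (ρ (d k) z)) (hG : ∀ k z, ρ (d k) (G z) = G (ρ (d k) z)) :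
    Vir →ₗ⁅ℂ⁆ Module.End ℂ (ℂ[X] ⊗[ℂ] Z) :=
  virRep θ (tensOp lam α F G ρ) (isVirAction_tensOp lam α hρ hGF hF hG)

end TensorRep

/-! ### Coefficients of polynomial families -/

section Coefficients

variable {V : Type*} [AddCommGroup V] [Module ℂ V]

/-- The value at `k` of the polynomial with the vector coefficients `c`. -/
def vecEval (k : ℤ) : (ℕ →₀ V) →ₗ[ℂ] V := Finsupp.lsum ℂ fun i => (k : ℂ) ^ i • LinearMap.id

@[simp] theorem vecEval_single (k : ℤ) (i : ℕ) (v : V) :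
    vecEval k (Finsupp.single i v) = (k : ℂ) ^ i • v := by
  simp [vecEval]

/-- Modulo `N`, any linear functional turns the family into a scalar polynomial in k with infinitely
many roots, so every coefficient vanishes modulo `N`. -/
theorem coeff_mem_of_vecEval_mem {N : Submodule ℂ V} (c : ℕ →₀ V) (K : ℤ)
    (h : ∀ k, K ≤ k → vecEval k c ∈ N) (i : ℕ) : c i ∈ N := by
  by_contra hi
  have hi' : N.mkQ (c i) ≠ 0 := by simpa using hi
  obtain ⟨ℓ, hℓ⟩ : ∃ ℓ : Module.Dual ℂ (V ⧸ N), ℓ (N.mkQ (c i)) ≠ 0 := by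
    by_contra! h'
    exact hi' ((Module.forall_dual_apply_eq_zero_iff ℂ _).1 h')
  set p : ℂ[X] := ∑ j ∈ c.support, Polynomial.monomial j (ℓ (N.mkQ (c j))) with hp
  have hroot : ∀ k : ℤ, K ≤ k → p.eval (k : ℂ) = 0 := by
    intro k hk
    have h1 : ℓ (N.mkQ (vecEval k c)) = 0 := by
      have h0 : N.mkQ (vecEval k c) = 0 := (Submodule.Quotient.mk_eq_zero N).2 (h k hk)
      rw [h0, map_zero]
    rw [← h1, hp, Polynomial.eval_finsetSum, vecEval, Finsupp.lsum_apply, Finsupp.sum, map_sum,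
      map_sum]
    refine Finset.sum_congr rfl fun j _ => ?_
    simp [mul_comm]
  have hp0 : p = 0 := by
    refine Polynomial.eq_zero_of_infinite_isRoot p ?_
    refine Set.Infinite.mono (s := (fun k : ℤ => (k : ℂ)) '' Set.Ici K) ?_ ?_
    · rintro _ ⟨k, hk, rfl⟩
      exact hroot k hk
    · exact (Set.Ici_infinite K).image Int.cast_injective.injOn
  have := congrArg (fun q => Polynomial.coeff q i) hp0
  simp only [hp, Polynomial.finsetSum_coeff, Polynomial.coeff_monomial, Polynomial.coeff_zero,
    Finset.sum_ite_eq'] at this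
  split_ifs at this with hs
  · exact hℓ this
  · rw [Finsupp.notMem_support_iff.1 hs, map_zero, map_zero] at hℓ
    exact hℓ rfl

end Coefficients

/-! ### Degree in the variable s -/

section Degree

variable {Z : Type*} [AddCommGroup Z] [Module ℂ Z]

/-- The elements of `ℂ[s] ⊗ Z` of degree less than `r`. -/
def degLT (Z : Type*) [AddCommGroup Z] [Module ℂ Z] (r : ℕ) : Submodule ℂ (ℂ[X] ⊗[ℂ] Z) :=
  Submodule.span ℂ {u | ∃ j < r, ∃ z : Z, u = (Polynomial.X ^ j : ℂ[X]) ⊗ₜ z}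

theorem X_pow_tmul_mem_degLT {r j : ℕ} (h : j < r) (z : Z) :
    (Polynomial.X ^ j : ℂ[X]) ⊗ₜ[ℂ] z ∈ degLT Z r :=
  Submodule.subset_span ⟨j, h, z, rfl⟩

theorem degLT_mono {r r' : ℕ} (h : r ≤ r') : degLT Z r ≤ degLT Z r' :=
  Submodule.span_mono fun _ ⟨j, hj, z, e⟩ => ⟨j, hj.trans_le h, z, e⟩

theorem degLT_zero : degLT Z 0 = ⊥ := by simp [degLT]

theorem tmul_mem_degLT {r : ℕ} {f : ℂ[X]} (hf : f.degree < r) (z : Z) :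
    f ⊗ₜ[ℂ] z ∈ degLT Z r := by
  rw [f.as_sum_support_C_mul_X_pow, TensorProduct.sum_tmul]
  refine Submodule.sum_mem _ fun j hj => ?_
  rw [← Polynomial.smul_eq_C_mul, ← TensorProduct.smul_tmul']
  refine Submodule.smul_mem _ _ (X_pow_tmul_mem_degLT ?_ z)
  exact_mod_cast (Polynomial.le_degree_of_mem_supp j hj).trans_lt hf

theorem exists_mem_degLT (u : ℂ[X] ⊗[ℂ] Z) : ∃ r, u ∈ degLT Z r := by
  induction u using TensorProduct.induction_on with
  | zero => exact ⟨0, Submodule.zero_mem _⟩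
  | add u v hu hv =>
    obtain ⟨r, hr⟩ := hu
    obtain ⟨r', hr'⟩ := hv
    exact ⟨max r r', Submodule.add_mem _ (degLT_mono (le_max_left _ _) hr)
      (degLT_mono (le_max_right _ _) hr')⟩
  | tmul f z =>
    exact ⟨f.natDegree + 1, tmul_mem_degLT
      (Polynomial.degree_le_natDegree.trans_lt (by exact_mod_cast Nat.lt_succ_self _)) z⟩

/-- The coefficient of `s ^ r` of an element of `ℂ[s] ⊗ Z`. -/
def coeffMap (Z : Type*) [AddCommGroup Z] [Module ℂ Z] (r : ℕ) : ℂ[X] ⊗[ℂ] Z →ₗ[ℂ] Z :=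
  (TensorProduct.lid ℂ Z).toLinearMap.comp (LinearMap.rTensor Z (Polynomial.lcoeff ℂ r))

@[simp] theorem coeffMap_tmul (r : ℕ) (f : ℂ[X]) (z : Z) :
    coeffMap Z r (f ⊗ₜ z) = f.coeff r • z := by
  simp [coeffMap]

theorem sub_coeff_mem_degLT {r : ℕ} {u : ℂ[X] ⊗[ℂ] Z} (hu : u ∈ degLT Z (r + 1)) :
    u - (Polynomial.X ^ r : ℂ[X]) ⊗ₜ coeffMap Z r u ∈ degLT Z r := by
  unfold degLT at hu
  induction hu using Submodule.span_induction with
  | zero => simp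
  | add u v _ _ hu hv =>
    rw [map_add, TensorProduct.tmul_add, add_sub_add_comm]
    exact Submodule.add_mem _ hu hv
  | smul c u _ hu =>
    rw [map_smul, TensorProduct.tmul_smul, ← smul_sub]
    exact Submodule.smul_mem _ _ hu
  | mem u h =>
    obtain ⟨j, hj, z, rfl⟩ := h
    rw [coeffMap_tmul, Polynomial.coeff_X_pow]
    split_ifs with h
    · subst h
      simp
    · rw [zero_smul, TensorProduct.tmul_zero, sub_zero]
      exact X_pow_tmul_mem_degLT (by omega) z

/-- A nonzero element of `ℂ[s] ⊗ Z` has a leading coefficient. -/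
theorem exists_leading_coeff {u : ℂ[X] ⊗[ℂ] Z} (hu : u ≠ 0) :
    ∃ r, u ∈ degLT Z (r + 1) ∧ coeffMap Z r u ≠ 0 := by
  classical
  have hex := exists_mem_degLT u
  obtain ⟨r, hr⟩ : ∃ r, Nat.find hex = r + 1 := by
    refine Nat.exists_eq_succ_of_ne_zero fun h => hu ?_
    have := Nat.find_spec hex
    rwa [h, degLT_zero, Submodule.mem_bot] at this
  have h1 : u ∈ degLT Z (r + 1) := hr ▸ Nat.find_spec hex
  refine ⟨r, h1, fun h => ?_⟩
  have := sub_coeff_mem_degLT h1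
  rw [h, TensorProduct.tmul_zero, sub_zero] at this
  have := Nat.find_min' hex this
  omega

end Degree

/-! ### Expansion in powers of k and irreducibility of tensor products -/

section Expansion

variable {Z : Type*} [AddCommGroup Z] [Module ℂ Z]

variable (lam : ℂˣ) (α : ℂ) (F G : Module.End ℂ Z) {ρ : Vir →ₗ⁅ℂ⁆ Module.End ℂ Z}

theorem X_sub_C_pow (k : ℤ) (j : ℕ) : (Polynomial.X - Polynomial.C (k : ℂ)) ^ j
    = ∑ i ∈ Finset.range (j + 1),
      (k : ℂ) ^ i • (((-1 : ℂ) ^ i * j.choose i) • (Polynomial.X ^ (j - i) : ℂ[X])) := by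
  rw [sub_eq_neg_add, add_pow]
  refine Finset.sum_congr rfl fun i _ => ?_
  rw [Polynomial.smul_eq_C_mul, Polynomial.smul_eq_C_mul, neg_pow]
  simp
  ring

/-- The operators by which `d k` acts depend polynomially on `k`, up to the factor `λ ^ k`. -/
theorem exists_polyOp_expansion (r : ℕ) {u : ℂ[X] ⊗[ℂ] Z} (hu : u ∈ degLT Z (r + 1)) :
    ∃ c : ℕ →₀ ℂ[X] ⊗[ℂ] Z, (∀ k, polyOp α F G k u = vecEval k c)
      ∧ c 0 = TensorProduct.map mulX LinearMap.id u
      ∧ c (r + 2) = ((-1) ^ (r + 1) * α) • (1 : ℂ[X]) ⊗ₜ F (coeffMap Z r u) := by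
  unfold degLT at hu
  induction hu using Submodule.span_induction with
  | zero => exact ⟨0, by simp⟩
  | add u v _ _ hu hv =>
    obtain ⟨c, h1, h2, h3⟩ := hu
    obtain ⟨c', h1', h2', h3'⟩ := hv
    exact ⟨c + c', fun k => by rw [map_add, map_add, h1, h1'],
      by rw [Finsupp.add_apply, h2, h2', map_add],
      by rw [Finsupp.add_apply, h3, h3', map_add, map_add, TensorProduct.tmul_add, smul_add]⟩
  | smul s u _ hu =>
    obtain ⟨c, h1, h2, h3⟩ := hu
    exact ⟨s • c, fun k => by rw [map_smul, map_smul, h1],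
      by rw [Finsupp.smul_apply, h2, map_smul],
      by rw [Finsupp.smul_apply, h3, map_smul, map_smul, TensorProduct.tmul_smul, smul_comm]⟩
  | mem u h =>
    obtain ⟨j, hj, z, rfl⟩ := h
    set b : ℕ → ℂ[X] := fun i => ((-1 : ℂ) ^ i * j.choose i) • (Polynomial.X ^ (j - i) : ℂ[X])
      with hb
    -- Binomial expansion of (s - k)^j: the factor s keeps the power k^i, the operator G raises it
    -- by one and F by two. Hence k^0 comes only from i = 0, and k^(r+2) only from the F-term with i
    -- = j = r.
    refine ⟨∑ i ∈ Finset.range (j + 1), (Finsupp.single i ((Polynomial.X * b i) ⊗ₜ z)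
      + Finsupp.single (i + 1) (b i ⊗ₜ G z) - Finsupp.single (i + 2) (α • b i ⊗ₜ F z)), ?_, ?_, ?_⟩
    · intro k
      rw [polyOp_tmul, shift_pow, X_sub_C_pow, Finset.mul_sum, TensorProduct.sum_tmul,
        TensorProduct.sum_tmul, ← Finset.sum_add_distrib, map_sum]
      refine Finset.sum_congr rfl fun i _ => ?_
      rw [map_sub, map_add, vecEval_single, vecEval_single, vecEval_single, kOp_apply,
        mul_smul_comm, ← TensorProduct.smul_tmul', ← TensorProduct.smul_tmul',
        TensorProduct.tmul_sub, TensorProduct.tmul_smul, TensorProduct.tmul_smul]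
      module
    · rw [Finsupp.finsetSum_apply, Finset.sum_eq_single 0]
      · simp [hb]
      · intro i _ hi
        simp [hi]
      · simp
    · rw [Finsupp.finsetSum_apply, coeffMap_tmul, Polynomial.coeff_X_pow]
      rcases eq_or_ne r j with rfl | hrj
      · rw [Finset.sum_eq_single r]
        · simp [hb, pow_succ, ← TensorProduct.smul_tmul', smul_smul, mul_comm]
          module
        · intro i hi hir
          rw [Finset.mem_range] at hi
          rw [Finsupp.sub_apply, Finsupp.add_apply, Finsupp.single_eq_of_ne (by omega),
            Finsupp.single_eq_of_ne (by omega), Finsupp.single_eq_of_ne (by omega)]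
          simp
        · simp
      · rw [if_neg hrj, zero_smul, map_zero, TensorProduct.tmul_zero, smul_zero]
        refine Finset.sum_eq_zero fun i hi => ?_
        rw [Finset.mem_range] at hi
        rw [Finsupp.sub_apply, Finsupp.add_apply, Finsupp.single_eq_of_ne (by omega),
          Finsupp.single_eq_of_ne (by omega), Finsupp.single_eq_of_ne (by omega)]
        simp

variable {lam α F G}

theorem exists_bound_map_eq_zero (hev : ∀ z : Z, ∃ K : ℤ, ∀ k, K ≤ k → ρ (d k) z = 0)
    (u : ℂ[X] ⊗[ℂ] Z) : ∃ K : ℤ, ∀ k, K ≤ k → TensorProduct.map LinearMap.id (ρ (d k)) u = 0 := by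
  induction u using TensorProduct.induction_on with
  | zero => exact ⟨0, by simp⟩
  | add u v hu hv =>
    obtain ⟨K, hK⟩ := hu
    obtain ⟨K', hK'⟩ := hv
    exact ⟨max K K', fun k hk => by
      rw [map_add, hK k ((le_max_left _ _).trans hk), hK' k ((le_max_right _ _).trans hk),
        add_zero]⟩
  | tmul f z =>
    obtain ⟨K, hK⟩ := hev z
    exact ⟨K, fun k hk => by rw [TensorProduct.map_tmul, hK k hk, TensorProduct.tmul_zero]⟩

section Stable

variable (hev : ∀ z : Z, ∃ K : ℤ, ∀ k, K ≤ k → ρ (d k) z = 0)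
  {N : Submodule ℂ (ℂ[X] ⊗[ℂ] Z)} (hN : ∀ k, ∀ u ∈ N, tensOp lam α F G ρ k u ∈ N)

include hev hN

/-- For large k the factor Z contributes nothing to the action on `u`, and the unit λ^k can be
divided out. -/
theorem exists_bound_polyOp_mem {u : ℂ[X] ⊗[ℂ] Z} (hu : u ∈ N) :
    ∃ K : ℤ, ∀ k, K ≤ k → polyOp α F G k u ∈ N := by
  obtain ⟨K, hK⟩ := exists_bound_map_eq_zero hev u
  refine ⟨K, fun k hk => ?_⟩
  have := hN k u hu
  rw [tensOp_apply, hK k hk, add_zero] at this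
  exact (N.smul_mem_iff (Units.ne_zero _)).1 this

theorem map_mulX_mem {u : ℂ[X] ⊗[ℂ] Z} (hu : u ∈ N) : TensorProduct.map mulX LinearMap.id u ∈ N := by
  obtain ⟨K, hK⟩ := exists_bound_polyOp_mem hev hN hu
  obtain ⟨r, hr⟩ := exists_mem_degLT u
  obtain ⟨c, h1, h2, -⟩ := exists_polyOp_expansion α F G r (degLT_mono (Nat.le_succ r) hr)
  rw [← h2]
  exact coeff_mem_of_vecEval_mem c K (fun k hk => h1 k ▸ hK k hk) 0

/-- This is the coefficient of the top power k^(r+2). It isolates F of the leading coefficient, with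
a factor ±α that must be invertible. -/
theorem leading_mem (hα : α ≠ 0) {r : ℕ} {u : ℂ[X] ⊗[ℂ] Z} (hr : u ∈ degLT Z (r + 1))
    (hu : u ∈ N) : (1 : ℂ[X]) ⊗ₜ F (coeffMap Z r u) ∈ N := by
  obtain ⟨K, hK⟩ := exists_bound_polyOp_mem hev hN hu
  obtain ⟨c, h1, -, h2⟩ := exists_polyOp_expansion α F G r hr
  have := coeff_mem_of_vecEval_mem c K (fun k hk => h1 k ▸ hK k hk) (r + 2)
  rw [h2] at this
  exact (N.smul_mem_iff (mul_ne_zero (pow_ne_zero _ (by norm_num)) hα)).1 this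

theorem one_tmul_mem (hα : α ≠ 0) {z : Z} (hz : (1 : ℂ[X]) ⊗ₜ z ∈ N) :
    (1 : ℂ[X]) ⊗ₜ F z ∈ N ∧ (1 : ℂ[X]) ⊗ₜ G z ∈ N := by
  obtain ⟨K, hK⟩ := exists_bound_polyOp_mem hev hN hz
  have key := coeff_mem_of_vecEval_mem (N := N)
    (Finsupp.single 0 (Polynomial.X ⊗ₜ z) + Finsupp.single 1 ((1 : ℂ[X]) ⊗ₜ G z)
      - Finsupp.single 2 (α • (1 : ℂ[X]) ⊗ₜ F z)) K (fun k hk => by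
        convert hK k hk using 1
        rw [polyOp_tmul, map_sub, map_add, vecEval_single, vecEval_single, vecEval_single,
          shift_one, mul_one, kOp_apply, TensorProduct.tmul_sub, TensorProduct.tmul_smul,
          TensorProduct.tmul_smul]
        module)
  refine ⟨?_, by simpa using key 1⟩
  have := key 2
  simp only [Finsupp.sub_apply, Finsupp.add_apply] at this
  rw [Finsupp.single_eq_of_ne (by omega), Finsupp.single_eq_of_ne (by omega),
    Finsupp.single_eq_same, add_zero, zero_sub, neg_mem_iff] at this
  exact (N.smul_mem_iff hα).1 this

theorem tmul_mem_of_one_tmul_mem {z : Z} (hz : (1 : ℂ[X]) ⊗ₜ z ∈ N) (f : ℂ[X]) : f ⊗ₜ z ∈ N := by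
  induction f using Polynomial.induction_on' with
  | add p q hp hq =>
    rw [TensorProduct.add_tmul]
    exact N.add_mem hp hq
  | monomial j c =>
    rw [← Polynomial.C_mul_X_pow_eq_monomial, ← Polynomial.smul_eq_C_mul,
      ← TensorProduct.smul_tmul']
    refine N.smul_mem c ?_
    induction j with
    | zero => simpa using hz
    | succ j ih =>
      have := map_mulX_mem hev hN ih
      rwa [TensorProduct.map_tmul, mulX_apply, ← pow_succ', LinearMap.id_apply] at this

theorem one_tmul_rep_mem (hα : α ≠ 0) {z : Z} (hz : (1 : ℂ[X]) ⊗ₜ z ∈ N) (k : ℤ) :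
    (1 : ℂ[X]) ⊗ₜ ρ (d k) z ∈ N := by
  obtain ⟨h1, h2⟩ := one_tmul_mem hev hN hα hz
  have h3 := hN k _ hz
  rw [tensOp_tmul] at h3
  refine (N.add_mem_iff_right (N.smul_mem _ (N.add_mem
    (tmul_mem_of_one_tmul_mem hev hN hz _) ?_))).1 h3
  rw [shift_one, kOp_apply, TensorProduct.tmul_sub, TensorProduct.tmul_smul,
    TensorProduct.tmul_smul]
  exact N.sub_mem (N.smul_mem _ h2) (N.smul_mem _ h1)

/-- If `Z` has no proper invariant subspaces, then neither does `ℂ[s] ⊗ Z`. -/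
theorem tens_irreducible (hα : α ≠ 0) (hF : Function.Injective F)
    (hZ : ∀ Y : Submodule ℂ Z, (∀ y ∈ Y, F y ∈ Y) → (∀ y ∈ Y, G y ∈ Y) →
      (∀ k, ∀ y ∈ Y, ρ (d k) y ∈ Y) → Y ≠ ⊥ → Y = ⊤) (hN0 : N ≠ ⊥) : N = ⊤ := by
  -- The subspace of all z with 1 ⊗ z in `N` is stable under F, G and Vir. It is nonzero because it
  -- contains F of a leading coefficient and F is injective.
  have hY := hZ (N.comap (TensorProduct.mk ℂ ℂ[X] Z 1))
    (fun y hy => (one_tmul_mem hev hN hα hy).1) (fun y hy => (one_tmul_mem hev hN hα hy).2)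
    (fun k y hy => one_tmul_rep_mem hev hN hα hy k) (by
      obtain ⟨u, hu, hu0⟩ := N.exists_mem_ne_zero_of_ne_bot hN0
      obtain ⟨r, hr, hr0⟩ := exists_leading_coeff hu0
      refine (Submodule.ne_bot_iff _).2 ⟨_, leading_mem hev hN hα hr hu, ?_⟩
      rwa [Ne, map_eq_zero_iff F hF])
  rw [eq_top_iff]
  rintro u -
  induction u using TensorProduct.induction_on with
  | zero => exact N.zero_mem
  | add u v hu hv => exact N.add_mem hu hv
  | tmul f z =>
    have hz : z ∈ N.comap (TensorProduct.mk ℂ ℂ[X] Z 1) := hY ▸ Submodule.mem_top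
    exact tmul_mem_of_one_tmul_mem hev hN hz f

end Stable

end Expansion

/-! ### The tensor product with the Whittaker module -/

section Polynomials

variable {α : ℂ} {h : ℂ[X]}

theorem opF_apply (α : ℂ) (h f : ℂ[X]) : opF α h f
    = ((h - Polynomial.C (h.eval α)) /ₘ (Polynomial.X - Polynomial.C α)) * f
      - Polynomial.derivative f := rfl

theorem opG_apply (α : ℂ) (h f : ℂ[X]) :
    opG α h f = h.eval α • f + Polynomial.X * opF α h f := rfl

theorem natDegree_divDiff (α : ℂ) (h : ℂ[X]) :
    ((h - Polynomial.C (h.eval α)) /ₘ (Polynomial.X - Polynomial.C α)).natDegree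
      = h.natDegree - 1 := by
  rw [Polynomial.natDegree_divByMonic _ (Polynomial.monic_X_sub_C α), Polynomial.natDegree_sub_C,
    Polynomial.natDegree_X_sub_C]

theorem opF_of_natDegree_zero (hh : h.natDegree = 0) (f : ℂ[X]) :
    opF α h f = -Polynomial.derivative f := by
  obtain ⟨c, rfl⟩ := Polynomial.natDegree_eq_zero.1 hh
  rw [opF_apply]
  simp

theorem exists_opF_of_natDegree_one (hh : h.natDegree = 1) :
    ∃ m : ℂ, m ≠ 0 ∧ ∀ f, opF α h f = m • f - Polynomial.derivative f := by
  obtain ⟨m, hm, b, rfl⟩ := Polynomial.natDegree_eq_one.1 hh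
  refine ⟨m, hm, fun f => ?_⟩
  have e : (Polynomial.C m * Polynomial.X + Polynomial.C b
      - Polynomial.C ((Polynomial.C m * Polynomial.X + Polynomial.C b).eval α))
      = (Polynomial.X - Polynomial.C α) * Polynomial.C m := by
    simp
    ring
  rw [opF_apply, e, Polynomial.mul_divByMonic_cancel_left _ (Polynomial.monic_X_sub_C α),
    Polynomial.smul_eq_C_mul]

theorem natDegree_opF (hh : 2 ≤ h.natDegree) {f : ℂ[X]} (hf : f ≠ 0) :
    (opF α h f).natDegree = h.natDegree - 1 + f.natDegree := by
  have hg := natDegree_divDiff α h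
  have hg0 : (h - Polynomial.C (h.eval α)) /ₘ (Polynomial.X - Polynomial.C α) ≠ 0 := by
    intro h0
    rw [h0, Polynomial.natDegree_zero] at hg
    omega
  have hd := Polynomial.natDegree_derivative_le f
  rw [opF_apply, Polynomial.natDegree_sub_eq_left_of_natDegree_lt,
    Polynomial.natDegree_mul hg0 hf, hg]
  rw [Polynomial.natDegree_mul hg0 hf, hg]
  omega

/-- If `deg h ≠ 1` or `α = 0`, then `ℂ[t]` has a proper subspace invariant under the operators
`k G - k ^ 2 α F`. -/
theorem exists_invariant_polynomials (hh : h.natDegree ≠ 1 ∨ α = 0) :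
    ∃ Y : Submodule ℂ ℂ[X], (∀ k, ∀ y ∈ Y, kOp α (opF α h) (opG α h) k y ∈ Y)
      ∧ Y ≠ ⊥ ∧ Y ≠ ⊤ := by
  by_cases hα : α = 0
  · subst hα
    -- For α = 0 only G acts, and the value of G f at 0 is h(0) f(0); polynomials vanishing at 0 are
    -- preserved.
    refine ⟨LinearMap.ker (Polynomial.leval (0 : ℂ)), fun k y hy => ?_, ?_, ?_⟩
    · rw [LinearMap.mem_ker, Polynomial.leval_apply] at hy ⊢
      simp [kOp_apply, opG_apply, hy]
    · refine (Submodule.ne_bot_iff _).2 ⟨Polynomial.X, ?_, Polynomial.X_ne_zero⟩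
      simp [Polynomial.leval]
    · intro h1
      have : (1 : ℂ[X]) ∈ LinearMap.ker (Polynomial.leval (0 : ℂ)) := h1 ▸ Submodule.mem_top
      simp [Polynomial.leval] at this
  have hh1 := hh.resolve_right hα
  rcases Nat.lt_or_ge h.natDegree 1 with h0 | h2
  · have h0' : h.natDegree = 0 := by omega
    have hF := opF_of_natDegree_zero (α := α) h0'
    -- Here F = -d/dt, so its kernel consists of the constants, on which G is the scalar h(α).
    refine ⟨LinearMap.ker (opF α h), fun k y hy => ?_, ?_, ?_⟩
    · rw [LinearMap.mem_ker] at hy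
      have : kOp α (opF α h) (opG α h) k y = ((k : ℂ) * h.eval α) • y := by
        simp [kOp_apply, opG_apply, hy, smul_smul]
      rw [this]
      exact Submodule.smul_mem _ _ hy
    · refine (Submodule.ne_bot_iff _).2 ⟨1, ?_, one_ne_zero⟩
      simp [hF]
    · intro h1
      have : (Polynomial.X : ℂ[X]) ∈ LinearMap.ker (opF α h) := h1 ▸ Submodule.mem_top
      simp [hF] at this
  · have h2' : 2 ≤ h.natDegree := by omega
    -- The relation G F = F (G + 1) makes the range of F invariant. It is proper because F raises
    -- the degree of every nonzero polynomial by deg h - 1 ≥ 1, so 1 is not attained.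
    refine ⟨LinearMap.range (opF α h), ?_, ?_, ?_⟩
    · rintro k _ ⟨f, rfl⟩
      refine ⟨(k : ℂ) • (opG α h f + f) - ((k : ℂ) ^ 2 * α) • opF α h f, ?_⟩
      rw [kOp_apply, opG_opF, map_sub, map_smul, map_smul, map_add]
    · refine (Submodule.ne_bot_iff _).2 ⟨_, ⟨1, rfl⟩, fun h0 => ?_⟩
      have := natDegree_opF (α := α) h2' one_ne_zero
      rw [h0, Polynomial.natDegree_zero, Polynomial.natDegree_one] at this
      omega
    · intro h1
      have : (1 : ℂ[X]) ∈ LinearMap.range (opF α h) := h1 ▸ Submodule.mem_top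
      obtain ⟨f, hf⟩ := this
      have hf0 : f ≠ 0 := by
        rintro rfl
        simp at hf
      have := natDegree_opF (α := α) h2' hf0
      rw [hf, Polynomial.natDegree_one] at this
      omega

end Polynomials

/-! ### Tensor products of the polynomial module with a representation W -/

section Target

variable {W : Type*} [AddCommGroup W] [Module ℂ W] {σ : Vir →ₗ⁅ℂ⁆ Module.End ℂ W} {θ : ℂ}

theorem isVirAction_lTensor (hσ : HasCharge σ θ) : IsVirAction θ (fun k =>
    (TensorProduct.map LinearMap.id (σ (d k)) : Module.End ℂ (ℂ[X] ⊗[ℂ] W))) := by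
  intro i j u
  rw [← cocyc]
  induction u using TensorProduct.induction_on with
  | zero => simp
  | add u v hu hv =>
    simp only [map_add, smul_add]
    rw [add_sub_add_comm, hu, hv]
    abel
  | tmul f z =>
    simp only [TensorProduct.map_tmul, LinearMap.id_apply, ← TensorProduct.tmul_smul,
      ← TensorProduct.tmul_sub, ← TensorProduct.tmul_add]
    rw [rep_d_comm hσ i j z]
    congr 1
    abel

/-- The representation on `ℂ[t] ⊗ W` through the second factor. -/
def lTensorRep (hσ : HasCharge σ θ) : Vir →ₗ⁅ℂ⁆ Module.End ℂ (ℂ[X] ⊗[ℂ] W) :=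
  virRep θ _ (isVirAction_lTensor hσ)

theorem lTensorRep_d (hσ : HasCharge σ θ) (k : ℤ) :
    lTensorRep hσ (d k) = TensorProduct.map LinearMap.id (σ (d k)) :=
  virRep_d _ _ _ k

theorem lTensorRep_hasCharge (hσ : HasCharge σ θ) : HasCharge (lTensorRep hσ) θ := by
  intro v
  rw [lTensorRep, virRep_c]
  simp

/-- The operator `F` on `ℂ[t] ⊗ W`. -/
def tF (α : ℂ) (h : ℂ[X]) (W : Type*) [AddCommGroup W] [Module ℂ W] :
    Module.End ℂ (ℂ[X] ⊗[ℂ] W) := TensorProduct.map (opF α h) LinearMap.id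

/-- The operator `G` on `ℂ[t] ⊗ W`. -/
def tG (α : ℂ) (h : ℂ[X]) (W : Type*) [AddCommGroup W] [Module ℂ W] :
    Module.End ℂ (ℂ[X] ⊗[ℂ] W) := TensorProduct.map (opG α h) LinearMap.id

theorem tF_tmul (α : ℂ) (h f : ℂ[X]) (w : W) : tF α h W (f ⊗ₜ w) = opF α h f ⊗ₜ w := rfl

theorem tG_tmul (α : ℂ) (h f : ℂ[X]) (w : W) : tG α h W (f ⊗ₜ w) = opG α h f ⊗ₜ w := rfl

theorem tG_tF (α : ℂ) (h : ℂ[X]) (z : ℂ[X] ⊗[ℂ] W) :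
    tG α h W (tF α h W z) = tF α h W (tG α h W z) + tF α h W z := by
  induction z using TensorProduct.induction_on with
  | zero => simp
  | add u v hu hv => simp only [map_add, hu, hv]; abel
  | tmul f w =>
    rw [tF_tmul, tG_tmul, tG_tmul, tF_tmul, opG_opF, TensorProduct.add_tmul]

theorem lTensorRep_tF (hσ : HasCharge σ θ) (α : ℂ) (h : ℂ[X]) (k : ℤ) (z : ℂ[X] ⊗[ℂ] W) :
    lTensorRep hσ (d k) (tF α h W z) = tF α h W (lTensorRep hσ (d k) z) := by
  rw [lTensorRep_d, tF, ← LinearMap.comp_apply, ← LinearMap.comp_apply, ← TensorProduct.map_comp,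
    ← TensorProduct.map_comp]
  rfl

theorem lTensorRep_tG (hσ : HasCharge σ θ) (α : ℂ) (h : ℂ[X]) (k : ℤ) (z : ℂ[X] ⊗[ℂ] W) :
    lTensorRep hσ (d k) (tG α h W z) = tG α h W (lTensorRep hσ (d k) z) := by
  rw [lTensorRep_d, tG, ← LinearMap.comp_apply, ← LinearMap.comp_apply, ← TensorProduct.map_comp,
    ← TensorProduct.map_comp]
  rfl

theorem kOp_tmul (α : ℂ) (h f : ℂ[X]) (w : W) (k : ℤ) :
    kOp α (tF α h W) (tG α h W) k (f ⊗ₜ w) = kOp α (opF α h) (opG α h) k f ⊗ₜ w := by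
  simp only [kOp_apply, tF_tmul, tG_tmul, TensorProduct.sub_tmul, TensorProduct.smul_tmul']

/-- The tensor product of the polynomial module on `ℂ[s, t]` with `W`. -/
def targetRep (lam : ℂˣ) (α : ℂ) (h : ℂ[X]) (hσ : HasCharge σ θ) :
    Vir →ₗ⁅ℂ⁆ Module.End ℂ (ℂ[X] ⊗[ℂ] (ℂ[X] ⊗[ℂ] W)) :=
  tensRep lam α (lTensorRep_hasCharge hσ) (tG_tF α h) (lTensorRep_tF hσ α h) (lTensorRep_tG hσ α h)

theorem targetRep_d (lam : ℂˣ) (α : ℂ) (h : ℂ[X]) (hσ : HasCharge σ θ) (k : ℤ) :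
    targetRep lam α h hσ (d k) = tensOp lam α (tF α h W) (tG α h W) (lTensorRep hσ) k := by
  rw [targetRep, tensRep, virRep_d]

theorem targetRep_hasCharge (lam : ℂˣ) (α : ℂ) (h : ℂ[X]) (hσ : HasCharge σ θ) :
    HasCharge (targetRep lam α h hσ) θ := by
  intro v
  rw [targetRep, tensRep, virRep_c]
  simp

theorem targetRep_tmul (lam : ℂˣ) (α : ℂ) (h : ℂ[X]) (hσ : HasCharge σ θ) (k : ℤ) (f x : ℂ[X])
    (w : W) : targetRep lam α h hσ (d k) (f ⊗ₜ (x ⊗ₜ w))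
      = ((lam ^ k : ℂˣ) : ℂ) • ((Polynomial.X * shift k f) ⊗ₜ (x ⊗ₜ w)
          + shift k f ⊗ₜ (kOp α (opF α h) (opG α h) k x ⊗ₜ w))
        + f ⊗ₜ (x ⊗ₜ σ (d k) w) := by
  rw [targetRep_d, tensOp_tmul, kOp_tmul, lTensorRep_d]
  rfl

/-- The map `f ⊗ x ⊗ w ↦ f(0) ℓ(x) w`. -/
def contract (W : Type*) [AddCommGroup W] [Module ℂ W] (ℓ : ℂ[X] →ₗ[ℂ] ℂ) :
    ℂ[X] ⊗[ℂ] (ℂ[X] ⊗[ℂ] W) →ₗ[ℂ] W :=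
  ((TensorProduct.lid ℂ W).toLinearMap.comp (TensorProduct.map ℓ LinearMap.id)).comp (coeffMap _ 0)

theorem contract_tmul (ℓ : ℂ[X] →ₗ[ℂ] ℂ) (f x : ℂ[X]) (w : W) :
    contract W ℓ (f ⊗ₜ (x ⊗ₜ w)) = f.coeff 0 • ℓ x • w := by
  simp [contract]

theorem exists_contract_one_tmul_ne_zero {x : ℂ[X]} (hx : x ≠ 0) {w : W} (hw : w ≠ 0) :
    (1 : ℂ[X]) ⊗ₜ[ℂ] (x ⊗ₜ[ℂ] w) ≠ 0 := by
  obtain ⟨ℓ, hℓ⟩ : ∃ ℓ : Module.Dual ℂ ℂ[X], ℓ x ≠ 0 := by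
    by_contra! h'
    exact hx ((Module.forall_dual_apply_eq_zero_iff ℂ _).1 h')
  intro h0
  have := congrArg (contract W ℓ) h0
  rw [contract_tmul, map_zero, Polynomial.coeff_one_zero, one_smul] at this
  exact smul_ne_zero hℓ hw this

/-- Invariant subspaces of the two factors give an invariant subspace of the tensor product. -/
theorem exists_invariant_target (lam : ℂˣ) (α : ℂ) (h : ℂ[X]) (hσ : HasCharge σ θ) [Nontrivial W]
    {Y : Submodule ℂ ℂ[X]} (hY : ∀ k, ∀ y ∈ Y, kOp α (opF α h) (opG α h) k y ∈ Y) (hY0 : Y ≠ ⊥)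
    {W' : Submodule ℂ W} (hW' : ∀ k, ∀ w ∈ W', σ (d k) w ∈ W') (hW0 : W' ≠ ⊥)
    (hne : Y ≠ ⊤ ∨ W' ≠ ⊤) :
    ∃ N : Submodule ℂ (ℂ[X] ⊗[ℂ] (ℂ[X] ⊗[ℂ] W)),
      (∀ k, ∀ u ∈ N, targetRep lam α h hσ (d k) u ∈ N) ∧ N ≠ ⊥ ∧ N ≠ ⊤ := by
  set N : Submodule ℂ (ℂ[X] ⊗[ℂ] (ℂ[X] ⊗[ℂ] W)) := Submodule.span ℂ
    {u | ∃ f : ℂ[X], ∃ y ∈ Y, ∃ w ∈ W', u = f ⊗ₜ (y ⊗ₜ w)} with hN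
  have hmem : ∀ f : ℂ[X], ∀ y ∈ Y, ∀ w ∈ W', f ⊗ₜ (y ⊗ₜ w) ∈ N := fun f y hy w hw =>
    Submodule.subset_span ⟨f, y, hy, w, hw, rfl⟩
  refine ⟨N, fun k => ?_, ?_, ?_⟩
  · change N ≤ N.comap (targetRep lam α h hσ (d k))
    conv_lhs => rw [hN]
    rw [Submodule.span_le]
    rintro _ ⟨f, y, hy, w, hw, rfl⟩
    rw [SetLike.mem_coe, Submodule.mem_comap, targetRep_tmul]
    exact N.add_mem (N.smul_mem _ (N.add_mem (hmem _ _ hy _ hw) (hmem _ _ (hY k y hy) _ hw)))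
      (hmem _ _ hy _ (hW' k w hw))
  · obtain ⟨y, hy, hy0⟩ := Y.exists_mem_ne_zero_of_ne_bot hY0
    obtain ⟨w, hw, hw0⟩ := W'.exists_mem_ne_zero_of_ne_bot hW0
    exact (Submodule.ne_bot_iff _).2 ⟨_, hmem 1 y hy w hw, exists_contract_one_tmul_ne_zero hy0 hw0⟩
  · intro htop
    -- If `N` were everything, whatever contraction by ℓ gives on Y ⊗ W' would hold for all vectors.
    -- A functional ℓ vanishing on Y excludes Y ≠ ⊤, and evaluation at 0 excludes W' ≠ ⊤.
    have key : ∀ (ℓ : ℂ[X] →ₗ[ℂ] ℂ) (W'' : Submodule ℂ W),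
        (∀ y ∈ Y, ∀ w ∈ W', ℓ y • w ∈ W'') → ∀ x w, ℓ x • w ∈ W'' := by
      intro ℓ W'' hW'' x w
      have hle : N ≤ W''.comap (contract W ℓ) := by
        rw [hN, Submodule.span_le]
        rintro _ ⟨f, y, hy, w, hw, rfl⟩
        rw [SetLike.mem_coe, Submodule.mem_comap, contract_tmul]
        exact W''.smul_mem _ (hW'' y hy w hw)
      have : (1 : ℂ[X]) ⊗ₜ (x ⊗ₜ w) ∈ N := htop ▸ Submodule.mem_top
      have := hle this
      rwa [Submodule.mem_comap, contract_tmul, Polynomial.coeff_one_zero, one_smul] at this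
    rcases hne with hY1 | hW1
    · obtain ⟨ℓ, hℓ, hYℓ⟩ := Submodule.exists_le_ker_of_lt_top Y (lt_top_iff_ne_top.2 hY1)
      obtain ⟨w, hw⟩ := exists_ne (0 : W)
      refine hℓ (LinearMap.ext fun x => ?_)
      have := key ℓ ⊥ (fun y hy w _ => by
        rw [LinearMap.mem_ker.1 (hYℓ hy), zero_smul]
        exact Submodule.zero_mem _) x w
      rw [Submodule.mem_bot, smul_eq_zero] at this
      exact this.resolve_right hw
    · refine hW1 ((Submodule.eq_top_iff').2 fun w => ?_)
      have := key (Polynomial.lcoeff ℂ 0) W' (fun y _ w hw => W'.smul_mem _ hw) 1 w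
      rwa [Polynomial.lcoeff_apply, Polynomial.coeff_one_zero, one_smul] at this

/-- The derivative in `t` on `ℂ[t] ⊗ W`. -/
def derivT (W : Type*) [AddCommGroup W] [Module ℂ W] : Module.End ℂ (ℂ[X] ⊗[ℂ] W) :=
  TensorProduct.map Polynomial.derivative LinearMap.id

theorem derivT_mem_degLT {r : ℕ} {z : ℂ[X] ⊗[ℂ] W} (hz : z ∈ degLT W (r + 1)) :
    derivT W z ∈ degLT W r ∧ ∀ s, r = s + 1 → coeffMap W s (derivT W z) = (r : ℂ) • coeffMap W r z := by
  unfold degLT at hz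
  induction hz using Submodule.span_induction with
  | zero => simp
  | add u v _ _ hu hv =>
    refine ⟨by rw [map_add]; exact Submodule.add_mem _ hu.1 hv.1, fun s hs => ?_⟩
    rw [map_add, map_add, hu.2 s hs, hv.2 s hs, map_add, smul_add]
  | smul c u _ hu =>
    refine ⟨by rw [map_smul]; exact Submodule.smul_mem _ _ hu.1, fun s hs => ?_⟩
    rw [map_smul, map_smul, hu.2 s hs, map_smul, smul_comm]
  | mem u h =>
    obtain ⟨j, hj, w, rfl⟩ := h
    rw [derivT, TensorProduct.map_tmul, LinearMap.id_apply, Polynomial.derivative_X_pow,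
      ← Polynomial.smul_eq_C_mul, ← TensorProduct.smul_tmul']
    constructor
    · rcases Nat.eq_zero_or_pos j with rfl | hj0
      · simp
      · exact Submodule.smul_mem _ _ (X_pow_tmul_mem_degLT (by omega) w)
    · rintro s rfl
      rw [map_smul, coeffMap_tmul, coeffMap_tmul, Polynomial.coeff_X_pow, Polynomial.coeff_X_pow]
      rcases eq_or_ne j (s + 1) with rfl | hjs
      · simp
      · rw [if_neg hjs.symm, zero_smul, smul_zero]
        rcases Nat.eq_zero_or_pos j with rfl | hj0
        · simp
        · rw [if_neg (by omega), zero_smul, smul_zero]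

/-- Differentiating r times leaves r! times the coefficient of t^r, and r! is invertible in ℂ. -/
theorem one_tmul_coeff_mem {Y : Submodule ℂ (ℂ[X] ⊗[ℂ] W)} (hY : ∀ y ∈ Y, derivT W y ∈ Y) (r : ℕ) :
    ∀ z ∈ Y, z ∈ degLT W (r + 1) → (1 : ℂ[X]) ⊗ₜ coeffMap W r z ∈ Y := by
  induction r with
  | zero =>
    intro z hz hr
    have := sub_coeff_mem_degLT hr
    rw [degLT_zero, Submodule.mem_bot, sub_eq_zero, pow_zero] at this
    rwa [← this]
  | succ r ih =>
    intro z hz hr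
    obtain ⟨h1, h2⟩ := derivT_mem_degLT hr
    have := ih _ (hY z hz) h1
    rw [h2 r rfl, TensorProduct.tmul_smul] at this
    exact (Y.smul_mem_iff (Nat.cast_ne_zero.2 (Nat.succ_ne_zero r))).1 this

/-- If `deg h = 1` and `W` is irreducible, then `ℂ[t] ⊗ W` has no proper invariant subspaces. -/
theorem polyTensor_irreducible {α : ℂ} {h : ℂ[X]} (hh : h.natDegree = 1) (hσ : HasCharge σ θ)
    (hW : ∀ W' : Submodule ℂ W, (∀ k, ∀ w ∈ W', σ (d k) w ∈ W') → W' ≠ ⊥ → W' = ⊤)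
    (Y : Submodule ℂ (ℂ[X] ⊗[ℂ] W)) (hF : ∀ y ∈ Y, tF α h W y ∈ Y) (hG : ∀ y ∈ Y, tG α h W y ∈ Y)
    (hρ : ∀ k, ∀ y ∈ Y, lTensorRep hσ (d k) y ∈ Y) (hY0 : Y ≠ ⊥) : Y = ⊤ := by
  obtain ⟨m, hm, hFm⟩ := exists_opF_of_natDegree_one (α := α) hh
  -- For deg h = 1 the divided difference is the constant slope m, so stability under F is stability
  -- under d/dt.
  have hd : derivT W = m • LinearMap.id - tF α h W := by
    refine TensorProduct.ext' fun f w => ?_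
    rw [derivT, TensorProduct.map_tmul, LinearMap.sub_apply, tF_tmul, hFm,
      TensorProduct.sub_tmul, ← TensorProduct.smul_tmul']
    simp
  have hD : ∀ y ∈ Y, derivT W y ∈ Y := by
    intro y hy
    rw [hd]
    exact Y.sub_mem (Y.smul_mem m hy) (hF y hy)
  have hW' := hW (Y.comap (TensorProduct.mk ℂ ℂ[X] W 1)) (fun k w hw => by
      have := hρ k _ hw
      rwa [lTensorRep_d] at this) (by
    obtain ⟨z, hz, hz0⟩ := Y.exists_mem_ne_zero_of_ne_bot hY0
    obtain ⟨r, hr, hr0⟩ := exists_leading_coeff hz0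
    exact (Submodule.ne_bot_iff _).2 ⟨_, one_tmul_coeff_mem hD r z hz hr, hr0⟩)
  have hpow : ∀ (w : W) (j : ℕ), (Polynomial.X ^ j : ℂ[X]) ⊗ₜ w ∈ Y := by
    intro w j
    induction j with
    | zero =>
      have : w ∈ Y.comap (TensorProduct.mk ℂ ℂ[X] W 1) := hW' ▸ Submodule.mem_top
      simpa using this
    | succ j ih =>
      -- G raises the degree in t by one with coefficient m ≠ 0, so powers of t are reached
      -- inductively from 1.
      have e : tG α h W ((Polynomial.X ^ j : ℂ[X]) ⊗ₜ w) = (h.eval α - j) • (Polynomial.X ^ j) ⊗ₜ w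
          + m • (Polynomial.X ^ (j + 1)) ⊗ₜ w := by
        have : opG α h (Polynomial.X ^ j) = (h.eval α - j) • (Polynomial.X ^ j : ℂ[X])
            + m • (Polynomial.X ^ (j + 1) : ℂ[X]) := by
          rw [opG_apply, hFm, Polynomial.derivative_X_pow]
          cases j with
          | zero =>
            simp [Polynomial.smul_eq_C_mul]
          | succ j =>
            simp only [Polynomial.smul_eq_C_mul, Nat.add_sub_cancel, map_sub]
            ring
        rw [tG_tmul, this, TensorProduct.add_tmul, TensorProduct.smul_tmul',
          TensorProduct.smul_tmul']
      have h1 := hG _ ih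
      rw [e] at h1
      exact (Y.smul_mem_iff hm).1 ((Y.add_mem_iff_right (Y.smul_mem _ ih)).1 h1)
  rw [eq_top_iff]
  rintro u -
  obtain ⟨r, hr⟩ := exists_mem_degLT u
  refine (Submodule.span_le.2 ?_ : degLT W r ≤ Y) hr
  rintro _ ⟨j, -, w, rfl⟩
  exact hpow w j

theorem opF_injective {α : ℂ} {h : ℂ[X]} (hh : h.natDegree = 1) : Function.Injective (opF α h) := by
  obtain ⟨m, hm, hFm⟩ := exists_opF_of_natDegree_one (α := α) hh
  rw [injective_iff_map_eq_zero]
  intro f hf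
  by_contra hf0
  rw [hFm, sub_eq_zero] at hf
  have h1 := Polynomial.degree_derivative_lt hf0
  rw [← hf, Polynomial.degree_smul_of_smul_regular f (IsSMulRegular.of_ne_zero hm)] at h1
  exact lt_irrefl _ h1

theorem tF_injective {α : ℂ} {h : ℂ[X]} (hh : h.natDegree = 1) : Function.Injective (tF α h W) :=
  Module.Flat.rTensor_preserves_injective_linearMap (M := W) (opF α h) (opF_injective hh)

end Target

/-! ### The polynomial module -/

section Unitriangular

/-- The geometric series in 1 - T is a finite sum on each vector and inverts T. -/
theorem bijective_of_locally_nilpotent {V : Type*} [AddCommGroup V] [Module ℂ V]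
    {T : Module.End ℂ V} (h : ∀ v, ∃ r : ℕ, ((1 - T) ^ r) v = 0) : Function.Bijective T := by
  constructor
  · rw [injective_iff_map_eq_zero]
    intro v hv
    obtain ⟨r, hr⟩ := h v
    have : ∀ r : ℕ, ((1 - T) ^ r) v = v := by
      intro r
      induction r with
      | zero => rfl
      | succ r ih =>
        rw [pow_succ, Module.End.mul_apply, LinearMap.sub_apply, hv, Module.End.one_apply, sub_zero,
          ih]
    rwa [this] at hr
  · intro v
    obtain ⟨r, hr⟩ := h v
    refine ⟨(∑ i ∈ Finset.range r, (1 - T) ^ i) v, ?_⟩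
    have := LinearMap.congr_fun (mul_neg_geom_sum (1 - T) r) v
    rwa [sub_sub_cancel, Module.End.mul_apply, LinearMap.sub_apply, hr, sub_zero] at this

variable {Z : Type*} [AddCommGroup Z] [Module ℂ Z]

/-- The map `f ⊗ z ↦ f(E) g(z)`. -/
def evalOp {V : Type*} [AddCommGroup V] [Module ℂ V] (E : Module.End ℂ V) (g : Z →ₗ[ℂ] V) :
    ℂ[X] ⊗[ℂ] Z →ₗ[ℂ] V :=
  TensorProduct.lift (LinearMap.mk₂ ℂ (fun f z => Polynomial.aeval E f (g z))
    (by intros; simp) (by intros; simp) (by intros; simp) (by intros; simp))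

theorem evalOp_tmul {V : Type*} [AddCommGroup V] [Module ℂ V] (E : Module.End ℂ V) (g : Z →ₗ[ℂ] V)
    (f : ℂ[X]) (z : Z) : evalOp E g (f ⊗ₜ z) = Polynomial.aeval E f (g z) := rfl

theorem evalOp_mulX {V : Type*} [AddCommGroup V] [Module ℂ V] (E : Module.End ℂ V) (g : Z →ₗ[ℂ] V)
    (u : ℂ[X] ⊗[ℂ] Z) : evalOp E g (TensorProduct.map mulX LinearMap.id u) = E (evalOp E g u) := by
  induction u using TensorProduct.induction_on with
  | zero => simp
  | add u v hu hv => simp only [map_add, hu, hv]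
  | tmul f z => simp [evalOp_tmul]

variable (α : ℂ) (F G : Module.End ℂ Z) (k : ℤ)

theorem degree_shift_X_pow (j : ℕ) : (shift k (Polynomial.X ^ j)).degree = j := by
  rw [shift_pow, Polynomial.degree_pow, Polynomial.degree_X_sub_C]
  simp

theorem polyOp_mem_degLT {r : ℕ} {u : ℂ[X] ⊗[ℂ] Z} (hu : u ∈ degLT Z r) :
    polyOp α F G k u ∈ degLT Z (r + 1) := by
  suffices degLT Z r ≤ (degLT Z (r + 1)).comap (polyOp α F G k) from this hu
  conv_lhs => rw [degLT]
  rw [Submodule.span_le]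
  rintro _ ⟨j, hj, z, rfl⟩
  rw [SetLike.mem_coe, Submodule.mem_comap, polyOp_tmul]
  refine Submodule.add_mem _ (tmul_mem_degLT ?_ _) (tmul_mem_degLT ?_ _)
  · rw [Polynomial.degree_mul, degree_shift_X_pow, Polynomial.degree_X, add_comm]
    exact_mod_cast Nat.succ_lt_succ hj
  · rw [degree_shift_X_pow]
    exact_mod_cast hj.trans (Nat.lt_succ_self r)

theorem polyOp_X_pow_sub_mem (j : ℕ) (z : Z) :
    polyOp α F G k ((Polynomial.X ^ j : ℂ[X]) ⊗ₜ z) - (Polynomial.X ^ (j + 1) : ℂ[X]) ⊗ₜ z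
      ∈ degLT Z (j + 1) := by
  rw [polyOp_tmul, pow_succ', add_sub_right_comm, ← TensorProduct.sub_tmul, ← mul_sub]
  refine Submodule.add_mem _ (tmul_mem_degLT ?_ _) (tmul_mem_degLT ?_ _)
  · have : (shift k (Polynomial.X ^ j) - Polynomial.X ^ j).degree
        < (shift k (Polynomial.X ^ j)).degree := by
      refine Polynomial.degree_sub_lt_left ?_ ?_ ?_
      · rw [degree_shift_X_pow, Polynomial.degree_X_pow]
      · rw [shift_pow]
        exact pow_ne_zero _ (Polynomial.X_sub_C_ne_zero _)
      · rw [shift_pow, ((Polynomial.monic_X_sub_C _).pow j).leadingCoeff,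
          (Polynomial.monic_X_pow j).leadingCoeff]
    rw [degree_shift_X_pow] at this
    rw [Polynomial.degree_mul, Polynomial.degree_X]
    calc _ < (1 : WithBot ℕ) + (j : WithBot ℕ) := WithBot.add_lt_add_left (by decide) this
      _ = _ := by push_cast; rw [add_comm]
  · rw [degree_shift_X_pow]
    exact_mod_cast Nat.lt_succ_self j

/-- The map `s ^ j ⊗ z ↦ E ^ j (1 ⊗ z)` for `E = polyOp α F G k`. -/
def unitri : Module.End ℂ (ℂ[X] ⊗[ℂ] Z) :=
  evalOp (polyOp α F G k) (TensorProduct.mk ℂ ℂ[X] Z 1)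

theorem unitri_X_pow_sub_mem (j : ℕ) (z : Z) :
    unitri α F G k ((Polynomial.X ^ j : ℂ[X]) ⊗ₜ z) - (Polynomial.X ^ j : ℂ[X]) ⊗ₜ z
      ∈ degLT Z j := by
  induction j with
  | zero => simp [unitri, evalOp_tmul]
  | succ j ih =>
    have e : unitri α F G k ((Polynomial.X ^ (j + 1) : ℂ[X]) ⊗ₜ z)
        = polyOp α F G k (unitri α F G k ((Polynomial.X ^ j : ℂ[X]) ⊗ₜ z)) := by
      rw [unitri, ← evalOp_mulX, TensorProduct.map_tmul, mulX_apply, ← pow_succ',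
        LinearMap.id_apply]
    have := Submodule.add_mem _ (polyOp_mem_degLT α F G k ih) (polyOp_X_pow_sub_mem α F G k j z)
    rwa [map_sub, sub_add_sub_cancel, ← e] at this

/-- The map is unitriangular for the degree in s. Thus ℂ[s] ⊗ Z is free over polynomials in `polyOp
α F G k`, generated by 1 ⊗ Z, and a map intertwining this operator with another may be prescribed
freely on 1 ⊗ Z. -/
theorem unitri_bijective : Function.Bijective (unitri α F G k) := by
  refine bijective_of_locally_nilpotent fun v => ?_
  obtain ⟨r, hr⟩ := exists_mem_degLT v
  refine ⟨r, ?_⟩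
  induction r generalizing v with
  | zero => rwa [degLT_zero, Submodule.mem_bot] at hr
  | succ r ih =>
    rw [pow_succ, Module.End.mul_apply]
    refine ih _ ?_
    suffices degLT Z (r + 1) ≤ (degLT Z r).comap (1 - unitri α F G k) from this hr
    conv_lhs => rw [degLT]
    rw [Submodule.span_le]
    rintro _ ⟨j, hj, z, rfl⟩
    rw [SetLike.mem_coe, Submodule.mem_comap, LinearMap.sub_apply, Module.End.one_apply,
      ← neg_mem_iff, neg_sub]
    exact degLT_mono (Nat.lt_succ_iff.1 hj) (unitri_X_pow_sub_mem α F G k j z)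

end Unitriangular

/-! ### The action of Vir on spaces of linear maps -/

section HomRep

variable {A B : Type*} [AddCommGroup A] [Module ℂ A] [AddCommGroup B] [Module ℂ B]
  {σ : Vir →ₗ⁅ℂ⁆ Module.End ℂ A} {ρ : Vir →ₗ⁅ℂ⁆ Module.End ℂ B} {θ : ℂ}

/-- The action of `d k` on linear maps. -/
def homOp (σ : Vir →ₗ⁅ℂ⁆ Module.End ℂ A) (ρ : Vir →ₗ⁅ℂ⁆ Module.End ℂ B) (k : ℤ) :
    Module.End ℂ (A →ₗ[ℂ] B) :=
  LinearMap.compRight ℂ (ρ (d k)) - LinearMap.lcomp ℂ B (σ (d k))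

theorem homOp_apply (k : ℤ) (g : A →ₗ[ℂ] B) (v : A) :
    homOp σ ρ k g v = ρ (d k) (g v) - g (σ (d k) v) := rfl

theorem isVirAction_homOp (hσ : HasCharge σ 0) (hρ : HasCharge ρ θ) :
    IsVirAction θ (homOp σ ρ) := by
  intro i j g
  rw [← cocyc]
  ext v
  have h1 := rep_d_comm hρ i j (g v)
  have h2 := rep_d_comm hσ i j v
  have h3 : cocyc 0 i j = 0 := by simp [cocyc]
  simp only [LinearMap.sub_apply, LinearMap.add_apply, LinearMap.smul_apply, homOp_apply, map_sub,
    h1, h2, map_add, map_smul, h3]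
  module

/-- The representation on linear maps from a representation of central charge zero. -/
def homRep (hσ : HasCharge σ 0) (hρ : HasCharge ρ θ) : Vir →ₗ⁅ℂ⁆ Module.End ℂ (A →ₗ[ℂ] B) :=
  virRep θ (homOp σ ρ) (isVirAction_homOp hσ hρ)

theorem homRep_d (hσ : HasCharge σ 0) (hρ : HasCharge ρ θ) (k : ℤ) (g : A →ₗ[ℂ] B) (v : A) :
    homRep hσ hρ (d k) g v = ρ (d k) (g v) - g (σ (d k) v) := by
  rw [homRep, virRep_d, homOp_apply]

theorem homRep_hasCharge (hσ : HasCharge σ 0) (hρ : HasCharge ρ θ) :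
    HasCharge (homRep hσ hρ) θ := by
  intro v
  rw [homRep, virRep_c]
  simp

end HomRep

/-! ### The module ℂ[s, t] and generation of the tensor product -/

section PhiRep

theorem hasCharge_zero (Z : Type*) [AddCommGroup Z] [Module ℂ Z] :
    HasCharge (0 : Vir →ₗ⁅ℂ⁆ Module.End ℂ Z) 0 := by
  intro v
  simp

/-- The polynomial module `ℂ[s, t]`. -/
def phiRep (lam : ℂˣ) (α : ℂ) (h : ℂ[X]) : Vir →ₗ⁅ℂ⁆ Module.End ℂ (ℂ[X] ⊗[ℂ] ℂ[X]) :=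
  tensRep lam α (hasCharge_zero ℂ[X]) (opG_opF α h) (by simp) (by simp)

theorem phiRep_hasCharge (lam : ℂˣ) (α : ℂ) (h : ℂ[X]) : HasCharge (phiRep lam α h) 0 := by
  intro v
  rw [phiRep, tensRep, virRep_c]
  simp

theorem phiRep_d (lam : ℂˣ) (α : ℂ) (h : ℂ[X]) (k : ℤ) (u : ℂ[X] ⊗[ℂ] ℂ[X]) :
    phiRep lam α h (d k) u = ((lam ^ k : ℂˣ) : ℂ) • polyOp α (opF α h) (opG α h) k u := by
  rw [phiRep, tensRep, virRep_d, tensOp_apply]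
  simp

/-- An invariant subspace of `ℂ[s] ⊗ ℂ[t] ⊗ W` which contains `1 ⊗ x ⊗ v` for all `x`, where `v`
generates the Whittaker module `W`, is everything. -/
theorem target_eq_top {n : ℤ} {a : ℤ → ℂ} (θ : ℂ) (hn : 1 ≤ n) (ha : ∀ k, 2 * n < k → a k = 0)
    (lam : ℂˣ) (α : ℂ) (h : ℂ[X]) {N : Submodule ℂ (ℂ[X] ⊗[ℂ] (ℂ[X] ⊗[ℂ] Whit n))}
    (hN : ∀ k, ∀ u ∈ N, targetRep lam α h (whitRep_hasCharge θ hn ha) (d k) u ∈ N)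
    (h1 : ∀ x : ℂ[X], (1 : ℂ[X]) ⊗ₜ (x ⊗ₜ vac n) ∈ N) : N = ⊤ := by
  set J : ℂ[X] ⊗[ℂ] ℂ[X] →ₗ[ℂ] ℂ[X] ⊗[ℂ] (ℂ[X] ⊗[ℂ] Whit n) :=
    (TensorProduct.map LinearMap.id ((TensorProduct.mk ℂ ℂ[X] (Whit n)).flip (vac n))) with hJ
  -- On Φ ⊗ v, with v the generator of W, `d n` acts as λ^n times `polyOp` plus the scalar a_n.
  -- Hence the part of Φ that J sends into `N` is stable under `polyOp` at n.
  have hJE : ∀ u, J (polyOp α (opF α h) (opG α h) n u) = ((lam ^ n)⁻¹ : ℂˣ) •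
      (targetRep lam α h (whitRep_hasCharge θ hn ha) (d n) (J u) - a n • J u) := by
    intro u
    induction u using TensorProduct.induction_on with
    | zero => simp
    | add u v hu hv =>
      simp only [map_add, hu, hv, ← smul_add]
      congr 1
      module
    | tmul f x =>
      have e : J (f ⊗ₜ x) = f ⊗ₜ (x ⊗ₜ vac n) := rfl
      have e2 : J (polyOp α (opF α h) (opG α h) n (f ⊗ₜ x)) = (Polynomial.X * shift n f) ⊗ₜ
          (x ⊗ₜ vac n) + shift n f ⊗ₜ (kOp α (opF α h) (opG α h) n x ⊗ₜ vac n) := rfl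
      rw [e, e2, targetRep_tmul, whitRep_vac θ hn ha le_rfl, TensorProduct.tmul_smul,
        TensorProduct.tmul_smul, add_sub_cancel_right, ← Units.smul_def, inv_smul_smul]
  have hJN : ∀ u, J (unitri α (opF α h) (opG α h) n u) ∈ N := by
    intro u
    obtain ⟨r, hr⟩ := exists_mem_degLT u
    suffices degLT ℂ[X] r ≤ N.comap (J.comp (unitri α (opF α h) (opG α h) n)) from this hr
    rw [degLT, Submodule.span_le]
    rintro _ ⟨j, -, z, rfl⟩
    rw [SetLike.mem_coe, Submodule.mem_comap, LinearMap.comp_apply]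
    clear hr
    induction j with
    | zero =>
      have : unitri α (opF α h) (opG α h) n ((Polynomial.X ^ 0 : ℂ[X]) ⊗ₜ z) = 1 ⊗ₜ z := by
        simp [unitri, evalOp_tmul]
      rw [this]
      exact h1 z
    | succ j ih =>
      have e : unitri α (opF α h) (opG α h) n ((Polynomial.X ^ (j + 1) : ℂ[X]) ⊗ₜ z)
          = polyOp α (opF α h) (opG α h) n
            (unitri α (opF α h) (opG α h) n ((Polynomial.X ^ j : ℂ[X]) ⊗ₜ z)) := by
        rw [unitri, ← evalOp_mulX, TensorProduct.map_tmul, mulX_apply, ← pow_succ',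
          LinearMap.id_apply]
      rw [e, hJE]
      exact N.smul_mem _ (N.sub_mem (hN _ _ ih) (N.smul_mem _ ih))
  -- The vectors w for which all f ⊗ x ⊗ w lie in `N` form a Vir-submodule of W; it remains to see
  -- that it contains the generator.
  set W' : Submodule ℂ (Whit n) := ⨅ (f : ℂ[X]) (x : ℂ[X]),
    N.comap ((TensorProduct.mk ℂ ℂ[X] (ℂ[X] ⊗[ℂ] Whit n) f).comp (TensorProduct.mk ℂ ℂ[X] (Whit n) x))
    with hW'
  have hmem : ∀ w, w ∈ W' ↔ ∀ f x : ℂ[X], f ⊗ₜ (x ⊗ₜ w) ∈ N := by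
    intro w
    simp [hW', Submodule.mem_iInf]
  have htop : W' = ⊤ := by
    refine eq_top_of_vac_mem θ hn ha (fun i w hw => ?_) ?_
    · rw [hmem] at hw ⊢
      intro f x
      have := hN i _ (hw f x)
      rw [targetRep_tmul] at this
      exact (N.add_mem_iff_right (N.smul_mem _ (N.add_mem (hw _ _) (hw _ _)))).1 this
    · rw [hmem]
      intro f x
      obtain ⟨u, hu⟩ := (unitri_bijective α (opF α h) (opG α h) n).2 (f ⊗ₜ x)
      have := hJN u
      rwa [hu] at this
  rw [eq_top_iff]
  rintro u -
  induction u using TensorProduct.induction_on with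
  | zero => exact N.zero_mem
  | add u v hu hv => exact N.add_mem hu hv
  | tmul f z =>
    induction z using TensorProduct.induction_on with
    | zero => rw [TensorProduct.tmul_zero]; exact N.zero_mem
    | add u v hu hv => rw [TensorProduct.tmul_add]; exact N.add_mem hu hv
    | tmul x w =>
      have hw : w ∈ W' := htop ▸ Submodule.mem_top
      exact (hmem w).1 hw f x

end PhiRep

/-! ### The induced module -/

section Induced

variable {n : ℕ} {θ : ℂ} {lam : ℂˣ} {α : ℂ} {h : ℂ[X]} {a : ℤ → ℂ}

/-- The universal enveloping algebra is generated by the Lie algebra. -/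
theorem enveloping_subalgebra_eq_top {L : Type*} [LieRing L] [LieAlgebra ℂ L]
    (S : Subalgebra ℂ (UniversalEnvelopingAlgebra ℂ L))
    (hS : ∀ x : L, UniversalEnvelopingAlgebra.ι ℂ x ∈ S) : S = ⊤ := by
  let f : L →ₗ⁅ℂ⁆ S :=
    { toFun := fun x => ⟨UniversalEnvelopingAlgebra.ι ℂ x, hS x⟩
      map_add' := fun x y => Subtype.ext (map_add _ x y)
      map_smul' := fun r x => Subtype.ext (map_smul _ r x)
      map_lie' := fun {x y} => Subtype.ext (by
        simp [LieRing.of_associative_ring_bracket]) }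
  -- By the universal property the identity factors through S, so every element of the enveloping
  -- algebra lies in S.
  have hid : S.val.comp (UniversalEnvelopingAlgebra.lift ℂ f)
      = AlgHom.id ℂ (UniversalEnvelopingAlgebra ℂ L) := by
    apply UniversalEnvelopingAlgebra.hom_ext
    ext x
    change ((UniversalEnvelopingAlgebra.lift ℂ f (UniversalEnvelopingAlgebra.ι ℂ x) : S) :
      UniversalEnvelopingAlgebra ℂ L) = UniversalEnvelopingAlgebra.ι ℂ x
    rw [UniversalEnvelopingAlgebra.lift_ι_apply]
    rfl
  rw [eq_top_iff]
  rintro u -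
  have hu : ((UniversalEnvelopingAlgebra.lift ℂ f u : S) : UniversalEnvelopingAlgebra ℂ L) = u :=
    DFunLike.congr_fun hid u
  exact hu ▸ (UniversalEnvelopingAlgebra.lift ℂ f u).2

/-- A submodule stable under the image of the Lie algebra is stable under the enveloping algebra. -/
theorem enveloping_smul_mem {V : Type*} [AddCommGroup V] [Module ℂ V]
    [Module (UniversalEnvelopingAlgebra ℂ Vir) V]
    [IsScalarTower ℂ (UniversalEnvelopingAlgebra ℂ Vir) V] {N : Submodule ℂ V}
    (hN : ∀ x : Vir, ∀ v ∈ N, UniversalEnvelopingAlgebra.ι ℂ x • v ∈ N)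
    (u : UniversalEnvelopingAlgebra ℂ Vir) {v : V} (hv : v ∈ N) : u • v ∈ N := by
  let S : Subalgebra ℂ (UniversalEnvelopingAlgebra ℂ Vir) :=
    { carrier := {u | ∀ v ∈ N, u • v ∈ N}
      mul_mem' := fun {a b} ha hb v hv => by
        rw [mul_smul]
        exact ha _ (hb v hv)
      add_mem' := fun {a b} ha hb v hv => by
        rw [add_smul]
        exact N.add_mem (ha v hv) (hb v hv)
      algebraMap_mem' := fun r v hv => by
        rw [algebraMap_smul]
        exact N.smul_mem r hv }
  have hu : u ∈ S := enveloping_subalgebra_eq_top S hN ▸ Algebra.mem_top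
  exact hu v hv

variable (n θ lam α h a) in
/-- The representation of `Vir` on the induced module. -/
def indRep : Vir →ₗ⁅ℂ⁆ Module.End ℂ (IndMod n θ lam α h a) :=
  LieModule.toEnd ℂ Vir (IndMod n θ lam α h a)

theorem indRep_apply (x : Vir) (v : IndMod n θ lam α h a) :
    indRep n θ lam α h a x v = UniversalEnvelopingAlgebra.ι ℂ x • v := rfl

variable (n θ lam α h a) in
/-- The projection from `U(Vir) ⊗ ℂ[t]` to the induced module. -/
def indProj : (UniversalEnvelopingAlgebra ℂ Vir ⊗[ℂ] ℂ[X])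
    →ₗ[UniversalEnvelopingAlgebra ℂ Vir] IndMod n θ lam α h a :=
  (Submodule.mkQ (centralSub θ (InducedModule (bAlg n lam) (bRep n lam α h a)))).comp
    (Submodule.mkQ (inducedRel (bAlg n lam) (bRep n lam α h a)))

theorem indProj_surjective : Function.Surjective (indProj n θ lam α h a) :=
  (Submodule.mkQ_surjective _).comp (Submodule.mkQ_surjective _)

theorem indRep_hasCharge : HasCharge (indRep n θ lam α h a) θ := by
  intro v
  obtain ⟨z, rfl⟩ : ∃ z, Submodule.mkQ (centralSub θ
    (InducedModule (bAlg n lam) (bRep n lam α h a))) z = v := Submodule.mkQ_surjective _ v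
  have h1 : Submodule.mkQ (centralSub θ (InducedModule (bAlg n lam) (bRep n lam α h a)))
      ((UniversalEnvelopingAlgebra.ι ℂ c
        - algebraMap ℂ (UniversalEnvelopingAlgebra ℂ Vir) θ) • z) = 0 := by
    rw [Submodule.mkQ_apply, Submodule.Quotient.mk_eq_zero]
    exact Submodule.subset_span ⟨z, rfl⟩
  rw [map_smul, sub_smul, sub_eq_zero, algebraMap_smul] at h1
  exact h1

variable (n θ lam α h a) in
/-- The map from `ℂ[t]` to the induced module. -/
def indGen : ℂ[X] →ₗ[ℂ] IndMod n θ lam α h a where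
  toFun x := indProj n θ lam α h a (1 ⊗ₜ x)
  map_add' x y := by rw [TensorProduct.tmul_add, map_add]
  map_smul' r x := by
    rw [TensorProduct.tmul_smul, ← algebraMap_smul (UniversalEnvelopingAlgebra ℂ Vir) r, map_smul,
      algebraMap_smul]
    rfl

theorem indProj_tmul (u : UniversalEnvelopingAlgebra ℂ Vir) (x : ℂ[X]) :
    indProj n θ lam α h a (u ⊗ₜ x) = u • indGen n θ lam α h a x := by
  have : u ⊗ₜ[ℂ] x = u • ((1 : UniversalEnvelopingAlgebra ℂ Vir) ⊗ₜ[ℂ] x) := by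
    rw [TensorProduct.smul_tmul', smul_eq_mul, mul_one]
  rw [this, map_smul]
  rfl

theorem indRep_indGen (k : ℤ) (hk : n + 1 ≤ k) (x : ℂ[X]) :
    indRep n θ lam α h a (bGen n lam k) (indGen n θ lam α h a x)
      = indGen n θ lam α h a (bOp n lam α h a k x) := by
  rw [indRep_apply, ← indProj_tmul]
  set y : bAlg n lam := ⟨bGen n lam k, bGen_mem n lam k hk⟩ with hy
  have h1 : (1 * envelopingIncl (bAlg n lam) (UniversalEnvelopingAlgebra.ι ℂ y)) ⊗ₜ[ℂ] x
      - 1 ⊗ₜ[ℂ] (UniversalEnvelopingAlgebra.lift ℂ (bRep n lam α h a)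
        (UniversalEnvelopingAlgebra.ι ℂ y) x) ∈ inducedRel (bAlg n lam) (bRep n lam α h a) :=
    Submodule.subset_span ⟨1, UniversalEnvelopingAlgebra.ι ℂ y, x, rfl⟩
  have h2 : envelopingIncl (bAlg n lam) (UniversalEnvelopingAlgebra.ι ℂ y)
      = UniversalEnvelopingAlgebra.ι ℂ (bGen n lam k) := by
    rw [envelopingIncl, UniversalEnvelopingAlgebra.lift_ι_apply]
    rfl
  have h3 : bRep n lam α h a y x = bOp n lam α h a k x :=
    (bRep_bGen n lam α h a k hk x).trans rfl
  rw [one_mul, h2, UniversalEnvelopingAlgebra.lift_ι_apply, h3] at h1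
  have h4 := (Submodule.Quotient.mk_eq_zero _).2 h1
  have h5 : indProj n θ lam α h a (UniversalEnvelopingAlgebra.ι ℂ (bGen n lam k) ⊗ₜ[ℂ] x
      - 1 ⊗ₜ[ℂ] (bOp n lam α h a k x)) = 0 :=
    (congrArg (Submodule.mkQ (centralSub θ (InducedModule (bAlg n lam) (bRep n lam α h a))))
      h4).trans (map_zero _)
  rw [map_sub, sub_eq_zero] at h5
  exact h5

/-- A subspace of a representation with a central charge invariant under all `d k` is invariant. -/
theorem rep_mem_of_d {V : Type*} [AddCommGroup V] [Module ℂ V] {ρ : Vir →ₗ⁅ℂ⁆ Module.End ℂ V}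
    (hρ : HasCharge ρ θ) {N : Submodule ℂ V} (hN : ∀ k, ∀ v ∈ N, ρ (d k) v ∈ N) (x : Vir) :
    ∀ v ∈ N, ρ x v ∈ N := by
  intro v hv
  induction x using induction_basis with
  | hadd x y hx hy => rw [map_add]; exact N.add_mem hx hy
  | hsmul r x hx => rw [map_smul]; exact N.smul_mem r hx
  | hd i => exact hN i v hv
  | hc => rw [hρ]; exact N.smul_mem θ hv

theorem ind_eq_top {N : Submodule ℂ (IndMod n θ lam α h a)}
    (hN : ∀ k, ∀ v ∈ N, indRep n θ lam α h a (d k) v ∈ N)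
    (h1 : ∀ x, indGen n θ lam α h a x ∈ N) : N = ⊤ := by
  rw [eq_top_iff]
  rintro v -
  obtain ⟨z, rfl⟩ := indProj_surjective v
  induction z using TensorProduct.induction_on with
  | zero => rw [map_zero]; exact N.zero_mem
  | add u v hu hv => rw [map_add]; exact N.add_mem hu hv
  | tmul u x =>
    rw [indProj_tmul]
    exact enveloping_smul_mem (rep_mem_of_d indRep_hasCharge hN) u (h1 x)

/-! ### The universal property of the induced module -/

section Lift

variable {V : Type*} [AddCommGroup V] [Module ℂ V]

/-- The space of a representation, as a module over the enveloping algebra. -/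
def EnvMod (_ρ : Vir →ₗ⁅ℂ⁆ Module.End ℂ V) : Type _ := V

variable (ρ : Vir →ₗ⁅ℂ⁆ Module.End ℂ V)

instance : AddCommGroup (EnvMod ρ) := inferInstanceAs (AddCommGroup V)

instance : Module ℂ (EnvMod ρ) := inferInstanceAs (Module ℂ V)

instance : Module (UniversalEnvelopingAlgebra ℂ Vir) (EnvMod ρ) :=
  letI : Module (Module.End ℂ V) (EnvMod ρ) := inferInstanceAs (Module (Module.End ℂ V) V)
  Module.compHom (EnvMod ρ) (UniversalEnvelopingAlgebra.lift ℂ ρ).toRingHom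

theorem envMod_smul (u : UniversalEnvelopingAlgebra ℂ Vir) (v : EnvMod ρ) :
    u • v = (UniversalEnvelopingAlgebra.lift ℂ ρ u : Module.End ℂ V) v := rfl

theorem envMod_ι_smul (x : Vir) (v : EnvMod ρ) :
    UniversalEnvelopingAlgebra.ι ℂ x • v = (ρ x : Module.End ℂ V) v := by
  rw [envMod_smul, UniversalEnvelopingAlgebra.lift_ι_apply]

instance : IsScalarTower ℂ (UniversalEnvelopingAlgebra ℂ Vir) (EnvMod ρ) where
  smul_assoc r u v := by
    rw [envMod_smul, envMod_smul, map_smul]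
    rfl

/-- The map `u ⊗ x ↦ u f(x)`. -/
def envLift (f : ℂ[X] →ₗ[ℂ] V) : (UniversalEnvelopingAlgebra ℂ Vir ⊗[ℂ] ℂ[X])
    →ₗ[UniversalEnvelopingAlgebra ℂ Vir] EnvMod ρ :=
  TensorProduct.AlgebraTensorModule.lift
    { toFun := fun u =>
        ((UniversalEnvelopingAlgebra.lift ℂ ρ u : Module.End ℂ V).comp f : ℂ[X] →ₗ[ℂ] V)
      map_add' := fun u u' => LinearMap.ext fun x => by
        rw [map_add]
        rfl
      map_smul' := fun u u' => LinearMap.ext fun x => by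
        rw [smul_eq_mul, map_mul]
        rfl }

theorem envLift_tmul (f : ℂ[X] →ₗ[ℂ] V) (u : UniversalEnvelopingAlgebra ℂ Vir) (x : ℂ[X]) :
    envLift ρ f (u ⊗ₜ x) = (UniversalEnvelopingAlgebra.lift ℂ ρ u : Module.End ℂ V) (f x) := rfl

variable {ρ}

theorem rep_eq_of_bGen {f : ℂ[X] →ₗ[ℂ] V}
    (hf : ∀ k, (n + 1 : ℤ) ≤ k → ∀ x, ρ (bGen n lam k) (f x) = f (bOp n lam α h a k x))
    (y : bAlg n lam) (x : ℂ[X]) : ρ y (f x) = f (bRep n lam α h a y x) := by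
  obtain ⟨y, hy⟩ := y
  change ρ y (f x) = f (bActLin n lam α h a y x)
  change y ∈ Submodule.span ℂ _ at hy
  induction hy using Submodule.span_induction with
  | mem y hy =>
    obtain ⟨k, hk, rfl⟩ := hy
    rw [bActLin_bGen]
    exact hf k hk x
  | zero => simp
  | add y z _ _ hy hz => simp only [map_add, LinearMap.add_apply, hy, hz]
  | smul r y _ hy => simp only [map_smul, LinearMap.smul_apply, hy]

theorem envLift_envelopingIncl {f : ℂ[X] →ₗ[ℂ] V}
    (hf : ∀ k, (n + 1 : ℤ) ≤ k → ∀ x, ρ (bGen n lam k) (f x) = f (bOp n lam α h a k x))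
    (y : UniversalEnvelopingAlgebra ℂ (bAlg n lam)) (x : ℂ[X]) :
    UniversalEnvelopingAlgebra.lift ℂ ρ (envelopingIncl (bAlg n lam) y) (f x)
      = f (UniversalEnvelopingAlgebra.lift ℂ (bRep n lam α h a) y x) := by
  let S : Subalgebra ℂ (UniversalEnvelopingAlgebra ℂ (bAlg n lam)) :=
    { carrier := {y | ∀ x, UniversalEnvelopingAlgebra.lift ℂ ρ (envelopingIncl (bAlg n lam) y) (f x)
        = f (UniversalEnvelopingAlgebra.lift ℂ (bRep n lam α h a) y x)}
      mul_mem' := fun {y z} hy hz x => by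
        rw [map_mul, map_mul, map_mul, Module.End.mul_apply, Module.End.mul_apply, hz, hy]
      add_mem' := fun {y z} hy hz x => by
        rw [map_add, map_add, map_add, LinearMap.add_apply, LinearMap.add_apply, hz, hy, map_add]
      algebraMap_mem' := fun r x => by
        rw [AlgHom.commutes, AlgHom.commutes, AlgHom.commutes, Module.algebraMap_end_apply,
          Module.algebraMap_end_apply, map_smul] }
  have hS : S = ⊤ := enveloping_subalgebra_eq_top S fun y x => by
    rw [envelopingIncl, UniversalEnvelopingAlgebra.lift_ι_apply,
      UniversalEnvelopingAlgebra.lift_ι_apply, LieHom.comp_apply,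
      UniversalEnvelopingAlgebra.lift_ι_apply]
    exact rep_eq_of_bGen hf y x
  have hy : y ∈ S := hS ▸ Algebra.mem_top
  exact hy x

/-- The universal property of the induced module. -/
theorem exists_indLift (hρ : HasCharge ρ θ) {f : ℂ[X] →ₗ[ℂ] V}
    (hf : ∀ k, (n + 1 : ℤ) ≤ k → ∀ x, ρ (bGen n lam k) (f x) = f (bOp n lam α h a k x)) :
    ∃ π : IndMod n θ lam α h a →ₗ[ℂ] V, (∀ x, π (indGen n θ lam α h a x) = f x) ∧
      ∀ k v, π (indRep n θ lam α h a (d k) v) = ρ (d k) (π v) := by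
  have h1 : inducedRel (bAlg n lam) (bRep n lam α h a) ≤ LinearMap.ker (envLift ρ f) := by
    rw [inducedRel, Submodule.span_le]
    rintro _ ⟨u, y, x, rfl⟩
    rw [SetLike.mem_coe, LinearMap.mem_ker, map_sub, sub_eq_zero, envLift_tmul, envLift_tmul,
      map_mul, Module.End.mul_apply, envLift_envelopingIncl hf]
  set p := (inducedRel (bAlg n lam) (bRep n lam α h a)).liftQ (envLift ρ f) h1 with hp
  have h2 : centralSub θ (InducedModule (bAlg n lam) (bRep n lam α h a)) ≤ LinearMap.ker p := by
    rw [centralSub, Submodule.span_le]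
    rintro _ ⟨z, rfl⟩
    rw [SetLike.mem_coe, LinearMap.mem_ker, map_smul, sub_smul, algebraMap_smul]
    refine sub_eq_zero.2 ?_
    rw [envMod_ι_smul]
    exact hρ _
  set q : IndMod n θ lam α h a →ₗ[UniversalEnvelopingAlgebra ℂ Vir] EnvMod ρ :=
    (centralSub θ (InducedModule (bAlg n lam) (bRep n lam α h a))).liftQ p h2 with hq
  refine ⟨{ toFun := fun v => q v, map_add' := fun u v => map_add q u v, map_smul' := ?_ }, ?_, ?_⟩
  · intro r v
    have := map_smul q (algebraMap ℂ _ r) v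
    rw [algebraMap_smul, algebraMap_smul] at this
    exact this
  · intro x
    have : q (indGen n θ lam α h a x) = envLift ρ f (1 ⊗ₜ x) := rfl
    change q (indGen n θ lam α h a x) = f x
    rw [this, envLift_tmul, map_one, Module.End.one_apply]
  · intro k v
    change q (UniversalEnvelopingAlgebra.ι ℂ (d k) • v) = (ρ (d k) : Module.End ℂ V) (q v)
    rw [map_smul, envMod_ι_smul]

end Lift

end Induced

/-! ### The induced module as a tensor product -/

section Iso

variable {n : ℕ} {θ : ℂ} {lam : ℂˣ} {α : ℂ} {h : ℂ[X]} {a : ℤ → ℂ}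

theorem aExt_eq_zero (n : ℕ) (a : ℤ → ℂ) (k : ℤ) (hk : 2 * (n : ℤ) < k) : aExt n a k = 0 :=
  if_neg (by omega)

theorem unitri_X_pow_succ {Z : Type*} [AddCommGroup Z] [Module ℂ Z] (α : ℂ) (F G : Module.End ℂ Z)
    (k : ℤ) (j : ℕ) (z : Z) : unitri α F G k ((Polynomial.X ^ (j + 1) : ℂ[X]) ⊗ₜ z)
      = polyOp α F G k (unitri α F G k ((Polynomial.X ^ j : ℂ[X]) ⊗ₜ z)) := by
  rw [unitri, ← evalOp_mulX, TensorProduct.map_tmul, mulX_apply, ← pow_succ', LinearMap.id_apply]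

theorem unitri_one_tmul {Z : Type*} [AddCommGroup Z] [Module ℂ Z] (α : ℂ) (F G : Module.End ℂ Z)
    (k : ℤ) (z : Z) : unitri α F G k ((1 : ℂ[X]) ⊗ₜ z) = (1 : ℂ[X]) ⊗ₜ z := by
  simp [unitri, evalOp_tmul]

/-- Every element is a combination of the vectors `E ^ j (1 ⊗ z)`. -/
theorem unitri_induction {Z : Type*} [AddCommGroup Z] [Module ℂ Z] (α : ℂ) (F G : Module.End ℂ Z)
    (k : ℤ) {N : Submodule ℂ (ℂ[X] ⊗[ℂ] Z)}
    (hN : ∀ (j : ℕ) (z : Z), unitri α F G k ((Polynomial.X ^ j : ℂ[X]) ⊗ₜ z) ∈ N) (u) : u ∈ N := by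
  obtain ⟨u, rfl⟩ := (unitri_bijective α F G k).2 u
  obtain ⟨r, hr⟩ := exists_mem_degLT u
  suffices degLT Z r ≤ N.comap (unitri α F G k) from this hr
  rw [degLT, Submodule.span_le]
  rintro _ ⟨j, -, z, rfl⟩
  exact hN j z

section

variable {V : Type*} [AddCommGroup V] [Module ℂ V] {ρ : Vir →ₗ⁅ℂ⁆ Module.End ℂ V}

theorem rep_bGen (ρ : Vir →ₗ⁅ℂ⁆ Module.End ℂ V) (n : ℕ) (lam : ℂˣ) (k : ℤ) (v : V) :
    ρ (bGen n lam k) v = ρ (d k) v - ((lam ^ (k - n) : ℂˣ) : ℂ) • ρ (d n) v := by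
  rw [bGen, map_sub, map_smul]
  rfl

/-- The polynomial module, twisted by `a`, is induced from `ℂ[t]`. -/
theorem exists_phiLift (hn : 1 ≤ n) (hρ : HasCharge ρ θ) {f : ℂ[X] →ₗ[ℂ] V}
    (hf : ∀ k, (n + 1 : ℤ) ≤ k → ∀ x, ρ (bGen n lam k) (f x) = f (bOp n lam α h a k x)) :
    ∃ κ : ℂ[X] ⊗[ℂ] ℂ[X] →ₗ[ℂ] V, (∀ x, κ (1 ⊗ₜ x) = f x) ∧
      ∀ k, (n : ℤ) ≤ k → ∀ u, ρ (d k) (κ u) - κ (phiRep lam α h (d k) u) = aExt n a k • κ u := by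
  set l : ℂ := ((lam ^ (n : ℤ) : ℂˣ) : ℂ) with hl
  have hl0 : l ≠ 0 := Units.ne_zero _
  -- On Φ the element `d n` acts by λ^n times `polyOp`, and the twist adds a_n. So E is the only
  -- operator on V to which `polyOp` can correspond, and κ must send its powers on 1 ⊗ x to powers
  -- of E on f(x).
  set E : Module.End ℂ V := l⁻¹ • (ρ (d n) - aExt n a n • LinearMap.id) with hE
  have hEapp : ∀ v, ρ (d n) v = l • E v + aExt n a n • v := by
    intro v
    simp [hE, smul_smul, hl0]
  set P := polyOp α (opF α h) (opG α h) n with hP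
  set U := LinearEquiv.ofBijective _ (unitri_bijective α (opF α h) (opG α h) n) with hU
  set κ : ℂ[X] ⊗[ℂ] ℂ[X] →ₗ[ℂ] V := (evalOp E f).comp U.symm.toLinearMap with hκ
  have hκU : ∀ u, κ (unitri α (opF α h) (opG α h) n u) = evalOp E f u := by
    intro u
    have : U.symm (unitri α (opF α h) (opG α h) n u) = u := U.symm_apply_apply u
    rw [hκ, LinearMap.comp_apply, LinearEquiv.coe_coe, this]
  have hκP : ∀ u, κ (P u) = E (κ u) := by
    intro u
    obtain ⟨u, rfl⟩ := (unitri_bijective α (opF α h) (opG α h) n).2 u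
    rw [hκU, ← evalOp_mulX, ← hκU, unitri, evalOp_mulX]
  have hκ1 : ∀ x, κ (1 ⊗ₜ x) = f x := by
    intro x
    rw [← unitri_one_tmul α (opF α h) (opG α h) n x, hκU, evalOp_tmul, map_one,
      Module.End.one_apply]
  have hphi : ∀ u, phiRep lam α h (d n) u = l • P u := fun u => phiRep_d lam α h n u
  refine ⟨κ, hκ1, fun k hk u => ?_⟩
  rcases eq_or_lt_of_le hk with rfl | hk
  · rw [hphi, map_smul, hκP, hEapp, add_sub_cancel_left]
  suffices h' : ∀ (j : ℕ) (x : ℂ[X]) (k : ℤ), n < k →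
      ρ (d k) (κ (unitri α (opF α h) (opG α h) n ((Polynomial.X ^ j : ℂ[X]) ⊗ₜ x)))
        = κ (phiRep lam α h (d k)
            (unitri α (opF α h) (opG α h) n ((Polynomial.X ^ j : ℂ[X]) ⊗ₜ x)))
          + aExt n a k • κ (unitri α (opF α h) (opG α h) n ((Polynomial.X ^ j : ℂ[X]) ⊗ₜ x)) by
    have := unitri_induction α (opF α h) (opG α h) n
      (N := LinearMap.eqLocus ((ρ (d k)).comp κ)
        (κ.comp (phiRep lam α h (d k)) + aExt n a k • κ)) (fun j x => h' j x k hk) u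
    rw [sub_eq_iff_eq_add']
    exact this
  intro j x
  induction j with
  | zero =>
    intro k hk
    rw [pow_zero, unitri_one_tmul, hκ1]
    -- Write d_k as (d_k - λ^(k-n) d_n) + λ^(k-n) d_n. The s-terms agree, and the rest is the
    -- identity (k G - k² α F) - (n G - n² α F) = (k - n)(G - (k + n) α F).
    have h1 := hf k (by omega) x
    rw [rep_bGen, sub_eq_iff_eq_add] at h1
    have h2 : l • E (f x) = κ (phiRep lam α h (d n) (1 ⊗ₜ x)) := by
      rw [hphi, map_smul, hκP, hκ1]
    have h3 : ∀ k, κ (phiRep lam α h (d k) (1 ⊗ₜ x)) = ((lam ^ k : ℂˣ) : ℂ) •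
        (κ (Polynomial.X ⊗ₜ x) + f (kOp α (opF α h) (opG α h) k x)) := by
      intro k
      rw [phiRep_d, polyOp_tmul, shift_one, mul_one, map_smul, map_add, hκ1]
    have hlam : lam ^ k = lam ^ (k - n) * lam ^ (n : ℤ) := by
      rw [← zpow_add, sub_add_cancel]
    have h4 : f (bOp n lam α h a k x) = (((k : ℂ) - n) * ((lam ^ k : ℂˣ) : ℂ)) •
        (f (opG α h x) - (((k : ℂ) + n) * α) • f (opF α h x))
        + (aExt n a k - ((lam ^ (k - n) : ℂˣ) : ℂ) * aExt n a n) • f x := by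
      simp [bOp]
    rw [h1, hEapp, h2, h3, h3, h4]
    simp only [kOp_apply, map_sub, map_smul, hlam, Units.val_mul, Int.cast_natCast]
    module
  | succ j ih =>
    intro k hk
    rw [unitri_X_pow_succ]
    set w := unitri α (opF α h) (opG α h) n ((Polynomial.X ^ j : ℂ[X]) ⊗ₜ x) with hw
    change ρ (d k) (κ (P w)) = κ (phiRep lam α h (d k) (P w)) + aExt n a k • κ (P w)
    -- Commuting `d k` with `d n` brings in `d (k + n)`, for which the twist vanishes since k + n >
    -- 2n; the induction hypothesis is needed for k and for k + n.
    have h1 := rep_d_comm hρ k n (κ w)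
    have h2 := congrArg κ (rep_d_comm (phiRep_hasCharge lam α h) k n w)
    have c1 : ∀ t, cocyc t k n = 0 := fun t => if_neg (by omega)
    rw [ih (k + n) (by omega), aExt_eq_zero n a (k + n) (by omega), c1] at h1
    rw [hphi, hphi, c1] at h2
    simp only [map_add, map_smul, hκP] at h2
    rw [ih k hk] at h1
    simp only [hEapp, map_add, map_smul, ih k hk] at h1
    rw [hκP]
    have h3 : l • ρ (d k) (E (κ w)) = l • (κ (phiRep lam α h (d k) (P w))
        + aExt n a k • E (κ w)) := by
      linear_combination (norm := module) h1 - h2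
    exact smul_right_injective _ hl0 h3

end

variable (n θ lam α h a) in
/-- The representation on the tensor product of the polynomial module and the Whittaker module. -/
def modelRep (hn : 1 ≤ n) : Vir →ₗ⁅ℂ⁆ Module.End ℂ (ℂ[X] ⊗[ℂ] (ℂ[X] ⊗[ℂ] Whit n)) :=
  targetRep lam α h (whitRep_hasCharge θ (by exact_mod_cast hn) (aExt_eq_zero n a))

variable (n) in
/-- The map `x ↦ 1 ⊗ x ⊗ v`. -/
def modelGen : ℂ[X] →ₗ[ℂ] ℂ[X] ⊗[ℂ] (ℂ[X] ⊗[ℂ] Whit n) :=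
  (TensorProduct.mk ℂ ℂ[X] (ℂ[X] ⊗[ℂ] Whit n) 1).comp
    ((TensorProduct.mk ℂ ℂ[X] (Whit n)).flip (vac n))

theorem modelGen_apply (x : ℂ[X]) : modelGen n x = 1 ⊗ₜ (x ⊗ₜ vac n) := rfl

/-- The term s ⊗ x ⊗ v enters `d k` with coefficient λ^k and cancels in d_k - λ^(k-n) d_n; the
generator v supplies the scalars a. -/
theorem modelRep_modelGen (hn : 1 ≤ n) (k : ℤ) (hk : (n + 1 : ℤ) ≤ k) (x : ℂ[X]) :
    modelRep n θ lam α h a hn (bGen n lam k) (modelGen n x)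
      = modelGen n (bOp n lam α h a k x) := by
  have hd : ∀ k : ℤ, n ≤ k → modelRep n θ lam α h a hn (d k) (modelGen n x)
      = ((lam ^ k : ℂˣ) : ℂ) • (Polynomial.X ⊗ₜ (x ⊗ₜ vac n)
        + modelGen n (kOp α (opF α h) (opG α h) k x)) + aExt n a k • modelGen n x := by
    intro k hk
    rw [modelRep, modelGen_apply, targetRep_tmul, whitRep_vac _ _ _ hk, shift_one, mul_one,
      TensorProduct.tmul_smul, TensorProduct.tmul_smul, modelGen_apply]
  have hlam : lam ^ k = lam ^ (k - n) * lam ^ (n : ℤ) := by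
    rw [← zpow_add, sub_add_cancel]
  rw [rep_bGen, hd k (by omega), hd n le_rfl]
  simp only [bOp, kOp_apply, map_sub, map_smul, map_add, hlam, Units.val_mul, LinearMap.add_apply,
    LinearMap.smul_apply, LinearMap.sub_apply, Module.End.one_apply, Int.cast_natCast]
  module

/-- The induced module is the tensor product of the polynomial and the Whittaker module. -/
theorem exists_ind_equiv (hn : 1 ≤ n) :
    ∃ e : IndMod n θ lam α h a ≃ₗ[ℂ] ℂ[X] ⊗[ℂ] (ℂ[X] ⊗[ℂ] Whit n),
      ∀ k v, e (indRep n θ lam α h a (d k) v) = modelRep n θ lam α h a hn (d k) (e v) := by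
  have hn' : (1 : ℤ) ≤ n := by exact_mod_cast hn
  obtain ⟨π, hπ1, hπ⟩ := exists_indLift (n := n) (α := α) (h := h) (a := a)
    (targetRep_hasCharge lam α h (whitRep_hasCharge θ hn' (aExt_eq_zero n a)))
    (modelRep_modelGen hn)
  obtain ⟨κ, hκ1, hκ⟩ := exists_phiLift hn indRep_hasCharge
    (indRep_indGen (n := n) (θ := θ) (lam := lam) (α := α) (h := h) (a := a))
  set η := homRep (phiRep_hasCharge lam α h) (indRep_hasCharge (n := n) (θ := θ) (lam := lam)
    (α := α) (h := h) (a := a)) with hη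
  -- So κ is a Whittaker vector in Hom(Φ, Ind), of charge θ because Φ has charge 0. The universal
  -- property of W extends it to W → Hom(Φ, Ind), that is, to a Vir-map Φ ⊗ W → Ind.
  have hηκ : ∀ k, (n : ℤ) ≤ k → η (d k) κ = aExt n a k • κ := fun k hk =>
    LinearMap.ext fun u => by
      rw [hη, homRep_d, hκ k hk]
      rfl
  set K : Whit n →ₗ[ℂ] (ℂ[X] ⊗[ℂ] ℂ[X] →ₗ[ℂ] IndMod n θ lam α h a) := whitLift η κ with hK
  have hKd : ∀ k w, K (whitRep θ hn' (aExt_eq_zero n a) (d k) w) = η (d k) (K w) := fun k w =>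
    whitLift_rep θ hn' (aExt_eq_zero n a) (homRep_hasCharge _ _) hηκ k w
  set κ' : ℂ[X] ⊗[ℂ] (ℂ[X] ⊗[ℂ] Whit n) →ₗ[ℂ] IndMod n θ lam α h a :=
    (TensorProduct.lift K.flip).comp (TensorProduct.assoc ℂ ℂ[X] ℂ[X] (Whit n)).symm.toLinearMap
    with hκ'
  have hκ'app : ∀ (f x : ℂ[X]) (w : Whit n), κ' (f ⊗ₜ (x ⊗ₜ w)) = K w (f ⊗ₜ x) :=
    fun f x w => rfl
  have hκ'd : ∀ k u, κ' (modelRep n θ lam α h a hn (d k) u)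
      = indRep n θ lam α h a (d k) (κ' u) := by
    intro k u
    induction u using TensorProduct.induction_on with
    | zero => simp
    | add u v hu hv => simp only [map_add, hu, hv]
    | tmul f z =>
      induction z using TensorProduct.induction_on with
      | zero => simp
      | add u v hu hv => simp only [TensorProduct.tmul_add, map_add, hu, hv]
      | tmul x w =>
        have h1 : η (d k) (K w) (f ⊗ₜ x) = indRep n θ lam α h a (d k) (K w (f ⊗ₜ x))
            - K w (phiRep lam α h (d k) (f ⊗ₜ x)) := homRep_d _ _ k (K w) _
        rw [modelRep, targetRep_tmul, map_add, map_smul, map_add, hκ'app, hκ'app, hκ'app, hκ'app,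
          hKd, h1, phiRep_d, polyOp_tmul, map_smul, map_add]
        abel
  have hκ'1 : ∀ x, κ' (modelGen n x) = indGen n θ lam α h a x := by
    intro x
    rw [modelGen_apply, hκ'app, hK, whitLift_vac, hκ1]
  have hleft : ∀ v, κ' (π v) = v := by
    have : LinearMap.eqLocus (κ'.comp π) LinearMap.id = ⊤ := by
      refine ind_eq_top (fun k v hv => ?_) fun x => ?_
      · change κ' (π v) = v at hv
        change κ' (π (indRep n θ lam α h a (d k) v)) = indRep n θ lam α h a (d k) v
        rw [hπ k v]
        exact (hκ'd k (π v)).trans (by rw [hv])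
      · change κ' (π (indGen n θ lam α h a x)) = indGen n θ lam α h a x
        rw [hπ1, hκ'1]
    intro v
    have hv : v ∈ LinearMap.eqLocus (κ'.comp π) LinearMap.id := this ▸ Submodule.mem_top
    exact hv
  -- Injectivity came from the left inverse, checked on generators of the induced module;
  -- surjectivity holds because the image contains 1 ⊗ x ⊗ v for all x.
  have hsurj : LinearMap.range π = ⊤ := by
    refine target_eq_top θ hn' (aExt_eq_zero n a) lam α h ?_ fun x => ⟨_, hπ1 x⟩
    rintro k _ ⟨v, rfl⟩
    exact ⟨_, hπ k v⟩
  exact ⟨LinearEquiv.ofBijective π ⟨Function.LeftInverse.injective hleft,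
    LinearMap.range_eq_top.1 hsurj⟩, hπ⟩

/-- A subspace of the induced module stable under all `d k`, as a Lie submodule. -/
def toLieSubmodule (N : Submodule ℂ (IndMod n θ lam α h a))
    (hN : ∀ k, ∀ v ∈ N, indRep n θ lam α h a (d k) v ∈ N) :
    LieSubmodule ℂ Vir (IndMod n θ lam α h a) where
  __ := N
  lie_mem := fun {x v} hv => rep_mem_of_d indRep_hasCharge hN x v hv

instance : Nontrivial (ℂ[X] ⊗[ℂ] (ℂ[X] ⊗[ℂ] Whit n)) :=
  ⟨⟨_, 0, exists_contract_one_tmul_ne_zero one_ne_zero (vac_ne_zero n)⟩⟩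

theorem isIrreducible_ind_iff (hn : 1 ≤ n) :
    LieModule.IsIrreducible ℂ Vir (IndMod n θ lam α h a) ↔
      ∀ N : Submodule ℂ (ℂ[X] ⊗[ℂ] (ℂ[X] ⊗[ℂ] Whit n)),
        (∀ k, ∀ u ∈ N, modelRep n θ lam α h a hn (d k) u ∈ N) → N ≠ ⊥ → N = ⊤ := by
  obtain ⟨e, he⟩ := exists_ind_equiv (n := n) (θ := θ) (lam := lam) (α := α) (h := h) (a := a) hn
  constructor
  · intro hirr N hN hN0
    have hstab : ∀ k, ∀ v ∈ N.comap e.toLinearMap,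
        indRep n θ lam α h a (d k) v ∈ N.comap e.toLinearMap := by
      intro k v hv
      have := hN k _ hv
      rw [Submodule.mem_comap, LinearEquiv.coe_coe, he]
      exact this
    rcases eq_bot_or_eq_top (toLieSubmodule _ hstab) with h0 | h1
    · refine absurd ?_ hN0
      rw [eq_bot_iff]
      intro u hu
      have : e.symm u ∈ toLieSubmodule _ hstab := by
        change e (e.symm u) ∈ N
        rwa [e.apply_symm_apply]
      rw [h0, LieSubmodule.mem_bot] at this
      rw [Submodule.mem_bot, ← e.apply_symm_apply u, this, map_zero]
    · rw [Submodule.eq_top_iff']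
      intro u
      have : e.symm u ∈ toLieSubmodule _ hstab := h1 ▸ LieSubmodule.mem_top _
      have h2 : e (e.symm u) ∈ N := this
      rwa [e.apply_symm_apply] at h2
  · intro hirr
    have : Nontrivial (IndMod n θ lam α h a) := e.toEquiv.nontrivial
    refine LieModule.IsIrreducible.mk fun N hN0 => ?_
    have hmap := hirr (N.toSubmodule.map e.toLinearMap) (by
      rintro k _ ⟨v, hv, rfl⟩
      exact ⟨_, N.lie_mem (x := d k) hv, he k v⟩) (by
      refine fun h0 => hN0 ((LieSubmodule.eq_bot_iff N).2 fun v hv => ?_)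
      have : e v ∈ N.toSubmodule.map e.toLinearMap := ⟨v, hv, rfl⟩
      rwa [h0, Submodule.mem_bot, map_eq_zero_iff e e.injective] at this)
    rw [← LieSubmodule.toSubmodule_eq_top, Submodule.eq_top_iff']
    intro v
    have : e v ∈ N.toSubmodule.map e.toLinearMap := hmap ▸ Submodule.mem_top
    obtain ⟨v', hv', h'⟩ := this
    rwa [← e.injective h']

/-- Carrying `d k` through a fixed word only produces some `d m` with m - k bounded, and these kill
the generator once m > 2n. -/
theorem whitRep_eventually_zero {n : ℤ} {a : ℤ → ℂ} (hn : 1 ≤ n) (ha : ∀ k, 2 * n < k → a k = 0)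
    (w : Whit n) : ∃ K : ℤ, ∀ k, K ≤ k → whitRep θ hn ha (d k) w = 0 := by
  have hmono : ∀ u : List ℤ, ∃ K : ℤ, ∀ k, K ≤ k →
      whitRep θ hn ha (d k) (mono (whitRep θ hn ha) (vac n) u) = 0 := by
    intro u
    induction u with
    | nil => exact ⟨2 * n + 1, fun k hk => by
        rw [mono_nil, whitRep_vac θ hn ha (by omega), ha k (by omega), zero_smul]⟩
    | cons i u ih =>
      obtain ⟨K, hK⟩ := ih
      refine ⟨max (max K (K - i)) (1 - i), fun k hk => ?_⟩
      rw [mono_cons, rep_d_comm (whitRep_hasCharge θ hn ha), hK k (by omega),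
        hK (k + i) (by omega), cocyc, if_neg (by omega)]
      simp
  rw [← sum_mono_incl θ hn ha w, Finsupp.linearCombination_apply, Finsupp.sum]
  choose K hK using hmono
  obtain ⟨B, hB⟩ := ((Whit.incl n w).support.image K).bddAbove
  refine ⟨B, fun k hk => ?_⟩
  rw [map_sum]
  refine Finset.sum_eq_zero fun u hu => ?_
  rw [map_smul, hK u k ((hB (Finset.mem_image_of_mem K hu)).trans hk), smul_zero]

theorem lTensorRep_eventually_zero {n : ℤ} {a : ℤ → ℂ} (hn : 1 ≤ n)
    (ha : ∀ k, 2 * n < k → a k = 0) (z : ℂ[X] ⊗[ℂ] Whit n) :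
    ∃ K : ℤ, ∀ k, K ≤ k → lTensorRep (whitRep_hasCharge θ hn ha) (d k) z = 0 := by
  simp only [lTensorRep_d]
  exact exists_bound_map_eq_zero (whitRep_eventually_zero hn ha) z

end Iso

/-- The induced module is irreducible if and only if `deg h = 1`, `α ≠ 0` and `a (2 n - 1)` or
`a (2 n)` is nonzero. -/
theorem isIrreducible_indMod_iff (n : ℕ) (hn : 1 ≤ n) (θ : ℂ) (lam : ℂˣ) (α : ℂ) (h : Polynomial ℂ)
    (a : ℤ → ℂ) :
    LieModule.IsIrreducible ℂ Vir (IndMod n θ lam α h a) ↔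
      h.natDegree = 1 ∧ α ≠ 0 ∧ (a (2 * n - 1) ≠ 0 ∨ a (2 * n) ≠ 0) := by
  have hn' : (1 : ℤ) ≤ n := by exact_mod_cast hn
  have ha := aExt_eq_zero n a
  have e1 : aExt n a (2 * n - 1) = a (2 * n - 1) := if_pos (by omega)
  have e2 : aExt n a (2 * n) = a (2 * n) := if_pos le_rfl
  rw [isIrreducible_ind_iff hn]
  have hW0 : (⊤ : Submodule ℂ (Whit n)) ≠ ⊥ := fun h0 =>
    vac_ne_zero n ((Submodule.mem_bot ℂ).1 (h0 ▸ Submodule.mem_top))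
  have : Nontrivial (Whit n) := ⟨⟨_, 0, vac_ne_zero n⟩⟩
  constructor
  · intro hirr
    have hX : ¬(h.natDegree ≠ 1 ∨ α = 0) := by
      intro hX
      obtain ⟨Y, hY, hY0, hY1⟩ := exists_invariant_polynomials hX
      obtain ⟨N, hN, hN0, hN1⟩ := exists_invariant_target lam α h (whitRep_hasCharge θ hn' ha) hY hY0
        (W' := ⊤) (fun _ _ _ => Submodule.mem_top) hW0 (Or.inl hY1)
      exact hN1 (hirr N hN hN0)
    have hW : ¬(a (2 * n - 1) = 0 ∧ a (2 * n) = 0) := by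
      rintro ⟨h1, h2⟩
      obtain ⟨W', hW', hW0', hW1⟩ := whit_reducible θ hn' ha (e1.trans h1) (e2.trans h2)
      obtain ⟨N, hN, hN0, hN1⟩ := exists_invariant_target lam α h (whitRep_hasCharge θ hn' ha)
        (Y := ⊤) (fun _ _ _ => Submodule.mem_top) top_ne_bot hW' hW0' (Or.inr hW1)
      exact hN1 (hirr N hN hN0)
    tauto
  · rintro ⟨hh, hα, ha2⟩ N hN hN0
    rw [← e1, ← e2] at ha2
    refine tens_irreducible (lam := lam) (α := α) (F := tF α h (Whit n)) (G := tG α h (Whit n))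
      (lTensorRep_eventually_zero (θ := θ) hn' ha) ?_ hα
      (tF_injective hh) (fun Y hF hG hρ hY0 => polyTensor_irreducible hh _
        (fun W' hW' hW0' => whit_irreducible θ hn' ha ha2 hW' hW0') Y hF hG hρ hY0) hN0
    intro k u hu
    have := hN k u hu
    rwa [modelRep, targetRep_d] at this

end VirInd

end

theorem corollary5p3 (n : ℕ) (hn : 1 ≤ n) (θ : ℂ) (lam : ℂˣ) (α : ℂ) (h : Polynomial ℂ)
    (a : ℤ → ℂ) :
    LieModule.IsIrreducible ℂ VirInd.Vir (VirInd.IndMod n θ lam α h a) ↔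
      h.natDegree = 1 ∧ α ≠ 0 ∧ (a (2 * n - 1) ≠ 0 ∨ a (2 * n) ≠ 0) :=
  VirInd.isIrreducible_indMod_iff n hn θ lam α h a
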